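/- Let $w:\mathbb R\to[0,\infty)$ be a bounded measurable weight function with $w(t)=w(-t)$ for all $t$, $\int_{\mathbb R} w(t)\,dt<\infty$ and $\int_{\mathbb R} t^2w(t)\,dt<\infty$, and let $L^2=L^2(\mathbb R,\mathcal B,w\,dt)$, with norm $\|f\|_{L^2}=\big(\int_{\mathbb R} f(t)^2w(t)\,dt\big)^{1/2}$ and inner product $\langle f,g\rangle_{L^2}=\int_{\mathbb R} f(t)g(t)w(t)\,dt$. Let $X_1,X_2,\dots$ be i.i.d. random variables with a normal distribution $N(\mu,\sigma^2)$, $\mu\in\mathbb R$, $\sigma^2>0$ (the hypothesis $H_0$). Put $$\overline X_n=\frac1n\sum_{j=1}^nX_j,\qquad S_n^2=\frac1n\sum_{j=1}^n(X_j-\overline X_n)^2,\qquad Y_{n,j}=\frac{X_j-\overline X_n}{S_n},$$ $$Z_n=n\int_{-\infty}^{\infty}\Big|\frac1n\sum_{j=1}^n(iY_{n,j}+t)e^{itY_{n,j}}\Big|^2w(t)\,dt,$$ $$W_n(t)=\frac1{\sqrt n}\sum_{j=1}^n\big[(Y_{n,j}+t)\cos(tY_{n,j})+(t-Y_{n,j})\sin(tY_{n,j})\big],\qquad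 t\in\mathbb R.$$ Then $Z_n=\int_{-\infty}^\infty W_n(t)^2w(t)\,dt$. There is a centred Gaussian random element $W$ of $L^2$ with covariance kernel $$K_Z(s,t)=(st+1)\exp\Big(-\frac{(s-t)^2}2\Big)-(2st+1)\exp\Big(-\frac{s^2+t^2}2\Big),\qquad s,t\in\mathbb R,$$ that is, $\operatorname{Cov}(\langle f,W\rangle_{L^2},\langle g,W\rangle_{L^2})=\int\!\!\int f(s)K_Z(s,t)g(t)\,w(t)\,w(s)\,dt\,ds$ for all $f,g\in L^2$. For every such $W$, as $n\to\infty$, $W_n$ converges in distribution to $W$ in $L^2$, and $$Z_n\xrightarrow{\ d\ }\int_{-\infty}^\infty W(t)^2w(t)\,dt=\|W\|_{L^2}^2 .$$ -/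

import Mathlib

open MeasureTheory ProbabilityTheory Filter
open scoped ENNReal NNReal

namespace NormalityTest

/-- The conditions on the weight function: it is measurable, nonnegative, bounded, even and
integrable; `sq_integrable` says that the functions `W_n` below belong to the weighted `L²`. -/
structure IsWeight (w : ℝ → ℝ) : Prop where
  measurable : Measurable w
  nonneg : ∀ t, 0 ≤ w t
  bounded : ∃ C, ∀ t, w t ≤ C
  even : ∀ t, w (-t) = w t
  integrable : Integrable w volume
  sq_integrable : Integrable (fun t => t ^ 2 * w t) volume

/-- The measure `w dt` on the real line. -/
noncomputable def weightMeasure (w : ℝ → ℝ) : Measure ℝ :=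
  volume.withDensity fun t => ENNReal.ofReal (w t)

/-- The Hilbert space `L²(ℝ, 𝓑, w dt)` of real functions. -/
abbrev L2w (w : ℝ → ℝ) : Type := Lp ℝ 2 (weightMeasure w)

/-- Random elements of `L²` are measurable with respect to the Borel σ-field. -/
noncomputable instance instMeasurableSpaceL2w (w : ℝ → ℝ) : MeasurableSpace (L2w w) := borel (L2w w)

instance instBorelSpaceL2w (w : ℝ → ℝ) : BorelSpace (L2w w) := ⟨rfl⟩

/-! The sample of size `n` is `x 0, …, x (n - 1)`. -/

/-- The sample mean. -/
noncomputable def sampleMean (n : ℕ) (x : ℕ → ℝ) : ℝ :=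
  (1 / (n : ℝ)) * ∑ j ∈ Finset.range n, x j

/-- The sample standard deviation `S_n`, with the factor `1 / n`. -/
noncomputable def sampleSD (n : ℕ) (x : ℕ → ℝ) : ℝ :=
  Real.sqrt ((1 / (n : ℝ)) * ∑ j ∈ Finset.range n, (x j - sampleMean n x) ^ 2)

/-- The scaled residuals `Y_{n,j}`. -/
noncomputable def residual (n : ℕ) (x : ℕ → ℝ) (j : ℕ) : ℝ :=
  (x j - sampleMean n x) / sampleSD n x

/-- The test statistic `Z_n`. -/
noncomputable def testStatistic (w : ℝ → ℝ) (n : ℕ) (x : ℕ → ℝ) : ℝ :=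
  n * ∫ t : ℝ, ‖(1 / (n : ℂ)) * ∑ j ∈ Finset.range n,
    (Complex.I * (residual n x j : ℂ) + (t : ℂ)) *
      Complex.exp (Complex.I * (t : ℂ) * (residual n x j : ℂ))‖ ^ 2 * w t

/-- The function `t ↦ W_n(t)`. -/
noncomputable def residualProcess (n : ℕ) (x : ℕ → ℝ) (t : ℝ) : ℝ :=
  (1 / Real.sqrt n) * ∑ j ∈ Finset.range n,
    ((residual n x j + t) * Real.cos (t * residual n x j)
      + (t - residual n x j) * Real.sin (t * residual n x j))

theorem memLp_residualProcess {w : ℝ → ℝ} (hw : IsWeight w) (n : ℕ) (x : ℕ → ℝ) :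
    MemLp (residualProcess n x) 2 (weightMeasure w) := by
  have hm : Measurable fun t => ENNReal.ofReal (w t) := hw.measurable.ennreal_ofReal
  have hlt : ∀ᵐ t ∂(volume : Measure ℝ), ENNReal.ofReal (w t) < ∞ :=
    ae_of_all _ fun t => ENNReal.ofReal_lt_top
  have key : ∀ g : ℝ → ℝ, Integrable (fun t => g t * w t) volume →
      Integrable g (weightMeasure w) := by
    intro g hg
    rw [weightMeasure, integrable_withDensity_iff hm hlt]
    refine hg.congr (ae_of_all _ fun t => ?_)
    simp [ENNReal.toReal_ofReal (hw.nonneg t)]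
  have hid : MemLp (fun t : ℝ => t) 2 (weightMeasure w) :=
    (memLp_two_iff_integrable_sq measurable_id.aestronglyMeasurable).2 (key _ hw.sq_integrable)
  have hconst : ∀ c : ℝ, MemLp (fun _ : ℝ => c) 2 (weightMeasure w) := fun c =>
    (memLp_two_iff_integrable_sq aestronglyMeasurable_const).2
      (key _ (hw.integrable.const_mul (c ^ 2)))
  have hterm : ∀ y : ℝ, MemLp (fun t : ℝ => (y + t) * Real.cos (t * y)
      + (t - y) * Real.sin (t * y)) 2 (weightMeasure w) := by
    intro y
    have h1 : MemLp (fun t : ℝ => (y + t) * Real.cos (t * y)) 2 (weightMeasure w) := by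
      refine ((hconst y).add hid).mono
        (Continuous.aestronglyMeasurable (by fun_prop)) (ae_of_all _ fun t => ?_)
      rw [norm_mul]
      exact mul_le_of_le_one_right (norm_nonneg _) (Real.abs_cos_le_one _)
    have h2 : MemLp (fun t : ℝ => (t - y) * Real.sin (t * y)) 2 (weightMeasure w) := by
      refine (hid.sub (hconst y)).mono
        (Continuous.aestronglyMeasurable (by fun_prop)) (ae_of_all _ fun t => ?_)
      rw [norm_mul]
      exact mul_le_of_le_one_right (norm_nonneg _) (Real.abs_sin_le_one _)
    exact h1.add h2
  have hsum := memLp_finsetSum (Finset.range n) fun j _ => hterm (residual n x j)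
  exact hsum.const_mul (1 / Real.sqrt n)

/-- `W_n` as an element of `L²(ℝ, 𝓑, w dt)`. -/
noncomputable def residualElement {w : ℝ → ℝ} (hw : IsWeight w) (n : ℕ) (x : ℕ → ℝ) : L2w w :=
  (memLp_residualProcess hw n x).toLp (residualProcess n x)

/-- The covariance kernel `K_Z`. -/
noncomputable def kernelZ (s t : ℝ) : ℝ :=
  (s * t + 1) * Real.exp (-(s - t) ^ 2 / 2)
    - (2 * s * t + 1) * Real.exp (-(s ^ 2 + t ^ 2) / 2)

/-- `W` is a centred Gaussian random element of `L²(ℝ, 𝓑, w dt)` with covariance kernel `K`: its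
covariance operator is the integral operator with kernel `K`, that is,
`Cov(⟨f, W⟩, ⟨g, W⟩) = ∫ ∫ f(s) K(s, t) g(t) w(t) w(s) dt ds` for all `f` and `g` in `L²`. -/
structure IsCentredGaussianWithKernel {w : ℝ → ℝ} {Ω : Type*} [MeasurableSpace Ω]
    (W : Ω → L2w w) (P : Measure Ω) (K : ℝ → ℝ → ℝ) : Prop where
  gaussian : HasGaussianLaw W P
  centred : ∀ f : L2w w, ∫ ω, inner ℝ f (W ω) ∂P = 0
  covariance_eq : ∀ f g : L2w w,
    covariance (fun ω => inner ℝ f (W ω)) (fun ω => inner ℝ g (W ω)) P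
      = ∫ s, ∫ t, f s * K s t * g t ∂(weightMeasure w) ∂(weightMeasure w)

end NormalityTest

/-!
Write `g_t(y) = (y + t) cos(ty) + (t - y) sin(ty)`, so that `W_n(t) = n⁻¹ᐟ² ∑ g_t(Y_{n,j})`. The
real and the imaginary part of the sum in `Z_n` are an odd and an even function of `t`, and `W_n`
is their normalized sum; since the weight is even, the mixed term integrates to zero and
`Z_n = ‖W_n‖²` (`testStatistic_eq_norm_sq`). Everything thus reduces to the convergence of `W_n`
in the weighted `L²` space, and the residuals are unchanged by affine maps of the data, so the `X_j` may
be taken standard normal (`exists_standardized`, `residualElement_affine`).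

*The linearized process.* Expanding `g_t(Y_{n,j})` about `X_j` to the first order suggests
replacing `W_n(t)` by `V_n(t) = n⁻¹ᐟ² ∑ ξ_t(X_j)` with
`ξ_t(x) = g_t(x) - x e^{-t²/2} + t (x² - 1) e^{-t²/2}`. The `ξ_t(X_j)` are i.i.d. and
centred, and two applications of Gaussian integration by parts to `g_t(y) = y f_t(y) - f_t'(y)`,
`f_t(y) = cos(ty) - sin(ty)`, show that their covariance is `K_Z`
(`integral_linSummand_mul_linSummand`). The central limit theorem in a separable Hilbert space
(`exists_isGaussian_tendsto_inv_sqrt_smul_sum`) then yields both the existence of the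
Gaussian limit and the convergence of `V_n`. Its proof combines the one-dimensional theorem,
applied to the characteristic functions, with tightness: projecting a square-integrable vector
onto the complement of a suitable finite-dimensional subspace makes its second moment small, hence
also that of the normalized sums. A Gaussian measure is determined by its mean and covariance, so
the law of every `W` as in the theorem is the limit (`IsCentredGaussianWithKernel.map_eq`).

*The error `‖W_n - V_n‖`.* For `|t| ≤ T` the second-order Taylor formula bounds
`(W_n(t) - V_n(t))²` by `C_T / n` times an expression in normalized sums of centred variables and in
the empirical fourth moment (`sq_residualProcess_sub_linProcess_le`), and these are bounded in
probability. For `|t| > T` the expansion is of no use, because its constants grow too fast in `t`: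
only the second moment of `w` is assumed finite. There the bound `E W_n(t)² ≤ C (1 + t²)`,
uniform in `n`, is needed (`lintegral_sq_residualProcess_le`). It comes from symmetry. The law of
the residual vector is invariant under the rotations that fix the vector `1`, and it is carried by
the sphere `∑ y = 0`, `∑ y² = n` (`IsResidualLaw`). Differentiating this invariance along the
rotations of three coordinates gives an integration by parts formula on the sphere
(`IsResidualLaw.integral_rotation`). Used for `g_t(y_a) = y_a f_t(y_a) - f_t'(y_a)` with the
coordinate `d` held fixed, it shows that `E g_t(Y_a) g_t(Y_d)` is of order `(1 + t²) / n` for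
`a ≠ d`.
-/

namespace NormalityTest

/-! ### Central limit theorem in a separable Hilbert space -/

section HilbertCLT

open Topology

/-- Tightness criterion in a Banach space: the measures are uniformly bounded in probability and
uniformly concentrated near finite-dimensional subspaces. -/
theorem isTightMeasureSet_of_flat {E : Type*} [NormedAddCommGroup E] [NormedSpace ℝ E]
    [CompleteSpace E] [MeasurableSpace E] {S : Set (Measure E)}
    (hbdd : ∀ ε : ℝ≥0∞, 0 < ε → ∃ R : ℝ, ∀ μ ∈ S, μ {x | R < ‖x‖} ≤ ε)
    (hflat : ∀ ε : ℝ≥0∞, 0 < ε → ∀ δ : ℝ, 0 < δ → ∃ U : Submodule ℝ E,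
      FiniteDimensional ℝ U ∧ ∀ μ ∈ S, μ {x | δ < Metric.infDist x U} ≤ ε) :
    IsTightMeasureSet S := by
  rw [isTightMeasureSet_iff_exists_isCompact_measure_compl_le]
  intro ε hε
  obtain ⟨ε', hε', hsum⟩ := ENNReal.exists_pos_sum_of_countable' (ι := ℕ)
    (ENNReal.half_pos hε.ne').ne'
  obtain ⟨R, hR⟩ := hbdd (ε / 2) (ENNReal.half_pos hε.ne')
  have hpos : ∀ m : ℕ, (0 : ℝ) < 1 / ((m : ℝ) + 1) := fun m => by positivity
  choose U hU hUS using fun m : ℕ => hflat (ε' m) (hε' m) (1 / ((m : ℝ) + 1)) (hpos m)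
  set K : Set E := Metric.closedBall 0 R ∩ ⋂ m : ℕ, {x | Metric.infDist x (U m) ≤ 1 / ((m : ℝ) + 1)}
    with hK
  refine ⟨K, ?_, ?_⟩
  · refine TotallyBounded.isCompact_of_isClosed ?_ ?_
    · rw [Metric.totallyBounded_iff]
      intro r hr
      obtain ⟨m, hm⟩ := exists_nat_one_div_lt (half_pos (half_pos hr))
      -- the part of `U m` that matters is a bounded subset of a finite-dimensional space
      have hcomp : IsCompact ((fun u : U m => (u : E)) '' Metric.closedBall 0 (R + r)) := by
        have : ProperSpace (U m) := FiniteDimensional.proper ℝ (U m)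
        exact (isCompact_closedBall _ _).image continuous_subtype_val
      obtain ⟨s, hs, hcov⟩ := Metric.totallyBounded_iff.1 hcomp.totallyBounded (r / 2) (half_pos hr)
      refine ⟨s, hs, fun x hx => ?_⟩
      have hx1 : ‖x‖ ≤ R := by simpa using hx.1
      have hx2 : Metric.infDist x (U m) < r / 2 := by
        have := Set.mem_iInter.1 hx.2 m
        have h3 : Metric.infDist x (U m) ≤ 1 / ((m : ℝ) + 1) := this
        linarith
      obtain ⟨u, hu, hxu⟩ := (Metric.infDist_lt_iff ⟨0, (U m).zero_mem⟩).1 hx2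
      have hun : ‖u‖ ≤ R + r := by
        have h1 : ‖u‖ ≤ ‖x‖ + dist x u := by
          rw [dist_eq_norm, norm_sub_rev]
          calc ‖u‖ = ‖x + (u - x)‖ := by congr 1; abel
            _ ≤ _ := norm_add_le _ _
        linarith
      have hmem : u ∈ (fun u : U m => (u : E)) '' Metric.closedBall 0 (R + r) :=
        ⟨⟨u, hu⟩, by simpa using hun, rfl⟩
      obtain ⟨y, hy, huy⟩ := Set.mem_iUnion₂.1 (hcov hmem)
      refine Set.mem_iUnion₂.2 ⟨y, hy, ?_⟩
      have h5 : dist u y < r / 2 := huy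
      have := dist_triangle x u y
      exact Metric.mem_ball.2 (by linarith)
    · refine Metric.isClosed_closedBall.inter (isClosed_iInter fun m => ?_)
      exact isClosed_le (Metric.continuous_infDist_pt _) continuous_const
  · intro μ hμ
    have hsub : Kᶜ ⊆ {x | R < ‖x‖} ∪ ⋃ m : ℕ, {x | 1 / ((m : ℝ) + 1) < Metric.infDist x (U m)} := by
      intro x hx
      by_contra hcon
      simp only [Set.mem_union, Set.mem_ofPred_eq, Set.mem_iUnion, not_or, not_lt,
        not_exists] at hcon
      exact hx ⟨by simpa using hcon.1, Set.mem_iInter.2 hcon.2⟩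
    calc μ Kᶜ ≤ μ {x | R < ‖x‖} + ∑' m : ℕ, μ {x | 1 / ((m : ℝ) + 1) < Metric.infDist x (U m)} :=
          (measure_mono hsub).trans ((measure_union_le _ _).trans
            (add_le_add le_rfl (measure_iUnion_le _)))
      _ ≤ ε / 2 + ∑' m, ε' m :=
          add_le_add (hR μ hμ) (ENNReal.tsum_le_tsum fun m => hUS m μ hμ)
      _ ≤ ε / 2 + ε / 2 := by gcongr
      _ = ε := ENNReal.add_halves ε

variable {Ω H : Type*} [MeasurableSpace Ω] {P : Measure Ω} [NormedAddCommGroup H]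

/-- Chebyshev's inequality for a random vector. -/
theorem measure_lt_norm_le [IsProbabilityMeasure P] {V : Ω → H} (hV : MemLp V 2 P) {c : ℝ}
    (hc : ∫ ω, ‖V ω‖ ^ 2 ∂P ≤ c) {δ : ℝ} (hδ : 0 < δ) :
    P {ω | δ < ‖V ω‖} ≤ ENNReal.ofReal (c / δ ^ 2) := by
  have hint : Integrable (fun ω => ‖V ω‖ ^ 2) P := hV.integrable_norm_pow (by norm_num)
  have h1 := mul_meas_ge_le_integral_of_nonneg (ae_of_all P fun ω => sq_nonneg ‖V ω‖) hint (δ ^ 2)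
  have h2 : P.real {ω | δ < ‖V ω‖} ≤ P.real {ω | δ ^ 2 ≤ ‖V ω‖ ^ 2} := by
    refine measureReal_mono fun ω hω => ?_
    have h3 : δ < ‖V ω‖ := hω
    exact pow_le_pow_left₀ hδ.le h3.le 2
  have h4 : P.real {ω | δ < ‖V ω‖} ≤ c / δ ^ 2 := by
    rw [le_div_iff₀ (by positivity)]
    nlinarith [sq_nonneg δ, pow_pos hδ 2]
  rw [← ofReal_measureReal]
  exact ENNReal.ofReal_le_ofReal h4

variable [InnerProductSpace ℝ H] [MeasurableSpace H] [BorelSpace H]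

/-- The second moment of a normalized sum of pairwise independent centred vectors: the mixed terms
vanish. -/
theorem integral_norm_sq_inv_sqrt_smul_sum_le [IsProbabilityMeasure P] [CompleteSpace H]
    {η : ℕ → Ω → H} {c : ℝ}
    (hL2 : ∀ i, MemLp (η i) 2 P) (hindep : Pairwise fun i j => IndepFun (η i) (η j) P)
    (h0 : ∀ i, ∫ ω, η i ω ∂P = 0) (hc : ∀ i, ∫ ω, ‖η i ω‖ ^ 2 ∂P ≤ c) (hc0 : 0 ≤ c) (n : ℕ) :
    ∫ ω, ‖(√(n : ℝ))⁻¹ • ∑ k ∈ Finset.range n, η k ω‖ ^ 2 ∂P ≤ c := by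
  have hexp : ∀ ω, ‖(√(n : ℝ))⁻¹ • ∑ k ∈ Finset.range n, η k ω‖ ^ 2
      = (n : ℝ)⁻¹ * ∑ i ∈ Finset.range n, ∑ j ∈ Finset.range n, inner ℝ (η i ω) (η j ω) := by
    intro ω
    rw [norm_smul, mul_pow, ← real_inner_self_eq_norm_sq (∑ k ∈ Finset.range n, η k ω), sum_inner]
    simp_rw [inner_sum]
    congr 1
    rw [norm_inv, Real.norm_of_nonneg (Real.sqrt_nonneg _), inv_pow,
      Real.sq_sqrt (Nat.cast_nonneg n)]
  have hint : ∀ i j, Integrable (fun ω => inner ℝ (η i ω) (η j ω)) P := fun i j => by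
    refine (MemLp.integrable_mul (hL2 i).norm (hL2 j).norm).mono'
      ((hL2 i).1.inner (hL2 j).1) (ae_of_all _ fun ω => ?_)
    exact norm_inner_le_norm _ _
  simp_rw [hexp]
  rw [integral_const_mul,
    integral_finsetSum _ fun i _ => integrable_finsetSum _ fun j _ => hint i j]
  have hcross : ∀ i j, ∫ ω, inner ℝ (η i ω) (η j ω) ∂P ≤ if i = j then c else 0 := by
    intro i j
    split_ifs with hij
    · subst hij
      simp_rw [real_inner_self_eq_norm_sq]
      exact hc i
    · have := (hindep hij).integral_bilin ((hL2 i).integrable (by norm_num))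
        ((hL2 j).integrable (by norm_num)) (innerSL ℝ)
      simp only [h0 i, map_zero, zero_apply] at this
      exact this.le
  have hle : ∑ i ∈ Finset.range n, ∫ ω, ∑ j ∈ Finset.range n, inner ℝ (η i ω) (η j ω) ∂P
      ≤ n * c := by
    calc _ ≤ ∑ i ∈ Finset.range n, c := by
          refine Finset.sum_le_sum fun i hi => ?_
          rw [integral_finsetSum _ fun j _ => hint i j]
          refine (Finset.sum_le_sum fun j _ => hcross i j).trans ?_
          simp [Finset.mem_range.1 hi]
      _ = n * c := by simp
  rcases Nat.eq_zero_or_pos n with rfl | hn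
  · simpa using hc0
  · have hn' : (0 : ℝ) < n := by exact_mod_cast hn
    rw [inv_mul_le_iff₀ hn']
    exact hle

theorem charFun_map_eq_charFun_map_inner {V : Ω → H} (hV : Measurable V) (t : H) :
    charFun (P.map V) t = charFun (P.map fun ω => inner ℝ (V ω) t) 1 := by
  have hm : Measurable fun ω => (inner ℝ (V ω) t : ℝ) :=
    (by fun_prop : Continuous fun x : H => (inner ℝ x t : ℝ)).measurable.comp hV
  rw [charFun_apply, charFun_apply_real, integral_map hV.aemeasurable
    (Continuous.aestronglyMeasurable (by fun_prop)), integral_map hm.aemeasurable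
    (Continuous.aestronglyMeasurable (by fun_prop))]
  simp

variable [IsProbabilityMeasure P] [CompleteSpace H] [SecondCountableTopology H]

/-- The laws of the normalized sums of an i.i.d. centred square-integrable sequence are tight:
project onto the span of the values of a simple function close to `ξ 0`. -/
theorem isTightMeasureSet_inv_sqrt_smul_sum {ξ : ℕ → Ω → H} (hm : ∀ i, Measurable (ξ i))
    (hL2 : MemLp (ξ 0) 2 P) (hident : ∀ i, IdentDistrib (ξ i) (ξ 0) P P) (hindep : iIndepFun ξ P)
    (h0 : ∫ ω, ξ 0 ω ∂P = 0) :
    IsTightMeasureSet (Set.range fun n : ℕ =>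
      P.map fun ω => (√(n : ℝ))⁻¹ • ∑ k ∈ Finset.range n, ξ k ω) := by
  have hL2' : ∀ i, MemLp (ξ i) 2 P := fun i => (hident i).memLp_iff.2 hL2
  have h0' : ∀ i, ∫ ω, ξ i ω ∂P = 0 := fun i => (hident i).integral_eq.trans h0
  have hmV : ∀ n : ℕ, Measurable fun ω => (√(n : ℝ))⁻¹ • ∑ k ∈ Finset.range n, ξ k ω := fun n =>
    (Finset.measurable_sum _ fun k _ => hm k).const_smul _
  have hV2 : ∀ (η : ℕ → Ω → H), (∀ i, MemLp (η i) 2 P) → ∀ n : ℕ,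
      MemLp (fun ω => (√(n : ℝ))⁻¹ • ∑ k ∈ Finset.range n, η k ω) 2 P := fun η hη n =>
    (memLp_finsetSum _ fun k _ => hη k).const_smul _
  refine isTightMeasureSet_of_flat ?_ ?_
  · intro ε hε
    set c := ∫ ω, ‖ξ 0 ω‖ ^ 2 ∂P with hc
    have hc0 : 0 ≤ c := integral_nonneg fun ω => sq_nonneg _
    have hlim : Tendsto (fun R : ℝ => ENNReal.ofReal (c / R ^ 2)) atTop (𝓝 0) := by
      rw [← ENNReal.ofReal_zero]
      exact ENNReal.tendsto_ofReal (tendsto_const_nhds.div_atTop (tendsto_pow_atTop (by norm_num)))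
    obtain ⟨R, hR0, hR⟩ := ((eventually_gt_atTop (0 : ℝ)).and (hlim.eventually_le_const hε)).exists
    refine ⟨R, ?_⟩
    rintro _ ⟨n, rfl⟩
    dsimp only
    rw [Measure.map_apply (hmV n) (measurableSet_lt measurable_const measurable_norm)]
    refine le_trans ?_ hR
    refine measure_lt_norm_le (hV2 ξ hL2' n) ?_ hR0
    refine integral_norm_sq_inv_sqrt_smul_sum_le hL2' (fun i j hij => hindep.indepFun hij) h0'
      (fun i => le_of_eq ?_) hc0 n
    exact ((hident i).comp (u := fun x : H => ‖x‖ ^ 2) (by fun_prop)).integral_eq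
  · intro ε hε δ hδ
    obtain ⟨τ, hτ0, hτ⟩ : ∃ τ : ℝ, 0 < τ ∧ ENNReal.ofReal (τ ^ 2 / δ ^ 2) ≤ ε := by
      have hlim : Tendsto (fun τ : ℝ => ENNReal.ofReal (τ ^ 2 / δ ^ 2)) (𝓝[>] 0) (𝓝 0) := by
        rw [← ENNReal.ofReal_zero]
        refine ENNReal.tendsto_ofReal (tendsto_nhdsWithin_of_tendsto_nhds ?_)
        have : Continuous fun τ : ℝ => τ ^ 2 / δ ^ 2 := by fun_prop
        simpa using this.tendsto 0
      obtain ⟨τ, h1, h2⟩ := ((eventually_mem_nhdsWithin (a := (0 : ℝ)) (s := Set.Ioi 0)).and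
        (hlim.eventually_le_const hε)).exists
      exact ⟨τ, h1, h2⟩
    obtain ⟨s, hs, hs2⟩ := hL2.exists_simpleFunc_eLpNorm_sub_lt (by norm_num)
      (ε := ENNReal.ofReal τ) (by simpa using hτ0)
    have hfin : FiniteDimensional ℝ (Submodule.span ℝ (Set.range s)) :=
      FiniteDimensional.span_of_finite ℝ s.finite_range
    set U := Submodule.span ℝ (Set.range s) with hU
    refine ⟨U, hfin, ?_⟩
    rintro _ ⟨n, rfl⟩
    dsimp only
    rw [Measure.map_apply (hmV n) (measurableSet_lt measurable_const
      (Metric.continuous_infDist_pt _).measurable)]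
    refine le_trans ?_ hτ
    -- `T` removes the component in `U`; the `T (ξ i)` have second moment at most `τ ^ 2`
    set T : H →L[ℝ] H := ContinuousLinearMap.id ℝ H - U.starProjection with hT
    have hsub : (fun ω => (√(n : ℝ))⁻¹ • ∑ k ∈ Finset.range n, ξ k ω) ⁻¹'
          {x | δ < Metric.infDist x U}
        ⊆ {ω | δ < ‖(√(n : ℝ))⁻¹ • ∑ k ∈ Finset.range n, T (ξ k ω)‖} := by
      intro ω hω
      have h1 : δ < Metric.infDist ((√(n : ℝ))⁻¹ • ∑ k ∈ Finset.range n, ξ k ω) U := hω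
      refine h1.trans_le ?_
      rw [← map_sum, ← map_smul]
      refine (Metric.infDist_le_dist_of_mem (U.starProjection_apply_mem
        ((√(n : ℝ))⁻¹ • ∑ k ∈ Finset.range n, ξ k ω))).trans ?_
      rw [dist_eq_norm]
      rfl
    refine (measure_mono hsub).trans ?_
    have hTL2 : ∀ i, MemLp (fun ω => T (ξ i ω)) 2 P := fun i => T.comp_memLp' (hL2' i)
    refine measure_lt_norm_le (hV2 (fun i ω => T (ξ i ω)) hTL2 n) ?_ hδ
    refine integral_norm_sq_inv_sqrt_smul_sum_le (η := fun i ω => T (ξ i ω)) hTL2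
      (fun i j hij => (hindep.indepFun hij).comp T.continuous.measurable T.continuous.measurable)
      (fun i => ?_) (fun i => ?_) (sq_nonneg τ) n
    · rw [T.integral_comp_comm ((hL2' i).integrable (by norm_num)), h0' i, map_zero]
    · have h1 : ∫ ω, ‖T (ξ i ω)‖ ^ 2 ∂P = ∫ ω, ‖T (ξ 0 ω)‖ ^ 2 ∂P :=
        ((hident i).comp (u := fun x : H => ‖T x‖ ^ 2)
          (by fun_prop : Continuous fun x : H => ‖T x‖ ^ 2).measurable).integral_eq
      rw [h1]
      have hd : MemLp (ξ 0 - ⇑s) 2 P := hL2.sub hs2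
      have h2 : ∫ ω, ‖T (ξ 0 ω)‖ ^ 2 ∂P ≤ ∫ ω, ‖(ξ 0 - ⇑s) ω‖ ^ 2 ∂P := by
        refine integral_mono ((hTL2 0).integrable_norm_pow (by norm_num))
          (hd.integrable_norm_pow (by norm_num)) fun ω => ?_
        refine pow_le_pow_left₀ (norm_nonneg _) ?_ 2
        have h3 : ‖ξ 0 ω - U.starProjection (ξ 0 ω)‖ ≤ ‖ξ 0 ω - s ω‖ := by
          rw [Submodule.starProjection_minimal]
          exact ciInf_le ⟨0, by rintro _ ⟨y, rfl⟩; exact norm_nonneg _⟩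
            (⟨s ω, Submodule.subset_span ⟨ω, rfl⟩⟩ : U)
        exact h3
      refine h2.trans ?_
      have h4 : (eLpNorm (ξ 0 - ⇑s) 2 P).toReal ≤ τ :=
        ENNReal.toReal_le_of_le_ofReal hτ0.le hs.le
      rw [hd.eLpNorm_eq_integral_rpow_norm (by norm_num) (by norm_num),
        ENNReal.toReal_ofReal (by positivity)] at h4
      simp only [ENNReal.toReal_ofNat, Real.rpow_two] at h4
      rw [← one_div, ← Real.sqrt_eq_rpow] at h4
      exact (Real.sqrt_le_left hτ0.le).1 h4

/-- **Central limit theorem** in a separable Hilbert space. The limit law is given as a Gaussian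
measure with the mean and the covariance of the summands; its existence is part of the claim and
follows from tightness. The laws of the normalized sums are passed as a sequence `V` in the type of
probability measures. -/
theorem exists_isGaussian_tendsto_inv_sqrt_smul_sum {ξ : ℕ → Ω → H} (hm : ∀ i, Measurable (ξ i))
    (hL2 : MemLp (ξ 0) 2 P) (hident : ∀ i, IdentDistrib (ξ i) (ξ 0) P P) (hindep : iIndepFun ξ P)
    (h0 : ∫ ω, ξ 0 ω ∂P = 0) :
    ∃ μ : ProbabilityMeasure H, IsGaussian (μ : Measure H) ∧ ∫ x, x ∂(μ : Measure H) = 0 ∧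
      covarianceBilin (μ : Measure H) = covarianceBilin (P.map (ξ 0)) ∧
      ∀ V : ℕ → ProbabilityMeasure H,
        (∀ n : ℕ, (V n : Measure H) = P.map fun ω => (√(n : ℝ))⁻¹ • ∑ k ∈ Finset.range n, ξ k ω) →
        Tendsto V atTop (𝓝 μ) := by
  have hmV : ∀ n : ℕ, Measurable fun ω => (√(n : ℝ))⁻¹ • ∑ k ∈ Finset.range n, ξ k ω := fun n =>
    (Finset.measurable_sum _ fun k _ => hm k).const_smul _
  have : IsProbabilityMeasure (P.map (ξ 0)) := Measure.isProbabilityMeasure_map (hm 0).aemeasurable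
  have hid : MemLp id 2 (P.map (ξ 0)) :=
    (memLp_map_measure_iff aestronglyMeasurable_id (hm 0).aemeasurable).2 hL2
  set V : ℕ → ProbabilityMeasure H := fun n =>
    ⟨P.map fun ω => (√(n : ℝ))⁻¹ • ∑ k ∈ Finset.range n, ξ k ω,
      Measure.isProbabilityMeasure_map (hmV n).aemeasurable⟩ with hV
  have htight : IsTightMeasureSet {(V n : Measure H) | n} :=
    isTightMeasureSet_inv_sqrt_smul_sum hm hL2 hident hindep h0
  -- the one-dimensional central limit theorem gives the limit of the characteristic functions
  have hchar : ∀ t : H, Tendsto (fun n => charFun (V n : Measure H) t) atTop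
      (𝓝 (Complex.exp (-((covarianceBilin (P.map (ξ 0)) t t : ℝ) : ℂ) / 2))) := by
    intro t
    have hc : Continuous fun x : H => (inner ℝ x t : ℝ) := by fun_prop
    have hmt : ∀ i, Measurable fun ω => (inner ℝ (ξ i ω) t : ℝ) := fun i =>
      hc.measurable.comp (hm i)
    have hmean : ∫ ω, (inner ℝ (ξ 0 ω) t : ℝ) ∂P = 0 := by
      simp_rw [real_inner_comm]
      rw [integral_inner (hL2.integrable (by norm_num)), h0, inner_zero_right]
    have hvar : Var[fun ω => (inner ℝ (ξ 0 ω) t : ℝ); P] = covarianceBilin (P.map (ξ 0)) t t := by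
      rw [covarianceBilin_self hid, variance_map
        (by fun_prop : Continuous fun x : H => (inner ℝ t x : ℝ)).measurable.aemeasurable
        (hm 0).aemeasurable]
      simp_rw [Function.comp_def, real_inner_comm]
    have hclt := tendstoInDistribution_inv_sqrt_mul_sum_sub (P := P)
      (P' := gaussianReal 0 Var[fun ω => (inner ℝ (ξ 0 ω) t : ℝ); P].toNNReal) (Y := id)
      (X := fun i ω => (inner ℝ (ξ i ω) t : ℝ)) ⟨aemeasurable_id, Measure.map_id⟩
      (hL2.inner_const t) (hindep.comp (fun _ x => inner ℝ x t) fun _ => hc.measurable)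
      (fun i => (hident i).comp hc.measurable)
    have h1 := ProbabilityMeasure.tendsto_iff_tendsto_charFun.1 hclt.tendsto 1
    simp only [ProbabilityMeasure.coe_mk, Measure.map_id, charFun_gaussianReal, hmean, hvar] at h1
    have hnn : 0 ≤ covarianceBilin (P.map (ξ 0)) t t := hvar ▸ variance_nonneg _ _
    convert h1 using 2 with n
    · rw [hV, ProbabilityMeasure.coe_mk, charFun_map_eq_charFun_map_inner (hmV n)]
      simp [inner_smul_left, sum_inner]
    · simp [hnn, neg_div]
  -- a limit point of the tight sequence has the limiting characteristic function, so it is the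
  -- Gaussian measure in question
  have hcomp : IsCompact (closure (Set.range V)) :=
    isCompact_closure_of_isTightMeasureSet (by simpa using htight)
  obtain ⟨μ, -, hμ⟩ := hcomp.ultrafilter_le_nhds (Ultrafilter.map V (Ultrafilter.of atTop))
    (.trans (by simp) (monotone_principal subset_closure))
  have hμ' : Tendsto V (Ultrafilter.of (atTop : Filter ℕ)) (𝓝 μ) := hμ
  have hcharμ : ∀ t : H, charFun (μ : Measure H) t
      = Complex.exp (-((covarianceBilin (P.map (ξ 0)) t t : ℝ) : ℂ) / 2) := by
    intro t
    refine tendsto_nhds_unique ?_ ((hchar t).mono_left (Ultrafilter.of_le atTop))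
    rw [ProbabilityMeasure.tendsto_iff_forall_integral_rclike_tendsto ℂ] at hμ'
    simp_rw [charFun_eq_integral_innerProbChar]
    exact hμ' _
  have hcharμ' : ∀ t : H, charFun (μ : Measure H) t
      = Complex.exp ((inner ℝ t (0 : H) : ℝ) * Complex.I
        - ((covarianceBilin (P.map (ξ 0)) t t : ℝ) : ℂ) / 2) := fun t => by
    rw [hcharμ t]; simp [neg_div]
  have hcov := gaussian_charFun_congr 0 _ isPosSemidef_covarianceBilin hcharμ'
  refine ⟨μ, isGaussian_iff_gaussian_charFun.2 ⟨0, _, isPosSemidef_covarianceBilin, hcharμ'⟩,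
    hcov.1.symm, hcov.2.symm, fun V' hV' => ?_⟩
  have hVV' : V' = V := funext fun n => Subtype.ext (hV' n)
  rw [hVV']
  refine ProbabilityMeasure.tendsto_of_tight_of_separatesPoints htight (𝕜 := ℂ)
    (A := BoundedContinuousFunction.charPoly Real.continuous_probChar (L := innerₗ H)
      continuous_inner) ?_ ?_
  · refine BoundedContinuousFunction.separatesPoints_charPoly Real.continuous_probChar
      Real.probChar_ne_one _ ?_
    exact fun v hv => DFunLike.ne_iff.mpr ⟨v, inner_self_ne_zero.mpr hv⟩
  · exact fun g => ProbabilityMeasure.tendsto_charPoly_of_tendsto_charFun fun t => by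
      rw [hcharμ t]; exact hchar t

end HilbertCLT

/-! ### Gaussian integration by parts on the line -/

section Stein

/-- Continuous functions of at most polynomial growth. -/
def PolyGrowth (F : ℝ → ℝ) : Prop :=
  Continuous F ∧ ∃ C : ℝ, ∃ k : ℕ, 0 ≤ C ∧ ∀ x, |F x| ≤ C * (1 + |x|) ^ k

namespace PolyGrowth

theorem of_bounded {F : ℝ → ℝ} (hF : Continuous F) {C : ℝ} (hC : ∀ x, |F x| ≤ C) :
    PolyGrowth F :=
  ⟨hF, C, 0, (abs_nonneg _).trans (hC 0), fun x => by simpa using hC x⟩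

theorem const (c : ℝ) : PolyGrowth fun _ => c := of_bounded continuous_const fun _ => le_rfl

theorem id : PolyGrowth fun x => x :=
  ⟨continuous_id, 1, 1, zero_le_one, fun x => by simp⟩

theorem cos (t : ℝ) : PolyGrowth fun x => Real.cos (t * x) :=
  of_bounded (by fun_prop) fun _ => Real.abs_cos_le_one _

theorem sin (t : ℝ) : PolyGrowth fun x => Real.sin (t * x) :=
  of_bounded (by fun_prop) fun _ => Real.abs_sin_le_one _

variable {F G : ℝ → ℝ}

theorem mul (hF : PolyGrowth F) (hG : PolyGrowth G) : PolyGrowth fun x => F x * G x := by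
  obtain ⟨hFc, C, k, hC, hFb⟩ := hF
  obtain ⟨hGc, D, l, hD, hGb⟩ := hG
  refine ⟨hFc.mul hGc, C * D, k + l, mul_nonneg hC hD, fun x => ?_⟩
  rw [abs_mul, pow_add]
  calc |F x| * |G x| ≤ (C * (1 + |x|) ^ k) * (D * (1 + |x|) ^ l) :=
        mul_le_mul (hFb x) (hGb x) (abs_nonneg _) (by positivity)
    _ = _ := by ring

theorem add (hF : PolyGrowth F) (hG : PolyGrowth G) : PolyGrowth fun x => F x + G x := by
  obtain ⟨hFc, C, k, hC, hFb⟩ := hF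
  obtain ⟨hGc, D, l, hD, hGb⟩ := hG
  refine ⟨hFc.add hGc, C + D, k + l, add_nonneg hC hD, fun x => ?_⟩
  have h1 : (1 : ℝ) ≤ 1 + |x| := le_add_of_nonneg_right (abs_nonneg x)
  calc |F x + G x| ≤ |F x| + |G x| := abs_add_le _ _
    _ ≤ C * (1 + |x|) ^ k + D * (1 + |x|) ^ l := add_le_add (hFb x) (hGb x)
    _ ≤ C * (1 + |x|) ^ (k + l) + D * (1 + |x|) ^ (k + l) := by
        gcongr <;> first | exact h1 | omega
    _ = _ := by ring

theorem const_mul (c : ℝ) (hF : PolyGrowth F) : PolyGrowth fun x => c * F x := (const c).mul hF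

theorem sub (hF : PolyGrowth F) (hG : PolyGrowth G) : PolyGrowth fun x => F x - G x := by
  simpa [sub_eq_add_neg] using hF.add (hG.const_mul (-1))

theorem pow (hF : PolyGrowth F) (k : ℕ) : PolyGrowth fun x => F x ^ k := by
  induction k with
  | zero => simpa using const 1
  | succ k ih => simpa [pow_succ] using ih.mul hF

theorem integrable (hF : PolyGrowth F) : Integrable F (gaussianReal 0 1) := by
  obtain ⟨hFc, C, k, hC, hFb⟩ := hF
  have hid : MemLp (fun x : ℝ => x) k (gaussianReal 0 1) := by
    have h := memLp_id_gaussianReal (μ := 0) (v := 1) (k : ℝ≥0)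
    rw [ENNReal.coe_natCast] at h
    exact h
  have habs : MemLp (fun x : ℝ => |x|) k (gaussianReal 0 1) := hid.norm
  have hone : MemLp (fun _ : ℝ => (1 : ℝ)) k (gaussianReal 0 1) := memLp_const 1
  have h1 : MemLp (fun x : ℝ => 1 + |x|) k (gaussianReal 0 1) := hone.add habs
  have h2 : Integrable (fun x : ℝ => ‖1 + |x|‖ ^ k) (gaussianReal 0 1) := h1.integrable_norm_pow'
  refine (h2.const_mul C).mono' hFc.aestronglyMeasurable
    (ae_of_all _ fun x => ?_)
  rw [Real.norm_eq_abs, Real.norm_of_nonneg (by positivity)]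
  exact hFb x

theorem integrable_mul_pdf (hF : PolyGrowth F) :
    Integrable (fun x => F x * gaussianPDFReal 0 1 x) volume := by
  have h := hF.integrable
  rw [gaussianReal_of_var_ne_zero 0 one_ne_zero, integrable_withDensity_iff
    (measurable_gaussianPDF 0 1) (ae_of_all _ fun x => gaussianPDF_lt_top)] at h
  simpa [toReal_gaussianPDF] using h

end PolyGrowth

theorem hasDerivAt_gaussianPDFReal (x : ℝ) :
    HasDerivAt (gaussianPDFReal 0 1) (-x * gaussianPDFReal 0 1 x) x := by
  have h1 : HasDerivAt (fun x : ℝ => -(x - 0) ^ 2 / (2 * ((1 : ℝ≥0) : ℝ))) (-x) x := by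
    have := (((hasDerivAt_id x).sub_const 0).pow 2).neg.div_const (2 * ((1 : ℝ≥0) : ℝ))
    exact this.congr_deriv (by simp; ring)
  have h2 := h1.exp.const_mul (√(2 * Real.pi * ((1 : ℝ≥0) : ℝ)))⁻¹
  rw [gaussianPDFReal_def]
  exact h2.congr_deriv (by ring)

/-- Gaussian integration by parts (Stein's identity). -/
theorem integral_id_mul_gaussianReal {F F' : ℝ → ℝ} (hF : PolyGrowth F) (hF' : PolyGrowth F')
    (hd : ∀ x, HasDerivAt F (F' x) x) :
    ∫ x, x * F x ∂(gaussianReal 0 1) = ∫ x, F' x ∂(gaussianReal 0 1) := by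
  have h := integral_mul_deriv_eq_deriv_mul_of_integrable (u := F) (u' := F')
    (v := gaussianPDFReal 0 1) (v' := fun x => -x * gaussianPDFReal 0 1 x)
    (fun x _ => hd x) (fun x _ => hasDerivAt_gaussianPDFReal x)
    (by
      have := (((PolyGrowth.id.const_mul (-1)).mul hF)).integrable_mul_pdf
      refine this.congr (ae_of_all _ fun x => ?_)
      simp only [Pi.mul_apply]; ring)
    hF'.integrable_mul_pdf hF.integrable_mul_pdf
  rw [integral_gaussianReal_eq_integral_smul one_ne_zero,
    integral_gaussianReal_eq_integral_smul one_ne_zero]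
  simp only [smul_eq_mul]
  have h2 : ∫ x, gaussianPDFReal 0 1 x * (x * F x) = -∫ x, F x * (-x * gaussianPDFReal 0 1 x) := by
    rw [← integral_neg]
    exact integral_congr_ae (ae_of_all _ fun x => by ring)
  rw [h2, h, neg_neg]
  exact integral_congr_ae (ae_of_all _ fun x => by ring)

theorem integral_cos_gaussianReal (t : ℝ) :
    ∫ x, Real.cos (t * x) ∂(gaussianReal 0 1) = Real.exp (-t ^ 2 / 2) := by
  have h := charFun_gaussianReal (μ := 0) (v := 1) t
  rw [charFun_apply_real] at h
  have h2 := congrArg Complex.re h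
  rw [← RCLike.re_eq_complex_re, ← integral_re] at h2
  · have h3 : ∀ x : ℝ, RCLike.re (Complex.exp (t * x * Complex.I)) = Real.cos (t * x) := by
      intro x
      rw [RCLike.re_eq_complex_re, ← Complex.ofReal_mul, Complex.exp_ofReal_mul_I_re]
    simp_rw [h3] at h2
    rw [h2, RCLike.re_eq_complex_re]
    have h4 : (t * ((0 : ℝ) : ℂ) * Complex.I - ((1 : ℝ≥0) : ℝ) * t ^ 2 / 2 : ℂ)
        = ((-t ^ 2 / 2 : ℝ) : ℂ) := by
      push_cast; simp; ring
    rw [h4, Complex.exp_ofReal_re]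
  · refine Integrable.of_bound (Continuous.aestronglyMeasurable (by fun_prop)) 1
      (ae_of_all _ fun x => ?_)
    rw [← Complex.ofReal_mul, Complex.norm_exp_ofReal_mul_I]

theorem integral_sin_gaussianReal (t : ℝ) :
    ∫ x, Real.sin (t * x) ∂(gaussianReal 0 1) = 0 := by
  have h := charFun_gaussianReal (μ := 0) (v := 1) t
  rw [charFun_apply_real] at h
  have h2 := congrArg Complex.im h
  rw [← RCLike.im_eq_complex_im, ← integral_im] at h2
  · have h3 : ∀ x : ℝ, RCLike.im (Complex.exp (t * x * Complex.I)) = Real.sin (t * x) := by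
      intro x
      rw [RCLike.im_eq_complex_im, ← Complex.ofReal_mul, Complex.exp_ofReal_mul_I_im]
    simp_rw [h3] at h2
    rw [h2, RCLike.im_eq_complex_im]
    have h4 : (t * ((0 : ℝ) : ℂ) * Complex.I - ((1 : ℝ≥0) : ℝ) * t ^ 2 / 2 : ℂ)
        = ((-t ^ 2 / 2 : ℝ) : ℂ) := by
      push_cast; simp; ring
    rw [h4, Complex.exp_ofReal_im]
  · refine Integrable.of_bound (Continuous.aestronglyMeasurable (by fun_prop)) 1
      (ae_of_all _ fun x => ?_)
    rw [← Complex.ofReal_mul, Complex.norm_exp_ofReal_mul_I]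

theorem integral_id_gaussianReal_std : ∫ x, x ∂(gaussianReal 0 1) = 0 := by
  simp

theorem integral_sq_gaussianReal : ∫ x, x ^ 2 ∂(gaussianReal 0 1) = 1 := by
  have := integral_id_mul_gaussianReal PolyGrowth.id (PolyGrowth.const 1) fun x => hasDerivAt_id x
  simpa [← sq] using this

theorem integral_cube_gaussianReal : ∫ x, x ^ 3 ∂(gaussianReal 0 1) = 0 := by
  have := integral_id_mul_gaussianReal (PolyGrowth.id.pow 2) (PolyGrowth.id.const_mul 2)
    fun x => by simpa using hasDerivAt_pow 2 x
  rw [integral_const_mul, integral_id_gaussianReal_std, mul_zero] at this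
  refine Eq.trans (integral_congr_ae (ae_of_all _ fun x => ?_)) this
  ring

theorem integral_fourth_gaussianReal : ∫ x, x ^ 4 ∂(gaussianReal 0 1) = 3 := by
  have := integral_id_mul_gaussianReal (PolyGrowth.id.pow 3) ((PolyGrowth.id.pow 2).const_mul 3)
    fun x => by simpa using hasDerivAt_pow 3 x
  rw [integral_const_mul, integral_sq_gaussianReal, mul_one] at this
  refine Eq.trans (integral_congr_ae (ae_of_all _ fun x => ?_)) this
  ring

end Stein

/-! ### The summands of the process and their linearization -/

section Summand

/-- The function `f_t(y) = cos(ty) - sin(ty)`; the summand of `W_n(t)` is its Gaussian divergence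
`y f_t(y) - f_t'(y)`. -/
noncomputable def waveFun (t y : ℝ) : ℝ := Real.cos (t * y) - Real.sin (t * y)

/-- The derivative `f_t'(y)`. -/
noncomputable def waveDeriv (t y : ℝ) : ℝ := -t * (Real.sin (t * y) + Real.cos (t * y))

/-- The summand `g_t(y)` of `W_n(t)`. -/
noncomputable def summand (t y : ℝ) : ℝ :=
  (y + t) * Real.cos (t * y) + (t - y) * Real.sin (t * y)

/-- The derivative `g_t'(y)`. -/
noncomputable def summandDeriv (t y : ℝ) : ℝ :=
  waveFun t y + y * waveDeriv t y + t ^ 2 * waveFun t y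

/-- The second derivative `g_t''(y)`. -/
noncomputable def summandDeriv2 (t y : ℝ) : ℝ :=
  2 * waveDeriv t y - t ^ 2 * y * waveFun t y + t ^ 2 * waveDeriv t y

/-- The summand of the linearized process, when the `X_j` are standard normal: the terms added to
`g_t(x)` account for the estimation of the mean and of the variance. -/
noncomputable def linSummand (t x : ℝ) : ℝ :=
  summand t x - Real.exp (-t ^ 2 / 2) * x + t * Real.exp (-t ^ 2 / 2) * (x ^ 2 - 1)

theorem residualProcess_eq (n : ℕ) (x : ℕ → ℝ) (t : ℝ) :
    residualProcess n x t = (1 / √n) * ∑ j ∈ Finset.range n, summand t (residual n x j) := rfl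

theorem summand_eq (t y : ℝ) : summand t y = y * waveFun t y - waveDeriv t y := by
  unfold summand waveFun waveDeriv; ring

theorem hasDerivAt_waveFun (t y : ℝ) : HasDerivAt (waveFun t) (waveDeriv t y) y := by
  have h1 : HasDerivAt (fun y : ℝ => t * y) t y := by simpa using (hasDerivAt_id y).const_mul t
  have := h1.cos.sub h1.sin
  exact this.congr_deriv (by unfold waveDeriv; ring)

theorem hasDerivAt_waveDeriv (t y : ℝ) : HasDerivAt (waveDeriv t) (-t ^ 2 * waveFun t y) y := by
  have h1 : HasDerivAt (fun y : ℝ => t * y) t y := by simpa using (hasDerivAt_id y).const_mul t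
  have := (h1.sin.add h1.cos).const_mul (-t)
  exact this.congr_deriv (by unfold waveFun; ring)

theorem hasDerivAt_summand (t y : ℝ) : HasDerivAt (summand t) (summandDeriv t y) y := by
  have h := ((hasDerivAt_id y).mul (hasDerivAt_waveFun t y)).sub (hasDerivAt_waveDeriv t y)
  have h2 : summand t = id * waveFun t - waveDeriv t := funext fun y => summand_eq t y
  rw [h2]
  exact h.congr_deriv (by unfold summandDeriv; simp)

theorem hasDerivAt_summandDeriv (t y : ℝ) :
    HasDerivAt (summandDeriv t) (summandDeriv2 t y) y := by
  have h := ((hasDerivAt_waveFun t y).add ((hasDerivAt_id y).mul (hasDerivAt_waveDeriv t y))).add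
    ((hasDerivAt_waveFun t y).const_mul (t ^ 2))
  have h2 : summandDeriv t = waveFun t + id * waveDeriv t + fun y => t ^ 2 * waveFun t y := by
    funext y; rfl
  rw [h2]
  exact h.congr_deriv (by unfold summandDeriv2; simp; ring)

theorem abs_waveFun_le (t y : ℝ) : |waveFun t y| ≤ 2 := by
  unfold waveFun
  exact (abs_sub _ _).trans (by linarith [Real.abs_cos_le_one (t * y), Real.abs_sin_le_one (t * y)])

theorem abs_waveDeriv_le (t y : ℝ) : |waveDeriv t y| ≤ 2 * |t| := by
  unfold waveDeriv
  rw [abs_mul, abs_neg, mul_comm]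
  refine mul_le_mul_of_nonneg_right ((abs_add_le _ _).trans ?_) (abs_nonneg t)
  linarith [Real.abs_cos_le_one (t * y), Real.abs_sin_le_one (t * y)]

theorem abs_summand_le (t y : ℝ) : |summand t y| ≤ 2 * (|t| + |y|) := by
  rw [summand_eq]
  refine (abs_sub _ _).trans ?_
  rw [abs_mul]
  nlinarith [abs_waveFun_le t y, abs_waveDeriv_le t y, abs_nonneg y, abs_nonneg t]

theorem abs_summandDeriv_le (t y : ℝ) : |summandDeriv t y| ≤ 2 * (1 + t ^ 2 + |t| * |y|) := by
  unfold summandDeriv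
  refine (abs_add_le _ _).trans ?_
  refine (add_le_add_left (abs_add_le _ _) _).trans ?_
  rw [abs_mul, abs_mul, abs_of_nonneg (sq_nonneg t)]
  nlinarith [abs_waveFun_le t y, abs_waveDeriv_le t y, abs_nonneg y, abs_nonneg t, sq_nonneg t]

theorem abs_summandDeriv2_le (t y : ℝ) :
    |summandDeriv2 t y| ≤ 4 * |t| + 2 * t ^ 2 * |y| + 2 * t ^ 2 * |t| := by
  unfold summandDeriv2
  refine (abs_add_le _ _).trans ?_
  refine (add_le_add_left (abs_sub _ _) _).trans ?_
  rw [abs_mul, abs_mul, abs_mul, abs_mul, abs_of_nonneg (sq_nonneg t), abs_two]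
  have h1 := mul_le_mul_of_nonneg_left (abs_waveFun_le t y)
    (mul_nonneg (sq_nonneg t) (abs_nonneg y))
  have h2 := mul_le_mul_of_nonneg_left (abs_waveDeriv_le t y) (sq_nonneg t)
  linarith [abs_waveDeriv_le t y]

theorem exp_neg_sq_le_one (t : ℝ) : Real.exp (-t ^ 2 / 2) ≤ 1 :=
  Real.exp_le_one_iff.2 (by nlinarith [sq_nonneg t])

theorem abs_linSummand_le (t x : ℝ) : |linSummand t x| ≤ 3 * (1 + x ^ 2) * (1 + |t|) := by
  unfold linSummand
  have he := exp_neg_sq_le_one t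
  have he0 := (Real.exp_pos (-t ^ 2 / 2)).le
  refine (abs_add_le _ _).trans ?_
  refine (add_le_add_left (abs_sub _ _) _).trans ?_
  rw [abs_mul, abs_mul, abs_mul, abs_of_nonneg he0]
  have h1 := abs_summand_le t x
  have h2 : Real.exp (-t ^ 2 / 2) * |x| ≤ |x| := mul_le_of_le_one_left (abs_nonneg _) he
  have h3 : |x ^ 2 - 1| ≤ x ^ 2 + 1 := by
    rw [abs_le]; constructor <;> nlinarith [sq_nonneg x]
  have h4 : |t| * Real.exp (-t ^ 2 / 2) * |x ^ 2 - 1| ≤ |t| * (x ^ 2 + 1) :=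
    mul_le_mul (mul_le_of_le_one_right (abs_nonneg _) he) h3 (abs_nonneg _) (abs_nonneg _)
  have h5 : 2 * |x| ≤ 1 + x ^ 2 := by nlinarith [sq_abs x, sq_nonneg (|x| - 1)]
  nlinarith [abs_nonneg t, sq_nonneg x, mul_nonneg (abs_nonneg t) (sq_nonneg x)]

theorem PolyGrowth.waveFun (t : ℝ) : PolyGrowth (waveFun t) := (PolyGrowth.cos t).sub (.sin t)

theorem PolyGrowth.waveDeriv (t : ℝ) : PolyGrowth (waveDeriv t) :=
  ((PolyGrowth.sin t).add (.cos t)).const_mul _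

theorem PolyGrowth.summand (t : ℝ) : PolyGrowth (summand t) :=
  ((PolyGrowth.id.add (.const t)).mul (.cos t)).add (((PolyGrowth.const t).sub .id).mul (.sin t))

theorem PolyGrowth.summandDeriv (t : ℝ) : PolyGrowth (summandDeriv t) :=
  ((PolyGrowth.waveFun t).add (PolyGrowth.id.mul (.waveDeriv t))).add
    ((PolyGrowth.waveFun t).const_mul _)

theorem PolyGrowth.linSummand (t : ℝ) : PolyGrowth (linSummand t) :=
  ((PolyGrowth.summand t).sub (PolyGrowth.id.const_mul _)).add
    (((PolyGrowth.id.pow 2).sub (.const 1)).const_mul _)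

local notation "γ" => gaussianReal 0 1

theorem integral_waveFun (t : ℝ) : ∫ y, waveFun t y ∂γ = Real.exp (-t ^ 2 / 2) := by
  unfold waveFun
  rw [integral_sub (PolyGrowth.cos t).integrable (PolyGrowth.sin t).integrable,
    integral_cos_gaussianReal, integral_sin_gaussianReal, sub_zero]

theorem integral_waveDeriv (t : ℝ) : ∫ y, waveDeriv t y ∂γ = -t * Real.exp (-t ^ 2 / 2) := by
  unfold waveDeriv
  rw [integral_const_mul, integral_add (PolyGrowth.sin t).integrable (PolyGrowth.cos t).integrable,
    integral_cos_gaussianReal, integral_sin_gaussianReal, zero_add]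

theorem integral_id_mul_waveFun (t : ℝ) :
    ∫ y, y * waveFun t y ∂γ = -t * Real.exp (-t ^ 2 / 2) := by
  rw [integral_id_mul_gaussianReal (.waveFun t) (.waveDeriv t) (hasDerivAt_waveFun t),
    integral_waveDeriv]

/-- The adjoint form of integration by parts: `y f_t(y) - f_t'(y)` is the Gaussian divergence of
`f_t`. -/
theorem integral_mul_summand {F F' : ℝ → ℝ} (hF : PolyGrowth F) (hF' : PolyGrowth F')
    (hd : ∀ x, HasDerivAt F (F' x) x) (t : ℝ) :
    ∫ y, F y * summand t y ∂γ = ∫ y, F' y * waveFun t y ∂γ := by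
  have h := integral_id_mul_gaussianReal (hF.mul (.waveFun t))
    ((hF'.mul (.waveFun t)).add (hF.mul (.waveDeriv t)))
    fun x => (hd x).mul (hasDerivAt_waveFun t x)
  rw [integral_add (hF'.mul (.waveFun t)).integrable (hF.mul (.waveDeriv t)).integrable] at h
  have h2 : ∀ y, F y * summand t y = y * (F y * waveFun t y) - F y * waveDeriv t y := fun y => by
    rw [summand_eq]; ring
  simp_rw [h2]
  rw [integral_sub (PolyGrowth.id.mul (hF.mul (.waveFun t))).integrable
    (hF.mul (.waveDeriv t)).integrable, h]
  ring

theorem integral_summand (t : ℝ) : ∫ y, summand t y ∂γ = 0 := by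
  simpa using integral_mul_summand (.const 1) (.const 0) (fun x => hasDerivAt_const x 1) t

theorem integral_id_mul_summand (t : ℝ) : ∫ y, y * summand t y ∂γ = Real.exp (-t ^ 2 / 2) := by
  rw [integral_mul_summand .id (.const 1) (fun x => hasDerivAt_id x) t, ← integral_waveFun t]
  simp

theorem integral_sq_mul_summand (t : ℝ) :
    ∫ y, y ^ 2 * summand t y ∂γ = -2 * t * Real.exp (-t ^ 2 / 2) := by
  rw [integral_mul_summand (PolyGrowth.id.pow 2) (PolyGrowth.id.const_mul 2)
    (fun x => by simpa using hasDerivAt_pow 2 x) t]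
  simp_rw [mul_assoc]
  rw [integral_const_mul, integral_id_mul_waveFun]
  ring

theorem integral_summandDeriv (t : ℝ) : ∫ y, summandDeriv t y ∂γ = Real.exp (-t ^ 2 / 2) := by
  rw [← integral_id_mul_gaussianReal (.summand t) (.summandDeriv t) (hasDerivAt_summand t),
    integral_id_mul_summand]

theorem integral_id_mul_summandDeriv (t : ℝ) :
    ∫ y, y * summandDeriv t y ∂γ = -2 * t * Real.exp (-t ^ 2 / 2) := by
  have h := integral_id_mul_gaussianReal (PolyGrowth.id.mul (.summand t))
    (((PolyGrowth.const 1).mul (.summand t)).add (PolyGrowth.id.mul (.summandDeriv t)))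
    fun x => (hasDerivAt_id x).mul (hasDerivAt_summand t x)
  rw [integral_add ((PolyGrowth.const 1).mul (.summand t)).integrable
    (PolyGrowth.id.mul (.summandDeriv t)).integrable] at h
  simp only [one_mul, integral_summand, zero_add] at h
  rw [← h, ← integral_sq_mul_summand]
  exact integral_congr_ae (ae_of_all _ fun x => by ring)

theorem integral_summand_mul_summand (s t : ℝ) :
    ∫ y, summand s y * summand t y ∂γ = (s * t + 1) * Real.exp (-(s - t) ^ 2 / 2) := by
  rw [integral_mul_summand (.summand s) (.summandDeriv s) (hasDerivAt_summand s) t]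
  -- a second integration by parts removes the factor `y` from `g_s'`
  have h := integral_id_mul_gaussianReal ((PolyGrowth.waveDeriv s).mul (.waveFun t))
    ((((PolyGrowth.waveFun s).const_mul (-s ^ 2)).mul (.waveFun t)).add
      ((PolyGrowth.waveDeriv s).mul (.waveDeriv t)))
    fun x => (hasDerivAt_waveDeriv s x).mul (hasDerivAt_waveFun t x)
  have i1 := ((PolyGrowth.waveFun s).mul (.waveFun t)).integrable
  have i2 := ((PolyGrowth.waveDeriv s).mul (.waveDeriv t)).integrable
  have i3 := (PolyGrowth.id.mul ((PolyGrowth.waveDeriv s).mul (.waveFun t))).integrable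
  have h0 : ∀ y, (-s ^ 2 * waveFun s y) * waveFun t y = -s ^ 2 * (waveFun s y * waveFun t y) :=
    fun y => by ring
  simp_rw [h0] at h
  rw [integral_add (i1.const_mul _) i2, integral_const_mul] at h
  have h1 : ∀ y, summandDeriv s y * waveFun t y = (1 + s ^ 2) * (waveFun s y * waveFun t y)
      + y * (waveDeriv s y * waveFun t y) := fun y => by unfold summandDeriv; ring
  simp_rw [h1]
  rw [integral_add (i1.const_mul _) i3, integral_const_mul, h]
  have h2 : ∀ y, waveFun s y * waveFun t y = Real.cos ((s - t) * y) - Real.sin ((s + t) * y) := by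
    intro y
    unfold waveFun
    rw [sub_mul s, add_mul s, Real.cos_sub, Real.sin_add]; ring
  have h3 : ∀ y, waveDeriv s y * waveDeriv t y
      = s * t * (Real.cos ((s - t) * y) + Real.sin ((s + t) * y)) := by
    intro y
    unfold waveDeriv
    rw [sub_mul s, add_mul s, Real.cos_sub, Real.sin_add]; ring
  simp_rw [h2, h3]
  rw [integral_const_mul, integral_sub (PolyGrowth.cos _).integrable (PolyGrowth.sin _).integrable,
    integral_add (PolyGrowth.cos _).integrable (PolyGrowth.sin _).integrable,
    integral_cos_gaussianReal, integral_sin_gaussianReal]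
  ring

theorem integral_linSummand (t : ℝ) : ∫ x, linSummand t x ∂γ = 0 := by
  unfold linSummand
  rw [integral_add (((PolyGrowth.summand t).sub (PolyGrowth.id.const_mul _)).integrable)
    ((((PolyGrowth.id.pow 2).sub (.const 1)).const_mul _).integrable),
    integral_sub (PolyGrowth.summand t).integrable (PolyGrowth.id.const_mul _).integrable,
    integral_const_mul, integral_const_mul,
    integral_sub (PolyGrowth.id.pow 2).integrable (PolyGrowth.const 1).integrable,
    integral_summand, integral_id_gaussianReal_std, integral_sq_gaussianReal]
  simp

/-- The linearized summands have covariance `K_Z`. -/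
theorem integral_linSummand_mul_linSummand (s t : ℝ) :
    ∫ x, linSummand s x * linSummand t x ∂γ = kernelZ s t := by
  set a := Real.exp (-s ^ 2 / 2) with ha
  set b := Real.exp (-t ^ 2 / 2) with hb
  have hab : Real.exp (-(s ^ 2 + t ^ 2) / 2) = a * b := by
    rw [ha, hb, ← Real.exp_add]; congr 1; ring
  have hexp : ∀ x, linSummand s x * linSummand t x
      = summand s x * summand t x + (-b) * (x * summand s x) + (t * b) * (x ^ 2 * summand s x)
        + (-(t * b)) * summand s x + (-a) * (x * summand t x) + (s * a) * (x ^ 2 * summand t x)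
        + (-(s * a)) * summand t x + (s * a * (t * b)) * x ^ 4
        + (-(a * (t * b)) - s * a * b) * x ^ 3 + (a * b - 2 * (s * a * (t * b))) * x ^ 2
        + (a * (t * b) + s * a * b) * x
        + s * a * (t * b) := by
    intro x
    unfold linSummand
    rw [← ha, ← hb]
    ring
  simp_rw [hexp]
  have p1 := ((PolyGrowth.summand s).mul (.summand t))
  have p2 := (PolyGrowth.id.mul (.summand s)).const_mul (-b)
  have p3 := ((PolyGrowth.id.pow 2).mul (.summand s)).const_mul (t * b)
  have p4 := (PolyGrowth.summand s).const_mul (-(t * b))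
  have p5 := (PolyGrowth.id.mul (.summand t)).const_mul (-a)
  have p6 := ((PolyGrowth.id.pow 2).mul (.summand t)).const_mul (s * a)
  have p7 := (PolyGrowth.summand t).const_mul (-(s * a))
  have p8 := (PolyGrowth.id.pow 4).const_mul (s * a * (t * b))
  have p9 := (PolyGrowth.id.pow 3).const_mul (-(a * (t * b)) - s * a * b)
  have p10 := (PolyGrowth.id.pow 2).const_mul (a * b - 2 * (s * a * (t * b)))
  have p11 := PolyGrowth.id.const_mul (a * (t * b) + s * a * b)
  have q2 := p1.add p2
  have q3 := q2.add p3
  have q4 := q3.add p4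
  have q5 := q4.add p5
  have q6 := q5.add p6
  have q7 := q6.add p7
  have q8 := q7.add p8
  have q9 := q8.add p9
  have q10 := q9.add p10
  have q11 := q10.add p11
  rw [integral_add q11.integrable (integrable_const _), integral_add q10.integrable p11.integrable,
    integral_add q9.integrable p10.integrable, integral_add q8.integrable p9.integrable,
    integral_add q7.integrable p8.integrable, integral_add q6.integrable p7.integrable,
    integral_add q5.integrable p6.integrable, integral_add q4.integrable p5.integrable,
    integral_add q3.integrable p4.integrable, integral_add q2.integrable p3.integrable,
    integral_add p1.integrable p2.integrable,
    integral_const_mul (a * (t * b) + s * a * b) fun x : ℝ => x]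
  simp only [integral_const_mul, integral_const, integral_summand_mul_summand,
    integral_id_mul_summand, integral_sq_mul_summand, integral_summand,
    integral_fourth_gaussianReal, integral_cube_gaussianReal, integral_sq_gaussianReal,
    integral_id_gaussianReal_std, probReal_univ, one_smul]
  unfold kernelZ
  rw [hab, ← ha, ← hb]
  ring

end Summand

/-! ### Random elements of the weighted `L²` space -/

section Elements

open Topology

variable {w : ℝ → ℝ}

/-- The measure `w dt` is s-finite, so its `L²` space is separable; this makes sums of random
elements measurable. -/
instance instSecondCountableTopologyL2w (w : ℝ → ℝ) : SecondCountableTopology (L2w w) := by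
  have : Fact ((2 : ℝ≥0∞) ≠ ∞) := ⟨by norm_num⟩
  have : SFinite (weightMeasure w) := by unfold weightMeasure; infer_instance
  infer_instance

theorem integrable_weightMeasure_iff (hw : IsWeight w) {g : ℝ → ℝ} :
    Integrable g (weightMeasure w) ↔ Integrable (fun t => g t * w t) volume := by
  rw [weightMeasure, integrable_withDensity_iff hw.measurable.ennreal_ofReal
    (ae_of_all _ fun t => ENNReal.ofReal_lt_top)]
  simp_rw [ENNReal.toReal_ofReal (hw.nonneg _)]

theorem integral_weightMeasure (hw : IsWeight w) (g : ℝ → ℝ) :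
    ∫ t, g t ∂(weightMeasure w) = ∫ t, g t * w t := by
  rw [weightMeasure, integral_withDensity_eq_integral_toReal_smul hw.measurable.ennreal_ofReal
    (ae_of_all _ fun t => ENNReal.ofReal_lt_top)]
  refine integral_congr_ae (ae_of_all _ fun t => ?_)
  simp only [ENNReal.toReal_ofReal (hw.nonneg t), smul_eq_mul, mul_comm]

theorem isFiniteMeasure_weightMeasure (hw : IsWeight w) : IsFiniteMeasure (weightMeasure w) :=
  isFiniteMeasure_withDensity_ofReal hw.integrable.2

theorem integrable_one_add_sq (hw : IsWeight w) :
    Integrable (fun t : ℝ => 1 + t ^ 2) (weightMeasure w) := by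
  rw [integrable_weightMeasure_iff hw]
  refine (hw.integrable.add hw.sq_integrable).congr (ae_of_all _ fun t => ?_)
  simp only [Pi.add_apply]; ring

theorem memLp_one_add_abs (hw : IsWeight w) :
    MemLp (fun t : ℝ => 1 + |t|) 2 (weightMeasure w) := by
  rw [memLp_two_iff_integrable_sq (Continuous.aestronglyMeasurable (by fun_prop))]
  refine ((integrable_one_add_sq hw).const_mul 2).mono'
    (Continuous.aestronglyMeasurable (by fun_prop)) (ae_of_all _ fun t => ?_)
  rw [Real.norm_of_nonneg (sq_nonneg _)]
  nlinarith [sq_nonneg (1 - |t|), sq_abs t]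

/-- Kernels `φ_t(y)` that are jointly continuous and grow at most linearly in `t` and quadratically
in `y`; their sections `t ↦ φ_t(y)` are elements of the weighted `L²` space. -/
structure IsAdmissible (φ : ℝ → ℝ → ℝ) : Prop where
  continuous : Continuous fun p : ℝ × ℝ => φ p.1 p.2
  bound : ∀ t y, |φ t y| ≤ 3 * (1 + y ^ 2) * (1 + |t|)

theorem isAdmissible_summand : IsAdmissible summand where
  continuous := by unfold summand; fun_prop
  bound t y := by
    have h5 : 2 * |y| ≤ 1 + y ^ 2 := by nlinarith [sq_abs y, sq_nonneg (|y| - 1)]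
    nlinarith [abs_summand_le t y, abs_nonneg t, mul_nonneg (abs_nonneg t) (sq_nonneg y),
      sq_nonneg y]

theorem isAdmissible_linSummand : IsAdmissible linSummand where
  continuous := by unfold linSummand summand; fun_prop
  bound := abs_linSummand_le

namespace IsAdmissible

variable {φ : ℝ → ℝ → ℝ}

theorem continuous_left (hφ : IsAdmissible φ) (y : ℝ) : Continuous fun t => φ t y :=
  hφ.continuous.comp (by fun_prop : Continuous fun t : ℝ => (t, y))

theorem continuous_right (hφ : IsAdmissible φ) (t : ℝ) : Continuous (φ t) :=
  hφ.continuous.comp (by fun_prop : Continuous fun y : ℝ => (t, y))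

theorem memLp (hφ : IsAdmissible φ) (hw : IsWeight w) (y : ℝ) :
    MemLp (fun t => φ t y) 2 (weightMeasure w) := by
  refine ((memLp_one_add_abs hw).const_mul (3 * (1 + y ^ 2))).mono
    (hφ.continuous_left y).aestronglyMeasurable (ae_of_all _ fun t => ?_)
  rw [Real.norm_eq_abs]
  exact (hφ.bound t y).trans (le_abs_self _)

/-- The section `t ↦ φ_t(y)` as an element of the weighted `L²` space. -/
noncomputable def toL2 (hφ : IsAdmissible φ) (hw : IsWeight w) (y : ℝ) : L2w w :=
  (hφ.memLp hw y).toLp _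

theorem coeFn_toL2 (hφ : IsAdmissible φ) (hw : IsWeight w) (y : ℝ) :
    hφ.toL2 hw y =ᵐ[weightMeasure w] fun t => φ t y := MemLp.coeFn_toLp _

end IsAdmissible

theorem norm_sq_eq_integral (f : L2w w) : ‖f‖ ^ 2 = ∫ t, f t ^ 2 ∂(weightMeasure w) := by
  rw [← real_inner_self_eq_norm_sq, L2.inner_def]
  refine integral_congr_ae (ae_of_all _ fun t => ?_)
  simp [sq]

theorem norm_sq_eq_integral_of_ae_eq {f : L2w w} {g : ℝ → ℝ} (h : f =ᵐ[weightMeasure w] g) :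
    ‖f‖ ^ 2 = ∫ t, g t ^ 2 ∂(weightMeasure w) := by
  rw [norm_sq_eq_integral]
  refine integral_congr_ae ?_
  filter_upwards [h] with t ht
  rw [ht]

namespace IsAdmissible

variable {φ : ℝ → ℝ → ℝ}

/-- Continuity of `y ↦ φ_·(y)` in `L²` makes `φ_·(X)` a random element. -/
theorem continuous_toL2 (hφ : IsAdmissible φ) (hw : IsWeight w) : Continuous (hφ.toL2 hw) := by
  rw [continuous_iff_continuousAt]
  intro y
  rw [ContinuousAt, tendsto_iff_norm_sub_tendsto_zero]
  have h1 : ∀ z, ‖hφ.toL2 hw z - hφ.toL2 hw y‖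
      = √(∫ t, (φ t z - φ t y) ^ 2 ∂(weightMeasure w)) := by
    intro z
    rw [← norm_sq_eq_integral_of_ae_eq (f := hφ.toL2 hw z - hφ.toL2 hw y),
      Real.sqrt_sq (norm_nonneg _)]
    filter_upwards [Lp.coeFn_sub (hφ.toL2 hw z) (hφ.toL2 hw y), hφ.coeFn_toL2 hw z,
      hφ.coeFn_toL2 hw y] with t h1 h2 h3
    rw [h1, Pi.sub_apply, h2, h3]
  simp_rw [h1]
  have h2 : Tendsto (fun z => ∫ t, (φ t z - φ t y) ^ 2 ∂(weightMeasure w)) (𝓝 y)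
      (𝓝 (∫ t, (φ t y - φ t y) ^ 2 ∂(weightMeasure w))) := by
    set B := 3 * (1 + (|y| + 1) ^ 2) with hB
    refine tendsto_integral_filter_of_dominated_convergence
      (fun t => (2 * B * (1 + |t|)) ^ 2) ?_ ?_ ?_ ?_
    · exact Eventually.of_forall fun z => Continuous.aestronglyMeasurable
        (((hφ.continuous_left z).sub (hφ.continuous_left y)).pow 2)
    · filter_upwards [Metric.ball_mem_nhds y one_pos] with z hz
      refine ae_of_all _ fun t => ?_
      have hz' : |z| ≤ |y| + 1 := by
        have h3 : |z - y| < 1 := by simpa [Real.dist_eq] using hz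
        have h4 := abs_sub_abs_le_abs_sub z y
        linarith
      have hle : ∀ u : ℝ, |u| ≤ |y| + 1 → |φ t u| ≤ B * (1 + |t|) := fun u hu => by
        refine (hφ.bound t u).trans ?_
        have : u ^ 2 ≤ (|y| + 1) ^ 2 := by rw [← sq_abs u]; gcongr
        rw [hB]; gcongr
      rw [Real.norm_of_nonneg (sq_nonneg _), ← sq_abs (φ t z - φ t y)]
      refine pow_le_pow_left₀ (abs_nonneg _) ((abs_sub _ _).trans ?_) 2
      linarith [hle z hz', hle y (by linarith)]
    · have := ((memLp_one_add_abs hw).const_mul (2 * B)).integrable_sq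
      exact this
    · refine ae_of_all _ fun t => ?_
      exact (((hφ.continuous_right t).sub continuous_const).pow 2).tendsto y
  have h3 := (Real.continuous_sqrt.tendsto _).comp h2
  simpa using! h3

theorem norm_toL2_le (hφ : IsAdmissible φ) (hw : IsWeight w) (y : ℝ) :
    ‖hφ.toL2 hw y‖ ≤ 3 * (1 + y ^ 2) * ‖(memLp_one_add_abs hw).toLp _‖ := by
  refine Lp.norm_le_mul_norm_of_ae_le_mul ?_
  filter_upwards [hφ.coeFn_toL2 hw y, (memLp_one_add_abs hw).coeFn_toLp] with t h1 h2
  rw [h1, h2, Real.norm_eq_abs, Real.norm_of_nonneg (by positivity)]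
  exact hφ.bound t y

theorem memLp_toL2 (hφ : IsAdmissible φ) (hw : IsWeight w) :
    MemLp (hφ.toL2 hw) 2 (gaussianReal 0 1) := by
  have hsq : MemLp (fun y : ℝ => 1 + y ^ 2) 2 (gaussianReal 0 1) := by
    rw [memLp_two_iff_integrable_sq (Continuous.aestronglyMeasurable (by fun_prop))]
    exact (((PolyGrowth.const 1).add (PolyGrowth.id.pow 2)).pow 2).integrable
  refine (hsq.const_mul (3 * ‖(memLp_one_add_abs hw).toLp _‖)).mono
    (hφ.continuous_toL2 hw).aestronglyMeasurable (ae_of_all _ fun y => ?_)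
  refine (hφ.norm_toL2_le hw y).trans ((le_of_eq ?_).trans (le_abs_self _))
  ring

theorem inner_toL2 (hφ : IsAdmissible φ) (hw : IsWeight w) (f : L2w w) (y : ℝ) :
    inner ℝ f (hφ.toL2 hw y) = ∫ t, f t * φ t y ∂(weightMeasure w) := by
  rw [L2.inner_def]
  refine integral_congr_ae ?_
  filter_upwards [hφ.coeFn_toL2 hw y] with t ht
  rw [ht]
  simp [mul_comm]

theorem integrable_abs_mul_one_add_abs (hw : IsWeight w) (f : L2w w) :
    Integrable (fun t => |f t| * (1 + |t|)) (weightMeasure w) :=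
  MemLp.integrable_mul (Lp.memLp f).norm (memLp_one_add_abs hw)

theorem integrable_prod (hφ : IsAdmissible φ) (hw : IsWeight w) (f : L2w w) :
    Integrable (fun p : ℝ × ℝ => f p.2 * φ p.2 p.1)
      ((gaussianReal 0 1).prod (weightMeasure w)) := by
  have := isFiniteMeasure_weightMeasure hw
  have h1 : Integrable (fun y : ℝ => 3 * (1 + y ^ 2)) (gaussianReal 0 1) :=
    (((PolyGrowth.const 1).add (PolyGrowth.id.pow 2)).const_mul 3).integrable
  refine (h1.mul_prod (integrable_abs_mul_one_add_abs hw f)).mono' ?_ (ae_of_all _ fun p => ?_)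
  · exact (Lp.aestronglyMeasurable f).comp_snd.mul
      (hφ.continuous.comp continuous_swap).aestronglyMeasurable
  · rw [norm_mul, Real.norm_eq_abs, Real.norm_eq_abs]
    calc |f p.2| * |φ p.2 p.1| ≤ |f p.2| * (3 * (1 + p.1 ^ 2) * (1 + |p.2|)) :=
          mul_le_mul_of_nonneg_left (hφ.bound _ _) (abs_nonneg _)
      _ = _ := by ring

theorem integral_toL2_eq_zero (hφ : IsAdmissible φ) (hw : IsWeight w)
    (h0 : ∀ t, ∫ y, φ t y ∂(gaussianReal 0 1) = 0) :
    ∫ y, hφ.toL2 hw y ∂(gaussianReal 0 1) = 0 := by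
  have := isFiniteMeasure_weightMeasure hw
  refine ext_inner_left ℝ fun f => ?_
  rw [← integral_inner ((hφ.memLp_toL2 hw).integrable (by norm_num)), inner_zero_right]
  simp_rw [hφ.inner_toL2 hw f]
  rw [integral_integral_swap (hφ.integrable_prod hw f)]
  simp_rw [integral_const_mul, h0, mul_zero, integral_zero]

/-- The covariance operator of the random element `φ_·(X)`, with `X` standard normal, is the
integral operator whose kernel is the covariance function. -/
theorem integral_inner_mul_inner (hφ : IsAdmissible φ) (hw : IsWeight w) (f g : L2w w) :
    ∫ y, inner ℝ f (hφ.toL2 hw y) * inner ℝ g (hφ.toL2 hw y) ∂(gaussianReal 0 1)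
      = ∫ s, ∫ t, f s * (∫ y, φ s y * φ t y ∂(gaussianReal 0 1)) * g t
          ∂(weightMeasure w) ∂(weightMeasure w) := by
  have := isFiniteMeasure_weightMeasure hw
  set ν := weightMeasure w with hν
  have hint : Integrable (fun p : ℝ × ℝ × ℝ => (f p.2.1 * φ p.2.1 p.1) * (g p.2.2 * φ p.2.2 p.1))
      ((gaussianReal 0 1).prod (ν.prod ν)) := by
    have h1 : Integrable (fun y : ℝ => (3 * (1 + y ^ 2)) ^ 2) (gaussianReal 0 1) :=
      ((((PolyGrowth.const 1).add (PolyGrowth.id.pow 2)).const_mul 3).pow 2).integrable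
    refine (h1.mul_prod ((integrable_abs_mul_one_add_abs hw f).mul_prod
      (integrable_abs_mul_one_add_abs hw g))).mono' ?_ (ae_of_all _ fun p => ?_)
    · have m1 : AEStronglyMeasurable (fun p : ℝ × ℝ × ℝ => f p.2.1)
          ((gaussianReal 0 1).prod (ν.prod ν)) :=
        ((Lp.aestronglyMeasurable f).comp_fst (ν := ν)).comp_snd
      have m2 : AEStronglyMeasurable (fun p : ℝ × ℝ × ℝ => g p.2.2)
          ((gaussianReal 0 1).prod (ν.prod ν)) :=
        ((Lp.aestronglyMeasurable g).comp_snd (μ := ν)).comp_snd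
      exact (m1.mul (hφ.continuous.comp
          (by fun_prop : Continuous fun p : ℝ × ℝ × ℝ => (p.2.1, p.1))).aestronglyMeasurable).mul
        (m2.mul (hφ.continuous.comp
          (by fun_prop : Continuous fun p : ℝ × ℝ × ℝ => (p.2.2, p.1))).aestronglyMeasurable)
    · rw [norm_mul, norm_mul, norm_mul]
      simp only [Real.norm_eq_abs]
      calc |f p.2.1| * |φ p.2.1 p.1| * (|g p.2.2| * |φ p.2.2 p.1|)
          ≤ |f p.2.1| * (3 * (1 + p.1 ^ 2) * (1 + |p.2.1|))
            * (|g p.2.2| * (3 * (1 + p.1 ^ 2) * (1 + |p.2.2|))) := by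
            gcongr
            · exact hφ.bound _ _
            · exact hφ.bound _ _
        _ = _ := by ring
  have hint2 := hint.swap.integral_prod_left
  calc ∫ y, inner ℝ f (hφ.toL2 hw y) * inner ℝ g (hφ.toL2 hw y) ∂(gaussianReal 0 1)
      = ∫ y, ∫ q : ℝ × ℝ, (f q.1 * φ q.1 y) * (g q.2 * φ q.2 y) ∂(ν.prod ν)
          ∂(gaussianReal 0 1) := by
        refine integral_congr_ae (ae_of_all _ fun y => ?_)
        simp only
        rw [hφ.inner_toL2 hw, hφ.inner_toL2 hw,
          integral_prod_mul (fun s => f s * φ s y) (fun t => g t * φ t y)]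
    _ = ∫ q : ℝ × ℝ, ∫ y, (f q.1 * φ q.1 y) * (g q.2 * φ q.2 y) ∂(gaussianReal 0 1) ∂(ν.prod ν) :=
        integral_integral_swap hint
    _ = ∫ q : ℝ × ℝ, f q.1 * (∫ y, φ q.1 y * φ q.2 y ∂(gaussianReal 0 1)) * g q.2 ∂(ν.prod ν) := by
        refine integral_congr_ae (ae_of_all _ fun q => ?_)
        simp only
        rw [← integral_const_mul, ← integral_mul_const]
        exact integral_congr_ae (ae_of_all _ fun y => by ring)
    _ = _ := by
        refine integral_prod (fun q : ℝ × ℝ =>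
          f q.1 * (∫ y, φ q.1 y * φ q.2 y ∂(gaussianReal 0 1)) * g q.2) ?_
        refine hint.integral_prod_right.congr (ae_of_all _ fun q => ?_)
        simp only
        rw [← integral_const_mul, ← integral_mul_const]
        exact integral_congr_ae (ae_of_all _ fun y => by ring)

end IsAdmissible

variable {Ω : Type*} [MeasurableSpace Ω] {P : Measure Ω} [IsProbabilityMeasure P]

/-- The linearized process satisfies the central limit theorem, and the limiting Gaussian measure
has covariance kernel `K_Z`. -/
theorem exists_isGaussian_tendsto_linearized (hw : IsWeight w) {X : ℕ → Ω → ℝ}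
    (hm : ∀ j, Measurable (X j)) (hlaw : ∀ j, P.map (X j) = gaussianReal 0 1)
    (hindep : iIndepFun X P) :
    ∃ μ : ProbabilityMeasure (L2w w), IsGaussian (μ : Measure (L2w w)) ∧
      ∫ x, x ∂(μ : Measure (L2w w)) = 0 ∧
      (∀ f g : L2w w, covarianceBilin (μ : Measure (L2w w)) f g
        = ∫ s, ∫ t, f s * kernelZ s t * g t ∂(weightMeasure w) ∂(weightMeasure w)) ∧
      ∀ V : ℕ → ProbabilityMeasure (L2w w),
        (∀ n : ℕ, (V n : Measure (L2w w)) = P.map fun ω =>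
          (√(n : ℝ))⁻¹ • ∑ k ∈ Finset.range n, isAdmissible_linSummand.toL2 hw (X k ω)) →
        Tendsto V atTop (𝓝 μ) := by
  have := isFiniteMeasure_weightMeasure hw
  set G := isAdmissible_linSummand.toL2 hw with hG
  have hGm : Measurable G := (isAdmissible_linSummand.continuous_toL2 hw).measurable
  have hG2 : MemLp G 2 (gaussianReal 0 1) := isAdmissible_linSummand.memLp_toL2 hw
  have hG2' : MemLp (fun ω => G (X 0 ω)) 2 P := by
    rw [← hlaw 0] at hG2
    exact hG2.comp_of_map (hm 0).aemeasurable
  have hident : ∀ i, IdentDistrib (X i) (X 0) P P := fun i =>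
    ⟨(hm i).aemeasurable, (hm 0).aemeasurable, by rw [hlaw i, hlaw 0]⟩
  have hG0 : ∫ y, G y ∂(gaussianReal 0 1) = 0 :=
    isAdmissible_linSummand.integral_toL2_eq_zero hw integral_linSummand
  obtain ⟨μ, h1, h2, h3, h4⟩ := exists_isGaussian_tendsto_inv_sqrt_smul_sum (P := P)
    (ξ := fun i ω => G (X i ω)) (fun i => hGm.comp (hm i)) hG2'
    (fun i => (hident i).comp hGm) (hindep.comp (fun _ => G) fun _ => hGm)
    (by rw [← integral_map (hm 0).aemeasurable hGm.aestronglyMeasurable, hlaw 0, hG0])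
  refine ⟨μ, h1, h2, fun f g => ?_, h4⟩
  have hmap : P.map (fun ω => G (X 0 ω)) = (gaussianReal 0 1).map G := by
    rw [← hlaw 0, Measure.map_map hGm (hm 0)]; rfl
  have hprob : IsProbabilityMeasure ((gaussianReal 0 1).map G) :=
    Measure.isProbabilityMeasure_map hGm.aemeasurable
  have hid : MemLp id 2 ((gaussianReal 0 1).map G) :=
    (memLp_map_measure_iff aestronglyMeasurable_id hGm.aemeasurable).2 hG2
  have hmean : ∫ x, id x ∂((gaussianReal 0 1).map G) = 0 := by
    rw [integral_map hGm.aemeasurable aestronglyMeasurable_id]; exact hG0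
  rw [h3, hmap, covarianceBilin_apply hid, hmean]
  simp only [sub_zero]
  rw [integral_map hGm.aemeasurable (Continuous.aestronglyMeasurable (by fun_prop)), hG,
    isAdmissible_linSummand.integral_inner_mul_inner hw f g]
  simp_rw [integral_linSummand_mul_linSummand]

end Elements

/-! ### Rotational invariance and integration by parts on the sphere -/

section Rotation

open Topology

section Plane

variable {H : Type*} [NormedAddCommGroup H] [InnerProductSpace ℝ H]

/-- The rotation by the angle `θ` in the plane spanned by two orthogonal vectors `p` and `q` with
`‖p‖ ^ 2 = ‖q‖ ^ 2 = r`, as a linear map. The formula is written down for all `p`, `q` and `r`. -/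
noncomputable def planeRotationLin (p q : H) (r θ : ℝ) : H →ₗ[ℝ] H where
  toFun x := x + (((Real.cos θ - 1) * inner ℝ p x - Real.sin θ * inner ℝ q x) / r) • p
    + ((Real.sin θ * inner ℝ p x + (Real.cos θ - 1) * inner ℝ q x) / r) • q
  map_add' x y := by
    simp only [inner_add_right]
    module
  map_smul' c x := by
    simp only [inner_smul_right, RingHom.id_apply]
    module

/-- The rotation by the angle `θ` in the plane spanned by `p` and `q`, as an isometry. -/
noncomputable def planeRotation {p q : H} {r : ℝ} (hr : r ≠ 0) (hp : inner ℝ p p = r)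
    (hq : inner ℝ q q = r) (hpq : inner ℝ p q = 0) (θ : ℝ) : H →ₗᵢ[ℝ] H where
  toLinearMap := planeRotationLin p q r θ
  norm_map' x := by
    rw [← sq_eq_sq₀ (norm_nonneg _) (norm_nonneg _), ← real_inner_self_eq_norm_sq,
      ← real_inner_self_eq_norm_sq]
    change inner ℝ (x + _ • p + _ • q) (x + _ • p + _ • q) = _
    have hqp : inner ℝ q p = 0 := by rw [real_inner_comm, hpq]
    simp only [inner_add_left, inner_add_right, inner_smul_left, inner_smul_right, hp, hq, hpq,
      hqp, real_inner_comm p x, real_inner_comm q x, conj_trivial]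
    have h := Real.sin_sq_add_cos_sq θ
    field_simp
    linear_combination (r * (inner ℝ p x ^ 2 + inner ℝ q x ^ 2)) * h

variable {p q : H} {r : ℝ} (hr : r ≠ 0) (hp : inner ℝ p p = r) (hq : inner ℝ q q = r)
  (hpq : inner ℝ p q = 0)

theorem planeRotation_apply (θ : ℝ) (x : H) : planeRotation hr hp hq hpq θ x
    = x + (((Real.cos θ - 1) * inner ℝ p x - Real.sin θ * inner ℝ q x) / r) • p
      + ((Real.sin θ * inner ℝ p x + (Real.cos θ - 1) * inner ℝ q x) / r) • q := rfl

end Plane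

variable {n : ℕ}

/-- The vector with all entries equal to one. -/
noncomputable def oneVec (n : ℕ) : EuclideanSpace ℝ (Fin n) := WithLp.toLp 2 fun _ => 1

theorem inner_oneVec (y : EuclideanSpace ℝ (Fin n)) : inner ℝ (oneVec n) y = ∑ i, y i := by
  simp [oneVec, PiLp.inner_apply]

/-- The first direction of the plane of rotation: `2 e_a - e_b - e_c`. Together with `dirQ` it spans
the vectors in the coordinates `a`, `b`, `c` with sum zero, so the rotations in this plane fix the
vector `1`. -/
noncomputable def dirP (a b c : Fin n) : EuclideanSpace ℝ (Fin n) :=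
  EuclideanSpace.single a 2 - EuclideanSpace.single b 1 - EuclideanSpace.single c 1

/-- The second direction of the plane of rotation: `√3 (e_b - e_c)`, of the same length as
`dirP`. -/
noncomputable def dirQ (b c : Fin n) : EuclideanSpace ℝ (Fin n) :=
  EuclideanSpace.single b (√3) - EuclideanSpace.single c (√3)

theorem inner_dirP (a b c : Fin n) (y : EuclideanSpace ℝ (Fin n)) :
    inner ℝ (dirP a b c) y = 2 * y a - y b - y c := by
  simp [dirP, inner_sub_left, EuclideanSpace.inner_single_left]

theorem inner_dirQ (b c : Fin n) (y : EuclideanSpace ℝ (Fin n)) :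
    inner ℝ (dirQ b c) y = √3 * (y b - y c) := by
  simp [dirQ, inner_sub_left, EuclideanSpace.inner_single_left]
  ring

section Identity

variable {a b c : Fin n} (hab : a ≠ b) (hac : a ≠ c) (hbc : b ≠ c)
include hab hac hbc

theorem inner_dirP_self : inner ℝ (dirP a b c) (dirP a b c) = (6 : ℝ) := by
  rw [inner_dirP]
  simp [dirP, hab, hac, hbc, hab.symm, hac.symm, hbc.symm]
  norm_num

omit hab hac in
theorem inner_dirQ_self : inner ℝ (dirQ b c) (dirQ b c) = (6 : ℝ) := by
  rw [inner_dirQ]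
  simp [dirQ, hbc, hbc.symm]
  nlinarith [Real.mul_self_sqrt (show (0 : ℝ) ≤ 3 by norm_num)]

theorem inner_dirP_dirQ : inner ℝ (dirP a b c) (dirQ b c) = (0 : ℝ) := by
  rw [inner_dirP]
  simp [dirQ, hab, hac, hbc, hbc.symm]

end Identity

/-- A law on `ℝⁿ` that is invariant under the rotations fixing the vector `1` and is carried by the
sphere `∑ y = 0`, `∑ y ^ 2 = n`. This is the law of the scaled residuals. -/
structure IsResidualLaw (ρ : Measure (EuclideanSpace ℝ (Fin n))) : Prop where
  invariant : ∀ U : EuclideanSpace ℝ (Fin n) →ₗᵢ[ℝ] EuclideanSpace ℝ (Fin n),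
    U (oneVec n) = oneVec n → ρ.map U = ρ
  sum_eq : ∀ᵐ y ∂ρ, ∑ i, y i = 0
  sum_sq_eq : ∀ᵐ y ∂ρ, ∑ i, y i ^ 2 = (n : ℝ)

variable {ρ : Measure (EuclideanSpace ℝ (Fin n))} [IsProbabilityMeasure ρ]

namespace IsResidualLaw

omit [IsProbabilityMeasure ρ] in
theorem ae_mem_closedBall (hρ : IsResidualLaw ρ) :
    ∀ᵐ y ∂ρ, y ∈ Metric.closedBall (0 : EuclideanSpace ℝ (Fin n)) (√n) := by
  filter_upwards [hρ.sum_sq_eq] with y hy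
  rw [mem_closedBall_zero_iff, EuclideanSpace.norm_eq]
  simp [hy]

theorem integrable (hρ : IsResidualLaw ρ) {F : EuclideanSpace ℝ (Fin n) → ℝ} (hF : Continuous F) :
    Integrable F ρ := by
  obtain ⟨C, hC⟩ := (isCompact_closedBall (0 : EuclideanSpace ℝ (Fin n))
    (√n)).exists_bound_of_continuousOn hF.continuousOn
  refine Integrable.of_bound hF.aestronglyMeasurable C ?_
  filter_upwards [hρ.ae_mem_closedBall] with y hy using hC y hy

/-- Integration by parts on the sphere: invariance under the rotations of three coordinates that
fix their sum, in infinitesimal form. The integral of `(y_b - y_c) f(y_a) G(y)` is constant along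
the rotations, and its derivative at the angle zero vanishes; `G` does not depend on the three
coordinates. -/
theorem integral_rotation (hρ : IsResidualLaw ρ) {a b c : Fin n} (hab : a ≠ b) (hac : a ≠ c)
    (hbc : b ≠ c) {f f' : ℝ → ℝ} (hd : ∀ x, HasDerivAt f (f' x) x) (hf' : Continuous f')
    {G : EuclideanSpace ℝ (Fin n) → ℝ} (hG : Continuous G)
    (hGinv : ∀ (y : EuclideanSpace ℝ (Fin n)) (A B : ℝ),
      G (y + A • dirP a b c + B • dirQ b c) = G y) :
    ∫ y, (y b - y c) ^ 2 * f' (y a) * G y ∂ρ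
      = ∫ y, (2 * y a - y b - y c) * f (y a) * G y ∂ρ := by
  have hf : Continuous f := continuous_iff_continuousAt.2 fun x => (hd x).continuousAt
  have h3 : √3 * √3 = (3 : ℝ) := Real.mul_self_sqrt (by norm_num)
  set U := planeRotation (by norm_num : (6 : ℝ) ≠ 0) (inner_dirP_self hab hac hbc)
    (inner_dirQ_self hbc) (inner_dirP_dirQ hab hac hbc) with hU
  have hone : ∀ θ, U θ (oneVec n) = oneVec n := by
    intro θ
    rw [hU, planeRotation_apply, inner_dirP, inner_dirQ]
    simp [oneVec]
    norm_num
  -- `α` and `β` are the coordinates in the plane of rotation, `Z θ` is the rotated coordinate `a`,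
  -- and `F θ` is `β f(y_a) G` composed with the rotation by `θ`
  set α : EuclideanSpace ℝ (Fin n) → ℝ := fun y => 2 * y a - y b - y c with hα
  set β : EuclideanSpace ℝ (Fin n) → ℝ := fun y => √3 * (y b - y c) with hβ
  have hαc : Continuous α := by fun_prop
  have hβc : Continuous β := by fun_prop
  set Z : ℝ → EuclideanSpace ℝ (Fin n) → ℝ := fun θ y =>
    y a + ((Real.cos θ - 1) * α y - Real.sin θ * β y) / 3 with hZ
  set F : ℝ → EuclideanSpace ℝ (Fin n) → ℝ := fun θ y =>
    (Real.sin θ * α y + Real.cos θ * β y) * f (Z θ y) * G y with hF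
  set F' : ℝ → EuclideanSpace ℝ (Fin n) → ℝ := fun θ y =>
    ((Real.cos θ * α y - Real.sin θ * β y) * f (Z θ y)
      + (Real.sin θ * α y + Real.cos θ * β y)
        * (f' (Z θ y) * ((-Real.sin θ * α y - Real.cos θ * β y) / 3))) * G y with hF'
  have hFU : ∀ θ y, F θ y = β (U θ y) * f ((U θ y) a) * G (U θ y) := by
    intro θ y
    have e1 : (U θ y) a = Z θ y := by
      rw [hU, planeRotation_apply, inner_dirP, inner_dirQ]
      simp [dirP, dirQ, hZ, hα, hβ, hab, hac]
      ring
    have e2 : β (U θ y) = Real.sin θ * α y + Real.cos θ * β y := by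
      rw [hU, planeRotation_apply, inner_dirP, inner_dirQ]
      simp [dirP, dirQ, hα, hβ, hab.symm, hac.symm, hbc, hbc.symm]
      linear_combination (1 / 3 * (Real.sin θ * (2 * y a - y b - y c)
        + (Real.cos θ - 1) * (√3 * (y b - y c)))) * h3
    have e3 : G (U θ y) = G y := by
      rw [hU, planeRotation_apply]
      exact hGinv y _ _
    rw [e1, e2, e3]
  have hconst : ∀ θ, ∫ y, F θ y ∂ρ = ∫ y, β y * f (y a) * G y ∂ρ := by
    intro θ
    simp_rw [hFU]
    conv_rhs => rw [← hρ.invariant (U θ) (hone θ)]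
    rw [integral_map (U θ).continuous.measurable.aemeasurable]
    exact Continuous.aestronglyMeasurable (by fun_prop)
  have hFc : ∀ θ, Continuous (F θ) := fun θ => by fun_prop
  have hF'c : Continuous fun z : ℝ × EuclideanSpace ℝ (Fin n) => F' z.1 z.2 := by fun_prop
  have hderiv : ∀ y θ, HasDerivAt (fun θ => F θ y) (F' θ y) θ := by
    intro y θ
    have d1 : HasDerivAt (fun θ => Real.sin θ * α y + Real.cos θ * β y)
        (Real.cos θ * α y - Real.sin θ * β y) θ :=
      (((Real.hasDerivAt_sin θ).mul_const _).add ((Real.hasDerivAt_cos θ).mul_const _)).congr_deriv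
        (by ring)
    have d2 : HasDerivAt (fun θ => Z θ y) ((-Real.sin θ * α y - Real.cos θ * β y) / 3) θ :=
      (((((Real.hasDerivAt_cos θ).sub_const 1).mul_const (α y)).sub
        ((Real.hasDerivAt_sin θ).mul_const (β y))).div_const 3).const_add (y a)
    exact (d1.mul ((hd (Z θ y)).comp θ d2)).mul_const (G y)
  obtain ⟨C, hC⟩ := ((isCompact_Icc (a := (-1 : ℝ)) (b := 1)).prod
    (isCompact_closedBall (0 : EuclideanSpace ℝ (Fin n)) (√n))).exists_bound_of_continuousOn
    hF'c.continuousOn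
  have hmain := (hasDerivAt_integral_of_dominated_loc_of_deriv_le (μ := ρ) (F := F) (F' := F')
    (x₀ := 0) (s := Set.Icc (-1) 1) (bound := fun _ => C) (Icc_mem_nhds (by norm_num) (by norm_num))
    (Eventually.of_forall fun θ => (hFc θ).aestronglyMeasurable) (hρ.integrable (hFc 0))
    (hF'c.comp (by fun_prop : Continuous fun y => ((0 : ℝ), y))).aestronglyMeasurable
    (by
      filter_upwards [hρ.ae_mem_closedBall] with y hy
      exact fun θ hθ => hC (θ, y) ⟨hθ, hy⟩)
    (integrable_const C) (ae_of_all _ fun y θ _ => hderiv y θ)).2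
  simp_rw [hconst] at hmain
  have h0 := hmain.unique (hasDerivAt_const _ _)
  have h4 : ∀ y, F' 0 y = α y * f (y a) * G y - (y b - y c) ^ 2 * f' (y a) * G y := by
    intro y
    have e : β y * β y = 3 * (y b - y c) ^ 2 := by
      rw [hβ]; linear_combination (y b - y c) ^ 2 * h3
    simp only [hF', hZ, Real.sin_zero, Real.cos_zero]
    simp only [sub_self, zero_mul, sub_zero, zero_div, add_zero, one_mul, zero_add, neg_zero,
      zero_sub]
    linear_combination (-(f' (y a) * G y) / 3) * e
  simp_rw [h4] at h0
  rw [integral_sub (hρ.integrable (by fun_prop)) (hρ.integrable (by fun_prop))] at h0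
  linarith

/-- The identity `integral_rotation` summed over the pairs of coordinates in `s`. For the residuals
the sums over `s` are functions of the few coordinates outside `s`. -/
theorem integral_sum_rotation (hρ : IsResidualLaw ρ) {a : Fin n} {s : Finset (Fin n)} (has : a ∉ s)
    {f f' : ℝ → ℝ} (hd : ∀ x, HasDerivAt f (f' x) x) (hf' : Continuous f')
    {G : EuclideanSpace ℝ (Fin n) → ℝ} (hG : Continuous G)
    (hGinv : ∀ b ∈ s, ∀ c ∈ s, ∀ (y : EuclideanSpace ℝ (Fin n)) (A B : ℝ),
      G (y + A • dirP a b c + B • dirQ b c) = G y) :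
    ∫ y, (s.card * (∑ b ∈ s, y b ^ 2) - (∑ b ∈ s, y b) ^ 2) * (f' (y a) * G y) ∂ρ
      = (s.card - 1) * ∫ y, (s.card * y a - ∑ b ∈ s, y b) * (f (y a) * G y) ∂ρ := by
  have hf : Continuous f := continuous_iff_continuousAt.2 fun x => (hd x).continuousAt
  have key : ∀ b ∈ s, ∀ c ∈ s, ∫ y, (y b - y c) ^ 2 * f' (y a) * G y ∂ρ
      = ∫ y, (if b = c then 0 else (2 * y a - y b - y c)) * f (y a) * G y ∂ρ := by
    intro b hb c hc
    by_cases hbc : b = c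
    · subst hbc; simp
    · simp only [hbc, if_false]
      exact hρ.integral_rotation (ne_of_mem_of_not_mem hb has).symm
        (ne_of_mem_of_not_mem hc has).symm hbc hd hf' hG
        (hGinv b hb c hc)
  have hsum := Finset.sum_congr rfl fun b hb => Finset.sum_congr rfl (key b hb)
  have hc1 : ∀ b c : Fin n, Continuous fun y : EuclideanSpace ℝ (Fin n) =>
      (y b - y c) ^ 2 * f' (y a) * G y := fun b c => by fun_prop
  have hc2 : ∀ b c : Fin n, Continuous fun y : EuclideanSpace ℝ (Fin n) =>
      (if b = c then 0 else (2 * y a - y b - y c)) * f (y a) * G y := fun b c => by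
    split_ifs <;> fun_prop
  have hswap : ∀ k : Fin n → Fin n → EuclideanSpace ℝ (Fin n) → ℝ, (∀ b c, Continuous (k b c)) →
      ∑ b ∈ s, ∑ c ∈ s, ∫ y, k b c y ∂ρ = ∫ y, ∑ b ∈ s, ∑ c ∈ s, k b c y ∂ρ := by
    intro k hk
    rw [integral_finsetSum s fun b _ => hρ.integrable (continuous_finsetSum s fun c _ => hk b c)]
    exact Finset.sum_congr rfl fun b _ =>
      (integral_finsetSum s fun c _ => hρ.integrable (hk b c)).symm
  rw [hswap _ hc1, hswap _ hc2] at hsum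
  have e1 : ∀ y : EuclideanSpace ℝ (Fin n), ∑ b ∈ s, ∑ c ∈ s, (y b - y c) ^ 2 * f' (y a) * G y
      = 2 * ((s.card * (∑ b ∈ s, y b ^ 2) - (∑ b ∈ s, y b) ^ 2) * (f' (y a) * G y)) := by
    intro y
    have : ∑ b ∈ s, ∑ c ∈ s, (y b - y c) ^ 2
        = 2 * (s.card * (∑ b ∈ s, y b ^ 2) - (∑ b ∈ s, y b) ^ 2) := by
      simp_rw [sub_sq, Finset.sum_add_distrib, Finset.sum_sub_distrib, mul_assoc, ← Finset.mul_sum,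
        ← Finset.sum_mul, Finset.sum_const, nsmul_eq_mul, ← Finset.mul_sum]
      ring
    simp_rw [← Finset.sum_mul, this]
    ring
  have e2 : ∀ y : EuclideanSpace ℝ (Fin n),
      ∑ b ∈ s, ∑ c ∈ s, (if b = c then 0 else (2 * y a - y b - y c)) * f (y a) * G y
      = 2 * ((s.card - 1) * ((s.card * y a - ∑ b ∈ s, y b) * (f (y a) * G y))) := by
    intro y
    have : ∑ b ∈ s, ∑ c ∈ s, (if b = c then 0 else (2 * y a - y b - y c))
        = 2 * ((s.card - 1) * (s.card * y a - ∑ b ∈ s, y b)) := by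
      have h1 : ∀ b ∈ s, ∑ c ∈ s, (if b = c then 0 else (2 * y a - y b - y c))
          = (s.card * (2 * y a - y b) - ∑ c ∈ s, y c) - (2 * y a - y b - y b) := by
        intro b hb
        have h2 : ∀ c, (if b = c then 0 else (2 * y a - y b - y c))
            = (2 * y a - y b - y c) - (if b = c then 2 * y a - y b - y b else 0) := by
          intro c
          split_ifs with h
          · subst h; ring
          · ring
        simp_rw [h2, Finset.sum_sub_distrib, Finset.sum_ite_eq, if_pos hb, Finset.sum_const,
          nsmul_eq_mul]
        ring
      rw [Finset.sum_congr rfl h1]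
      simp_rw [Finset.sum_sub_distrib, ← Finset.mul_sum, Finset.sum_sub_distrib, Finset.sum_const,
        nsmul_eq_mul]
      ring
    simp_rw [← Finset.sum_mul, this]
    ring
  simp_rw [e1, e2, integral_const_mul] at hsum
  linarith

end IsResidualLaw

end Rotation

/-! ### Second moments of the residual process -/

section ResidualMoments

open Topology

variable {n : ℕ} {ρ : Measure (EuclideanSpace ℝ (Fin n))} [IsProbabilityMeasure ρ]

namespace IsResidualLaw

theorem sum_integral_sq (hρ : IsResidualLaw ρ) : ∑ a, ∫ y, y a ^ 2 ∂ρ = n := by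
  rw [← integral_finsetSum _ fun a _ => hρ.integrable (by fun_prop),
    integral_congr_ae hρ.sum_sq_eq]
  simp

/-- The integration by parts for `f(y) = y ^ 3` and `s` the set of the other coordinates gives
`(n + 1) E y_a ^ 4 = 3 (n - 1) E y_a ^ 2`. -/
theorem integral_fourth_le (hρ : IsResidualLaw ρ) (a : Fin n) :
    ∫ y, y a ^ 4 ∂ρ ≤ 3 * ∫ y, y a ^ 2 ∂ρ := by
  have hn : 1 ≤ n := Nat.one_le_iff_ne_zero.2 fun h => (h ▸ a).elim0
  have hn' : (1 : ℝ) ≤ n := by exact_mod_cast hn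
  have h := hρ.integral_sum_rotation (a := a) (s := Finset.univ.erase a) (by simp)
    (f := fun x => x ^ 3) (f' := fun x => 3 * x ^ 2) (G := fun _ => 1)
    (fun x => by simpa using hasDerivAt_pow 3 x) (by fun_prop) continuous_const
    (fun _ _ _ _ _ _ _ => rfl)
  have hcard : ((Finset.univ.erase a).card : ℝ) = n - 1 := by
    rw [Finset.card_erase_of_mem (Finset.mem_univ a), Finset.card_univ, Fintype.card_fin,
      Nat.cast_sub hn, Nat.cast_one]
  rw [hcard] at h
  have e1 : ∀ᵐ y ∂ρ, (((n : ℝ) - 1) * (∑ b ∈ Finset.univ.erase a, y b ^ 2)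
      - (∑ b ∈ Finset.univ.erase a, y b) ^ 2) * (3 * y a ^ 2 * 1)
      = 3 * (n : ℝ) * (n - 1) * y a ^ 2 - 3 * (n : ℝ) * y a ^ 4 := by
    filter_upwards [hρ.sum_eq, hρ.sum_sq_eq] with y h1 h2
    rw [Finset.sum_erase_eq_sub (Finset.mem_univ a), Finset.sum_erase_eq_sub (Finset.mem_univ a),
      h1, h2]
    ring
  have e2 : ∀ᵐ y ∂ρ, (((n : ℝ) - 1) * y a - ∑ b ∈ Finset.univ.erase a, y b) * (y a ^ 3 * 1)
      = (n : ℝ) * y a ^ 4 := by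
    filter_upwards [hρ.sum_eq] with y h1
    rw [Finset.sum_erase_eq_sub (Finset.mem_univ a), h1]
    ring
  rw [integral_congr_ae e1, integral_congr_ae e2, integral_const_mul, integral_sub
    (hρ.integrable (by fun_prop)) (hρ.integrable (by fun_prop)), integral_const_mul,
    integral_const_mul] at h
  have h2 : 0 ≤ ∫ y, y a ^ 2 ∂ρ := integral_nonneg fun y => sq_nonneg _
  have h4 : (n : ℝ) * ((n + 1) * ∫ y, y a ^ 4 ∂ρ) = n * (3 * (n - 1) * ∫ y, y a ^ 2 ∂ρ) := by
    linear_combination -h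
  have h5 := mul_left_cancel₀ (by positivity) h4
  have h6 : ((n : ℝ) + 1) * ∫ y, y a ^ 4 ∂ρ ≤ (n + 1) * (3 * ∫ y, y a ^ 2 ∂ρ) := by
    rw [h5]; nlinarith
  exact le_of_mul_le_mul_left h6 (by positivity)

theorem sum_integral_fourth_le (hρ : IsResidualLaw ρ) : ∑ a, ∫ y, y a ^ 4 ∂ρ ≤ 3 * n := by
  rw [← hρ.sum_integral_sq, Finset.mul_sum]
  exact Finset.sum_le_sum fun a _ => hρ.integral_fourth_le a

/-- A bound for the integrand that remains after the integration by parts in two residuals `a` and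
`d`; here `m = n - 2` is the number of the other coordinates. -/
theorem abs_remainder_le {m t a d : ℝ} (hm : 1 ≤ m) :
    |((2 * m + 1 - m * (a ^ 2 + d ^ 2) - (a + d) ^ 2) * waveDeriv t a
      - (m - 1) * d * waveFun t a) * summand t d|
      ≤ (m + 1) * (32 * (1 + t ^ 2) * (1 + a ^ 4 + d ^ 4)) := by
  have k1 : |2 * m + 1 - m * (a ^ 2 + d ^ 2) - (a + d) ^ 2|
      ≤ (m + 1) * (2 * (1 + a ^ 2 + d ^ 2)) := by
    rw [abs_le]
    constructor <;> nlinarith [sq_nonneg (a - d), sq_nonneg (a + d), sq_nonneg a, sq_nonneg d,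
      mul_nonneg (by linarith : (0 : ℝ) ≤ m) (sq_nonneg a),
      mul_nonneg (by linarith : (0 : ℝ) ≤ m) (sq_nonneg d)]
  have k2 : |(m - 1) * d| ≤ (m + 1) * |d| := by
    rw [abs_mul, abs_of_nonneg (by linarith)]
    gcongr
    linarith
  have ht := abs_nonneg t
  have hd := abs_nonneg d
  have hst := sq_abs t
  have hsd := sq_abs d
  have k3 : (1 + a ^ 2 + d ^ 2) * (1 + |d|) ≤ 3 * (1 + a ^ 4 + d ^ 4) := by
    nlinarith [sq_nonneg ((1 + a ^ 2 + d ^ 2) - (1 + |d|)), sq_nonneg (|d| - 1),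
      sq_nonneg (d ^ 2 - 1), sq_nonneg (a ^ 2 - 1), sq_nonneg (a ^ 2 - d ^ 2), sq_nonneg (a ^ 2),
      sq_nonneg (d ^ 2)]
  have k4 : |t| * (|t| + |d|) ≤ (1 + t ^ 2) * (1 + |d|) := by
    nlinarith [mul_nonneg hd (sq_nonneg (|t| - 1)), mul_nonneg hd ht, mul_nonneg hd (sq_nonneg t)]
  have k5 : |d| * (|t| + |d|) ≤ 2 * ((1 + t ^ 2) * (1 + a ^ 4 + d ^ 4)) := by
    have : |d| * (|t| + |d|) ≤ 2 * (1 + t ^ 2 + d ^ 4) := by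
      nlinarith [sq_nonneg (|t| - |d|), sq_nonneg (d ^ 2 - 1)]
    nlinarith [mul_nonneg (sq_nonneg t) (sq_nonneg (a ^ 2)), sq_nonneg (a ^ 2),
      mul_nonneg (sq_nonneg t) (sq_nonneg (d ^ 2))]
  calc _ ≤ (|2 * m + 1 - m * (a ^ 2 + d ^ 2) - (a + d) ^ 2| * |waveDeriv t a|
        + |(m - 1) * d| * |waveFun t a|) * |summand t d| := by
        rw [abs_mul]
        refine mul_le_mul_of_nonneg_right ((norm_sub_le (E := ℝ) _ _).trans_eq ?_) (abs_nonneg _)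
        simp only [Real.norm_eq_abs, abs_mul]
    _ ≤ ((m + 1) * (2 * (1 + a ^ 2 + d ^ 2)) * (2 * |t|) + (m + 1) * |d| * 2)
        * (2 * (|t| + |d|)) := by
        gcongr
        · exact abs_waveDeriv_le t a
        · exact abs_waveFun_le t a
        · exact abs_summand_le t d
    _ = (m + 1) * (8 * ((1 + a ^ 2 + d ^ 2) * (|t| * (|t| + |d|))) + 4 * (|d| * (|t| + |d|))) := by
        ring
    _ ≤ (m + 1) * (8 * ((1 + a ^ 2 + d ^ 2) * ((1 + t ^ 2) * (1 + |d|)))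
        + 4 * (2 * ((1 + t ^ 2) * (1 + a ^ 4 + d ^ 4)))) := by gcongr
    _ = (m + 1) * (8 * (1 + t ^ 2) * ((1 + a ^ 2 + d ^ 2) * (1 + |d|))
        + 4 * (2 * ((1 + t ^ 2) * (1 + a ^ 4 + d ^ 4)))) := by ring
    _ ≤ (m + 1) * (8 * (1 + t ^ 2) * (3 * (1 + a ^ 4 + d ^ 4))
        + 4 * (2 * ((1 + t ^ 2) * (1 + a ^ 4 + d ^ 4)))) := by gcongr
    _ = _ := by ring

/-- Two different residuals are asymptotically uncorrelated: the covariance of functions of them is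
of order `1 / n`. Since `g_t(y) = y f_t(y) - f_t'(y)`, integration by parts in the coordinate `a`,
over the rotations that fix the coordinate `d`, cancels the leading term. -/
theorem abs_integral_summand_mul_summand_le (hρ : IsResidualLaw ρ) (hn : 4 ≤ n) {a d : Fin n}
    (had : a ≠ d) (t : ℝ) :
    |∫ y, summand t (y a) * summand t (y d) ∂ρ|
      ≤ 128 / n * (1 + t ^ 2) * (1 + ∫ y, y a ^ 4 ∂ρ + ∫ y, y d ^ 4 ∂ρ) := by
  have hn' : (4 : ℝ) ≤ n := by exact_mod_cast hn
  have hwf : Continuous (waveFun t) := by unfold waveFun; fun_prop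
  have hwd : Continuous (waveDeriv t) := by unfold waveDeriv; fun_prop
  have hsm : Continuous (summand t) := by unfold summand; fun_prop
  have hda : d ∈ Finset.univ.erase a := by simp [had.symm]
  have h := hρ.integral_sum_rotation (a := a) (s := (Finset.univ.erase a).erase d) (by simp)
    (f := waveFun t) (f' := waveDeriv t) (G := fun y => summand t (y d))
    (hasDerivAt_waveFun t) hwd (by fun_prop) (by
      intro b hb c hc y A B
      have hb' : d ≠ b := (Finset.ne_of_mem_erase hb).symm
      have hc' : d ≠ c := (Finset.ne_of_mem_erase hc).symm
      simp [dirP, dirQ, hb', hc', had.symm])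
  have hcard : (((Finset.univ.erase a).erase d).card : ℝ) = n - 2 := by
    rw [Finset.card_erase_of_mem hda, Finset.card_erase_of_mem (Finset.mem_univ a),
      Finset.card_univ, Fintype.card_fin, Nat.sub_sub, Nat.cast_sub (by omega)]
    norm_num
  rw [hcard] at h
  set m : ℝ := (n : ℝ) - 2 with hm
  -- `R` is what is left of `(m ^ 2 - 1) g_t(y_a) g_t(y_d)` after the integration by parts
  have hnm : (n : ℝ) = m + 2 := by rw [hm]; ring
  set R : EuclideanSpace ℝ (Fin n) → ℝ := fun y =>
    ((2 * m + 1 - m * (y a ^ 2 + y d ^ 2) - (y a + y d) ^ 2) * waveDeriv t (y a)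
      - (m - 1) * y d * waveFun t (y a)) * summand t (y d) with hR
  have hRc : Continuous R := by fun_prop
  have hs1 : ∀ k : Fin n → ℝ, ∑ b ∈ (Finset.univ.erase a).erase d, k b = ∑ b, k b - k a - k d :=
    fun k => by
      rw [Finset.sum_erase_eq_sub hda, Finset.sum_erase_eq_sub (Finset.mem_univ a)]
  have hkey : (m - 1) * ((m + 1) * ∫ y, summand t (y a) * summand t (y d) ∂ρ) = ∫ y, R y ∂ρ := by
    have e : ∀ᵐ y ∂ρ, R y = (m - 1) * ((m + 1) * (summand t (y a) * summand t (y d)))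
        + ((m * (∑ b ∈ (Finset.univ.erase a).erase d, y b ^ 2)
            - (∑ b ∈ (Finset.univ.erase a).erase d, y b) ^ 2)
              * (waveDeriv t (y a) * summand t (y d))
          - (m - 1) * ((m * y a - ∑ b ∈ (Finset.univ.erase a).erase d, y b)
              * (waveFun t (y a) * summand t (y d)))) := by
      filter_upwards [hρ.sum_eq, hρ.sum_sq_eq] with y h1 h2
      rw [hs1 fun b => y b ^ 2, hs1 fun b => y b, h1, h2, hR, hnm, summand_eq t (y a)]
      ring
    rw [integral_congr_ae e, integral_add (hρ.integrable (by fun_prop))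
      (hρ.integrable (by fun_prop)), integral_sub (hρ.integrable (by fun_prop))
      (hρ.integrable (by fun_prop)), h]
    simp_rw [integral_const_mul]
    ring
  set Q : ℝ := 1 + ∫ y, y a ^ 4 ∂ρ + ∫ y, y d ^ 4 ∂ρ with hQ
  have hQ0 : 0 ≤ Q := by
    have h1 : 0 ≤ ∫ y, y a ^ 4 ∂ρ := integral_nonneg fun y => by positivity
    have h2 : 0 ≤ ∫ y, y d ^ 4 ∂ρ := integral_nonneg fun y => by positivity
    positivity
  have hRle : |∫ y, R y ∂ρ| ≤ (m + 1) * (32 * (1 + t ^ 2) * Q) := by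
    calc |∫ y, R y ∂ρ| ≤ ∫ y, |R y| ∂ρ := abs_integral_le_integral_abs
      _ ≤ ∫ y, (m + 1) * (32 * (1 + t ^ 2) * (1 + y a ^ 4 + y d ^ 4)) ∂ρ :=
        integral_mono (hρ.integrable hRc).abs (hρ.integrable (by fun_prop)) fun y =>
          abs_remainder_le (by rw [hm]; linarith)
      _ = _ := by
        rw [integral_const_mul, integral_const_mul, integral_add (hρ.integrable (by fun_prop))
          (hρ.integrable (by fun_prop)), integral_add (hρ.integrable (by fun_prop))
          (hρ.integrable (by fun_prop))]
        simp [hQ]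
  rw [← hkey, abs_mul, abs_mul, abs_of_nonneg (by linarith : 0 ≤ m - 1),
    abs_of_nonneg (by linarith : 0 ≤ m + 1), mul_left_comm] at hRle
  have h1 := le_of_mul_le_mul_left hRle (by linarith)
  set I := |∫ y, summand t (y a) * summand t (y d) ∂ρ| with hI
  have hI0 : 0 ≤ I := abs_nonneg _
  rw [div_mul_eq_mul_div, div_mul_eq_mul_div, le_div_iff₀ (by linarith)]
  have h2 : (n : ℝ) ≤ 4 * (m - 1) := by rw [hm]; linarith
  nlinarith [mul_le_mul_of_nonneg_left h2 hI0]

/-- The diagonal terms contribute a bounded amount, and the `n ^ 2` mixed terms are of order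
`1 / n`. -/
theorem integral_sq_sum_summand_le (hρ : IsResidualLaw ρ) (hn : 4 ≤ n) (t : ℝ) :
    ∫ y, ((1 / √n) * ∑ a, summand t (y a)) ^ 2 ∂ρ ≤ 1000 * (1 + t ^ 2) := by
  have hn' : (4 : ℝ) ≤ n := by exact_mod_cast hn
  have hsm : Continuous (summand t) := by unfold summand; fun_prop
  have e : ∀ y : EuclideanSpace ℝ (Fin n), ((1 / √n) * ∑ a, summand t (y a)) ^ 2
      = (1 / n) * ∑ a, ∑ d, summand t (y a) * summand t (y d) := by
    intro y
    rw [mul_pow, div_pow, Real.sq_sqrt (by positivity), one_pow, sq (∑ a, _), Finset.sum_mul_sum]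
  simp_rw [e]
  rw [integral_const_mul, integral_finsetSum _ fun a _ => hρ.integrable (by fun_prop)]
  rw [Finset.sum_congr rfl fun a _ => integral_finsetSum Finset.univ fun d _ =>
    hρ.integrable (F := fun y => summand t (y a) * summand t (y d)) (by fun_prop)]
  set q : Fin n → ℝ := fun a => ∫ y, y a ^ 2 ∂ρ with hq
  set r : Fin n → ℝ := fun a => ∫ y, y a ^ 4 ∂ρ with hr
  have hr0 : ∀ a, 0 ≤ r a := fun a => integral_nonneg fun y => by positivity
  have hdiag : ∀ a, ∫ y, summand t (y a) * summand t (y a) ∂ρ ≤ 8 * t ^ 2 + 8 * q a := by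
    intro a
    have : ∀ y : EuclideanSpace ℝ (Fin n), summand t (y a) * summand t (y a)
        ≤ 8 * t ^ 2 + 8 * y a ^ 2 := by
      intro y
      have h1 := abs_summand_le t (y a)
      have h2 : |summand t (y a)| ^ 2 ≤ (2 * (|t| + |y a|)) ^ 2 :=
        pow_le_pow_left₀ (abs_nonneg _) h1 2
      rw [sq_abs] at h2
      nlinarith [sq_nonneg (|t| - |y a|), sq_abs t, sq_abs (y a)]
    calc _ ≤ ∫ y, 8 * t ^ 2 + 8 * y a ^ 2 ∂ρ :=
          integral_mono (hρ.integrable (by fun_prop)) (hρ.integrable (by fun_prop)) this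
      _ = _ := by
          rw [integral_add (hρ.integrable (by fun_prop)) (hρ.integrable (by fun_prop)),
            integral_const_mul 8 fun y : EuclideanSpace ℝ (Fin n) => y a ^ 2]
          simp [hq]
  have hterm : ∀ a d, ∫ y, summand t (y a) * summand t (y d) ∂ρ
      ≤ (if a = d then 8 * t ^ 2 + 8 * q a else 0) + 128 / n * (1 + t ^ 2) * (1 + r a + r d) := by
    intro a d
    have h0 : 0 ≤ 128 / n * (1 + t ^ 2) * (1 + r a + r d) := by
      have := hr0 a; have := hr0 d; positivity
    split_ifs with h
    · subst h; linarith [hdiag a]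
    · rw [zero_add]
      exact (le_abs_self _).trans (hρ.abs_integral_summand_mul_summand_le hn h t)
  calc (1 / (n : ℝ)) * ∑ a, ∑ d, ∫ y, summand t (y a) * summand t (y d) ∂ρ
      ≤ (1 / n) * ∑ a, ∑ d, ((if a = d then 8 * t ^ 2 + 8 * q a else 0)
        + 128 / n * (1 + t ^ 2) * (1 + r a + r d)) := by
        gcongr with a _ d _
        exact hterm a d
    _ = (1 / n) * ((n * (8 * t ^ 2) + 8 * ∑ a, q a)
        + 128 / n * (1 + t ^ 2) * (n * n + 2 * (n * ∑ a, r a))) := by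
        simp_rw [Finset.sum_add_distrib, ← Finset.mul_sum, Finset.sum_add_distrib,
          Finset.sum_ite_eq, Finset.mem_univ, if_true, Finset.sum_add_distrib, ← Finset.mul_sum]
        simp [← Finset.mul_sum]
        exact Or.inl (by ring)
    _ ≤ (1 / n) * ((n * (8 * t ^ 2) + 8 * n)
        + 128 / n * (1 + t ^ 2) * (n * n + 2 * (n * (3 * n)))) := by
        gcongr
        · exact hρ.sum_integral_sq.le
        · exact hρ.sum_integral_fourth_le
    _ = 904 * (1 + t ^ 2) := by field_simp; ring
    _ ≤ 1000 * (1 + t ^ 2) := by nlinarith [sq_nonneg t]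

end IsResidualLaw

end ResidualMoments

/-! ### The law of the residuals -/

section ResidualLaw

open Topology

variable {n : ℕ}

/-- The orthogonal projection onto the complement of the vector `1`. -/
noncomputable def centering (x : EuclideanSpace ℝ (Fin n)) : EuclideanSpace ℝ (Fin n) :=
  x - (inner ℝ (oneVec n) x / n) • oneVec n

/-- The vector of scaled residuals of a sample; it is zero when the sample is constant. -/
noncomputable def residualVec (x : EuclideanSpace ℝ (Fin n)) : EuclideanSpace ℝ (Fin n) :=
  (√(‖centering x‖ ^ 2 / n))⁻¹ • centering x

theorem residual_eq_residualVec (x : ℕ → ℝ) (i : Fin n) :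
    residual n x i = residualVec (WithLp.toLp 2 fun i : Fin n => x i) i := by
  have h1 : sampleMean n x = inner ℝ (oneVec n) (WithLp.toLp 2 fun i : Fin n => x i) / n := by
    rw [inner_oneVec, sampleMean, Finset.sum_range]
    simp only
    ring
  have h2 : ∀ i : Fin n, centering (WithLp.toLp 2 fun i : Fin n => x i) i
      = x i - sampleMean n x := by
    intro i
    rw [h1]
    simp [centering, oneVec]
  have h3 : sampleSD n x = √(‖centering (WithLp.toLp 2 fun i : Fin n => x i)‖ ^ 2 / n) := by
    rw [sampleSD, EuclideanSpace.real_norm_sq_eq, Finset.sum_range]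
    simp_rw [h2]
    rw [one_div_mul_eq_div]
  rw [residual, residualVec, ← h3]
  simp [h2, div_eq_inv_mul]

theorem continuous_centering : Continuous (centering (n := n)) := by
  unfold centering; fun_prop

theorem measurable_residualVec : Measurable (residualVec (n := n)) := by
  have := (continuous_centering (n := n)).measurable
  unfold residualVec; fun_prop

theorem inner_oneVec_centering (hn : n ≠ 0) (x : EuclideanSpace ℝ (Fin n)) :
    inner ℝ (oneVec n) (centering x) = 0 := by
  have hn' : (n : ℝ) ≠ 0 := by exact_mod_cast hn
  rw [centering, inner_sub_right, inner_smul_right, inner_oneVec (oneVec n)]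
  simp [oneVec]
  field_simp
  simp

/-- The residuals are equivariant under the isometries that fix the vector `1`. -/
theorem residualVec_isometry (U : EuclideanSpace ℝ (Fin n) →ₗᵢ[ℝ] EuclideanSpace ℝ (Fin n))
    (hU : U (oneVec n) = oneVec n) (x : EuclideanSpace ℝ (Fin n)) :
    residualVec (U x) = U (residualVec x) := by
  have h : centering (U x) = U (centering x) := by
    have : inner ℝ (oneVec n) (U x) = inner ℝ (oneVec n) x := by
      rw [← U.inner_map_map (oneVec n) x, hU]
    rw [centering, centering, this, map_sub, map_smul, hU]
  rw [residualVec, residualVec, h, U.norm_map, map_smul]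

/-- The sample standard deviation is almost surely positive: two observations differ. -/
theorem ae_centering_ne_zero (hn : 2 ≤ n) :
    ∀ᵐ x ∂(stdGaussian (EuclideanSpace ℝ (Fin n))), centering x ≠ 0 := by
  set i : Fin n := ⟨0, by omega⟩
  set j : Fin n := ⟨1, by omega⟩
  have hij : i ≠ j := by simp [i, j]
  set L : StrongDual ℝ (EuclideanSpace ℝ (Fin n)) :=
    innerSL ℝ (EuclideanSpace.single i 1 - EuclideanSpace.single j 1) with hL
  have hLx : ∀ x : EuclideanSpace ℝ (Fin n), L x = x i - x j := by
    intro x; simp [hL, EuclideanSpace.inner_single_left]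
  have hne : ‖L‖ ≠ 0 := by
    rw [norm_ne_zero_iff]
    intro h
    have h1 := hLx (EuclideanSpace.single i 1)
    rw [h] at h1
    simp [hij.symm] at h1
  have hmap := IsGaussian.map_eq_gaussianReal (μ := stdGaussian (EuclideanSpace ℝ (Fin n))) L
  rw [variance_dual_stdGaussian] at hmap
  have hnull : ∀ᵐ z ∂((stdGaussian (EuclideanSpace ℝ (Fin n))).map L), z ≠ 0 := by
    rw [hmap]
    have := nullSingletonClass_gaussianReal
      (μ := (stdGaussian (EuclideanSpace ℝ (Fin n)))[L]) (v := (‖L‖ ^ 2).toNNReal)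
      (by simpa using hne)
    exact compl_mem_ae_iff.2 (measure_singleton (0 : ℝ))
  filter_upwards [ae_of_ae_map L.continuous.measurable.aemeasurable hnull] with x hx h
  rw [centering, sub_eq_zero] at h
  refine hx ?_
  rw [hLx, h]
  simp [oneVec]

theorem isResidualLaw_map_residualVec (hn : 2 ≤ n) :
    IsResidualLaw ((stdGaussian (EuclideanSpace ℝ (Fin n))).map residualVec) where
  invariant U hU := by
    have e : U ∘ residualVec = residualVec ∘ U := by
      ext1 x; exact (residualVec_isometry U hU x).symm
    rw [Measure.map_map U.continuous.measurable measurable_residualVec, e,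
      ← Measure.map_map measurable_residualVec U.continuous.measurable]
    congr 1
    exact stdGaussian_map (U.toLinearIsometryEquiv rfl)
  sum_eq := by
    refine (ae_map_iff measurable_residualVec.aemeasurable
      (measurableSet_eq_fun (by fun_prop) measurable_const)).2 (ae_of_all _ fun x => ?_)
    rw [← inner_oneVec, residualVec, inner_smul_right, inner_oneVec_centering (by omega), mul_zero]
  sum_sq_eq := by
    refine (ae_map_iff measurable_residualVec.aemeasurable
      (measurableSet_eq_fun (by fun_prop) measurable_const)).2 ?_
    filter_upwards [ae_centering_ne_zero hn] with x hx
    have hn' : (n : ℝ) ≠ 0 := by norm_cast; omega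
    rw [← EuclideanSpace.real_norm_sq_eq, residualVec, norm_smul, mul_pow, norm_inv, inv_pow,
      Real.norm_eq_abs, sq_abs, Real.sq_sqrt (by positivity)]
    have := norm_ne_zero_iff.2 hx
    field_simp

variable {Ω : Type*} [MeasurableSpace Ω] {P : Measure Ω} [IsProbabilityMeasure P]

omit [IsProbabilityMeasure P] in
theorem map_sample_eq_stdGaussian {X : ℕ → Ω → ℝ} (hm : ∀ j, Measurable (X j))
    (hlaw : ∀ j, P.map (X j) = gaussianReal 0 1) (hindep : iIndepFun X P) (n : ℕ) :
    P.map (fun ω => (WithLp.toLp 2 fun i : Fin n => X i ω : EuclideanSpace ℝ (Fin n)))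
      = stdGaussian (EuclideanSpace ℝ (Fin n)) := by
  have h := (hindep.precomp (g := fun i : Fin n => (i : ℕ)) Fin.val_injective)
  replace h := iIndepFun.map_fun_eq_pi_map (f := fun i : Fin n => X i)
    (fun i => (hm i).aemeasurable) h
  simp_rw [hlaw] at h
  rw [← map_pi_eq_stdGaussian, ← h, Measure.map_map (by fun_prop) (by fun_prop)]
  rfl

omit [IsProbabilityMeasure P] in
/-- The second moments of the residual process grow at most quadratically in `t`, uniformly
in `n`. -/
theorem lintegral_sq_residualProcess_le {X : ℕ → Ω → ℝ} (hm : ∀ j, Measurable (X j))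
    (hlaw : ∀ j, P.map (X j) = gaussianReal 0 1) (hindep : iIndepFun X P) (hn : 4 ≤ n) (t : ℝ) :
    ∫⁻ ω, ENNReal.ofReal (residualProcess n (fun j => X j ω) t ^ 2) ∂P
      ≤ ENNReal.ofReal (1000 * (1 + t ^ 2)) := by
  have hρ := isResidualLaw_map_residualVec (n := n) (by omega)
  have hsm : Continuous (summand t) := by unfold summand; fun_prop
  have hc : Continuous fun y : EuclideanSpace ℝ (Fin n) =>
    ((1 / √n) * ∑ a, summand t (y a)) ^ 2 := by fun_prop
  have : IsProbabilityMeasure ((stdGaussian (EuclideanSpace ℝ (Fin n))).map residualVec) :=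
    Measure.isProbabilityMeasure_map measurable_residualVec.aemeasurable
  have hcr := hc.measurable.ennreal_ofReal.comp (measurable_residualVec (n := n))
  rw [Function.comp_def] at hcr
  have h1 := ENNReal.ofReal_le_ofReal (hρ.integral_sq_sum_summand_le hn t)
  rw [ofReal_integral_eq_lintegral_ofReal (hρ.integrable hc) (ae_of_all _ fun y => sq_nonneg _),
    lintegral_map hc.measurable.ennreal_ofReal measurable_residualVec,
    ← map_sample_eq_stdGaussian hm hlaw hindep,
    lintegral_map hcr (by fun_prop)] at h1
  refine le_of_eq_of_le (lintegral_congr fun ω => ?_) h1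
  rw [residualProcess_eq, Finset.sum_range]
  simp_rw [residual_eq_residualVec]

end ResidualLaw

/-! ### Linearization of the residual process -/

section Linearization

open Topology

/-- The normalized sum `n⁻¹ᐟ² ∑ h (x_j)` over the sample of size `n`. -/
noncomputable def normSum (h : ℝ → ℝ) (n : ℕ) (x : ℕ → ℝ) : ℝ :=
  (1 / √n) * ∑ j ∈ Finset.range n, h (x j)

/-- The linearized process, a normalized sum of independent centred summands. -/
noncomputable def linProcess (n : ℕ) (x : ℕ → ℝ) (t : ℝ) : ℝ := normSum (linSummand t) n x

/-- The centred function `x g_t'(x) - E X g_t'(X)`: it multiplies the error of the variance. -/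
noncomputable def scaleFun (t x : ℝ) : ℝ := x * summandDeriv t x + 2 * t * Real.exp (-t ^ 2 / 2)

/-- The centred function `g_t'(x) - E g_t'(X)`: it multiplies the error of the mean. -/
noncomputable def shiftFun (t x : ℝ) : ℝ := summandDeriv t x - Real.exp (-t ^ 2 / 2)

/-- The second-order Taylor bound, for increments that do not exceed `(1 + |x|) / 2`: the mean value
inequality is applied twice. -/
theorem abs_summand_sub_taylor_le {t T x y : ℝ} (ht : |t| ≤ T) (hxy : |y - x| ≤ (1 + |x|) / 2) :
    |summand t y - summand t x - summandDeriv t x * (y - x)|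
      ≤ (4 * T + 4 * T ^ 2 + 2 * T ^ 3) * (1 + |x|) * (y - x) ^ 2 := by
  have hT : 0 ≤ T := (abs_nonneg t).trans ht
  have ht2 : t ^ 2 ≤ T ^ 2 := by rw [← sq_abs]; exact pow_le_pow_left₀ (abs_nonneg t) ht 2
  set C := (4 * T + 4 * T ^ 2 + 2 * T ^ 3) * (1 + |x|) with hC
  have hx := abs_nonneg x
  have hz : ∀ z ∈ Set.uIcc x y, |z - x| ≤ |y - x| := fun z hz => Set.abs_sub_left_of_mem_uIcc hz
  have hsecond : ∀ z ∈ Set.uIcc x y, |summandDeriv2 t z| ≤ C := by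
    intro z hz'
    have h1 : |z| ≤ 2 * (1 + |x|) := by
      have h2 := abs_add_le (z - x) x
      rw [sub_add_cancel] at h2
      linarith [hz z hz']
    refine (abs_summandDeriv2_le t z).trans ?_
    calc 4 * |t| + 2 * t ^ 2 * |z| + 2 * t ^ 2 * |t|
        ≤ 4 * T + 2 * T ^ 2 * (2 * (1 + |x|)) + 2 * T ^ 2 * T := by gcongr
      _ ≤ C := by
        rw [hC]
        nlinarith [mul_nonneg hT hx, mul_nonneg (pow_nonneg hT 3) hx]
  have hfirst : ∀ z ∈ Set.uIcc x y, |summandDeriv t z - summandDeriv t x| ≤ C * |y - x| := by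
    intro z hz'
    have h1 := (convex_uIcc x y).norm_image_sub_le_of_norm_hasDerivWithin_le
      (fun u _ => (hasDerivAt_summandDeriv t u).hasDerivWithinAt) hsecond Set.left_mem_uIcc hz'
    exact h1.trans (mul_le_mul_of_nonneg_left (hz z hz') (by rw [hC]; positivity))
  have hmain := (convex_uIcc x y).norm_image_sub_le_of_norm_hasDerivWithin_le
    (f := fun u => summand t u - summandDeriv t x * u)
    (f' := fun u => summandDeriv t u - summandDeriv t x)
    (fun u _ => ((hasDerivAt_summand t u).sub
      (by simpa using (hasDerivAt_id u).const_mul (summandDeriv t x))).hasDerivWithinAt)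
    hfirst Set.left_mem_uIcc Set.right_mem_uIcc
  simp only [Real.norm_eq_abs] at hmain
  calc _ = |summand t y - summandDeriv t x * y - (summand t x - summandDeriv t x * x)| := by
        congr 1; ring
    _ ≤ C * |y - x| * |y - x| := hmain
    _ = C * (y - x) ^ 2 := by rw [mul_assoc, abs_mul_abs_self, sq]

/-- The error of the sample standard deviation `S`, in terms of the mean `a` and of the second
moment `V` of the sample. -/
theorem scale_bounds {a V S : ℝ} (hS0 : 0 ≤ S) (hS : S ^ 2 = V - a ^ 2)
    (hD : |V - 1| + |a| ≤ 1 / 4) :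
    0 < S ∧ |1 / S - 1| ≤ 2 * (|V - 1| + |a|) ∧ 1 / S ≤ 2 ∧
      |2 * (1 / S - 1) + V - 1| ≤ 6 * (|V - 1| + |a|) ^ 2 := by
  set D := |V - 1| + |a| with hDdef
  have hv0 := abs_nonneg (V - 1)
  have ha0 := abs_nonneg a
  have hD0 : 0 ≤ D := by positivity
  have ha2 : a ^ 2 = |a| ^ 2 := (sq_abs a).symm
  have haD : a ^ 2 ≤ D ^ 2 := by rw [ha2]; exact pow_le_pow_left₀ ha0 (by linarith) 2
  have hS2 : |S ^ 2 - 1| ≤ D := by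
    rw [hS, abs_le]
    have := abs_le.1 (le_refl |V - 1|)
    constructor <;> nlinarith
  have hS3 := abs_le.1 hS2
  have hS1 : 1 / 2 ≤ S := by nlinarith
  have hSpos : 0 < S := by linarith
  have h1 : |S - 1| ≤ D := by
    have : |S - 1| * (S + 1) = |S ^ 2 - 1| := by
      rw [← abs_of_nonneg (by linarith : 0 ≤ S + 1), ← abs_mul]; ring_nf
    nlinarith [abs_nonneg (S - 1)]
  have h2 : 1 / S ≤ 2 := by rw [div_le_iff₀ hSpos]; linarith
  have h0 : 0 < 1 / S := by positivity
  refine ⟨hSpos, ?_, h2, ?_⟩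
  · have : 1 / S - 1 = -(1 / S * (S - 1)) := by field_simp; ring
    rw [this, abs_neg, abs_mul, abs_of_pos h0]
    exact mul_le_mul h2 h1 (abs_nonneg _) (by norm_num)
  -- the terms of first order cancel: `2 / S - 2 + S ^ 2 - 1 = (S - 1) ^ 2 (S + 2) / S`
  · have e : 2 * (1 / S - 1) + V - 1 = (S - 1) ^ 2 * (1 + 2 * (1 / S)) + a ^ 2 := by
      have hV : V = S ^ 2 + a ^ 2 := by linarith
      rw [hV]; field_simp; ring
    rw [e, abs_of_nonneg (by positivity)]
    have h3 : (S - 1) ^ 2 ≤ D ^ 2 := by rw [← sq_abs]; exact pow_le_pow_left₀ (abs_nonneg _) h1 2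
    nlinarith [mul_le_mul h3 (by linarith : 1 + 2 * (1 / S) ≤ 5) (by positivity) (sq_nonneg D)]

theorem one_add_abs_cube_le (x : ℝ) : (1 + |x|) ^ 3 ≤ 8 * (1 + x ^ 4) := by
  have h : x ^ 4 = |x| ^ 4 := by rw [← abs_pow]; exact (abs_of_nonneg (by positivity)).symm
  rw [h]
  have := abs_nonneg x
  nlinarith [mul_nonneg this (sq_nonneg (|x| - 1)), sq_nonneg (|x| ^ 2 - |x|), sq_nonneg (|x| - 1),
    sq_nonneg (|x| ^ 2 - 1)]

theorem sampleSD_sq (n : ℕ) (x : ℕ → ℝ) :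
    sampleSD n x ^ 2 = (1 / n) * ∑ j ∈ Finset.range n, x j ^ 2 - sampleMean n x ^ 2 := by
  rw [sampleSD,
    Real.sq_sqrt (mul_nonneg (by positivity) (Finset.sum_nonneg fun _ _ => sq_nonneg _))]
  rcases Nat.eq_zero_or_pos n with rfl | hn
  · simp [sampleMean]
  have hn' : (n : ℝ) ≠ 0 := by positivity
  have hs : ∑ j ∈ Finset.range n, x j = n * sampleMean n x := by rw [sampleMean]; field_simp
  simp_rw [sub_sq, Finset.sum_add_distrib, Finset.sum_sub_distrib, ← Finset.sum_mul,
    ← Finset.mul_sum, hs]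
  simp
  field_simp
  ring

/-- The deterministic form of the linearization: `|V - 1| + |a|`, the error of the estimates of the
two parameters, enters to the second order, or to the first order times a centred sum. -/
theorem abs_sum_summand_residual_sub_le {n : ℕ} (hn : 0 < n) {x : ℕ → ℝ} {t T D : ℝ} (ht : |t| ≤ T)
    (hDdef : D = |(1 / (n : ℝ)) * ∑ j ∈ Finset.range n, x j ^ 2 - 1| + |sampleMean n x|)
    (hD : D ≤ 1 / 4) :
    |∑ j ∈ Finset.range n, summand t (residual n x j) - ∑ j ∈ Finset.range n, linSummand t (x j)|
      ≤ 32 * (4 * T + 4 * T ^ 2 + 2 * T ^ 3) * D ^ 2 * (n + ∑ j ∈ Finset.range n, x j ^ 4)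
        + 2 * D * (|∑ j ∈ Finset.range n, scaleFun t (x j)|
          + |∑ j ∈ Finset.range n, shiftFun t (x j)|) + n * ((2 + 6 * T) * D ^ 2) := by
  have hn' : (n : ℝ) ≠ 0 := by positivity
  have hT : 0 ≤ T := (abs_nonneg t).trans ht
  set a := sampleMean n x with ha
  set V := (1 / (n : ℝ)) * ∑ j ∈ Finset.range n, x j ^ 2 with hV
  set S := sampleSD n x with hS
  rw [hDdef] at hD
  obtain ⟨hSpos, hk, hS2, hquad⟩ := scale_bounds (S := S) (Real.sqrt_nonneg _)
    (sampleSD_sq n x) hD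
  rw [← hDdef] at hD hk hquad
  have hD0 : 0 ≤ D := by rw [hDdef]; positivity
  have haD : |a| ≤ D := by rw [hDdef]; linarith [abs_nonneg (V - 1)]
  -- the residual is `x_j + κ x_j - (1 + κ) a`
  set κ := 1 / S - 1 with hκ
  set e := Real.exp (-t ^ 2 / 2) with he
  have he0 : 0 ≤ e := (Real.exp_pos _).le
  have he1 : e ≤ 1 := exp_neg_sq_le_one t
  have hκ1 : |1 + κ| ≤ 2 := by
    rw [hκ, add_sub_cancel, abs_of_pos (by positivity)]; exact hS2
  have hres : ∀ j, residual n x j - x j = κ * x j - (1 + κ) * a := by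
    intro j; rw [residual, ← hS, ← ha, hκ]; field_simp; ring
  have hδ : ∀ j, |residual n x j - x j| ≤ 2 * D * (1 + |x j|) := by
    intro j
    rw [hres]
    refine (abs_sub _ _).trans ?_
    rw [abs_mul, abs_mul]
    nlinarith [mul_le_mul_of_nonneg_right hk (abs_nonneg (x j)),
      mul_le_mul hκ1 haD (abs_nonneg a) (by norm_num)]
  set rem : ℕ → ℝ := fun j => summand t (residual n x j) - summand t (x j)
    - summandDeriv t (x j) * (residual n x j - x j) with hrem
  have hremle : ∀ j, |rem j| ≤ 32 * (4 * T + 4 * T ^ 2 + 2 * T ^ 3) * D ^ 2 * (1 + x j ^ 4) := by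
    intro j
    have hxj := abs_nonneg (x j)
    have h1 := abs_summand_sub_taylor_le (x := x j) (y := residual n x j) ht (by nlinarith [hδ j])
    have h2 : (residual n x j - x j) ^ 2 ≤ (2 * D * (1 + |x j|)) ^ 2 := by
      rw [← sq_abs]; exact pow_le_pow_left₀ (abs_nonneg _) (hδ j) 2
    calc |rem j| ≤ (4 * T + 4 * T ^ 2 + 2 * T ^ 3) * (1 + |x j|) * (residual n x j - x j) ^ 2 := h1
      _ ≤ (4 * T + 4 * T ^ 2 + 2 * T ^ 3) * (1 + |x j|) * (2 * D * (1 + |x j|)) ^ 2 := by gcongr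
      _ = 4 * (4 * T + 4 * T ^ 2 + 2 * T ^ 3) * D ^ 2 * (1 + |x j|) ^ 3 := by ring
      _ ≤ 4 * (4 * T + 4 * T ^ 2 + 2 * T ^ 3) * D ^ 2 * (8 * (1 + x j ^ 4)) := by
          gcongr; exact one_add_abs_cube_le _
      _ = _ := by ring
  have hsx : ∑ j ∈ Finset.range n, x j = n * a := by rw [ha, sampleMean]; field_simp
  have hsx2 : ∑ j ∈ Finset.range n, x j ^ 2 = n * V := by rw [hV]; field_simp
  -- the terms of `linSummand` are chosen so that the terms of first order in `κ` and `a` cancel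
  have key : ∑ j ∈ Finset.range n, summand t (residual n x j)
      - ∑ j ∈ Finset.range n, linSummand t (x j)
      = ∑ j ∈ Finset.range n, rem j + (κ * ∑ j ∈ Finset.range n, scaleFun t (x j)
        - (1 + κ) * a * ∑ j ∈ Finset.range n, shiftFun t (x j))
        + n * (-(κ * a * e) - t * e * (2 * κ + V - 1)) := by
    have hj : ∀ j, summand t (residual n x j) - linSummand t (x j)
        = rem j + κ * scaleFun t (x j) - (1 + κ) * a * shiftFun t (x j)
          - (2 * κ * t * e + (1 + κ) * a * e) + x j * e - (x j ^ 2 * (t * e) - t * e) := by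
      intro j
      simp only [hrem, hres, scaleFun, shiftFun, linSummand, ← he]
      ring
    rw [← Finset.sum_sub_distrib, Finset.sum_congr rfl fun j _ => hj j]
    simp_rw [Finset.sum_sub_distrib, Finset.sum_add_distrib, Finset.sum_sub_distrib,
      Finset.sum_add_distrib, ← Finset.mul_sum, ← Finset.sum_mul, hsx, hsx2, Finset.sum_const,
      Finset.card_range, nsmul_eq_mul]
    ring
  have b1 : |∑ j ∈ Finset.range n, rem j|
      ≤ 32 * (4 * T + 4 * T ^ 2 + 2 * T ^ 3) * D ^ 2 * (n + ∑ j ∈ Finset.range n, x j ^ 4) := by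
    refine (Finset.abs_sum_le_sum_abs _ _).trans ((Finset.sum_le_sum fun j _ => hremle j).trans ?_)
    rw [← Finset.mul_sum, Finset.sum_add_distrib]
    simp
  have b2 : |κ * ∑ j ∈ Finset.range n, scaleFun t (x j)
      - (1 + κ) * a * ∑ j ∈ Finset.range n, shiftFun t (x j)|
      ≤ 2 * D * (|∑ j ∈ Finset.range n, scaleFun t (x j)|
          + |∑ j ∈ Finset.range n, shiftFun t (x j)|) := by
    refine (abs_sub _ _).trans ?_
    rw [mul_add, abs_mul, abs_mul, abs_mul]
    gcongr
  have b3 : |-(κ * a * e) - t * e * (2 * κ + V - 1)| ≤ (2 + 6 * T) * D ^ 2 := by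
    refine (abs_sub _ _).trans ?_
    rw [abs_neg, abs_mul, abs_mul, abs_mul, abs_mul, abs_of_nonneg he0]
    have c1 : |κ| * |a| * e ≤ 2 * D * D * 1 := by gcongr
    have c2 : |t| * e * |2 * κ + V - 1| ≤ T * 1 * (6 * D ^ 2) := by gcongr
    linarith
  rw [key]
  refine (abs_add_le _ _).trans (add_le_add ((abs_add_le _ _).trans (add_le_add b1 b2)) ?_)
  rw [abs_mul, abs_of_nonneg (Nat.cast_nonneg n)]
  gcongr

/-- The normalized error of the estimates of the two parameters: `√n (|V - 1| + |a|)` with `a` the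
mean and `V` the second moment of the sample. -/
noncomputable def paramError (n : ℕ) (x : ℕ → ℝ) : ℝ :=
  |normSum (fun x => x ^ 2 - 1) n x| + |normSum (fun x => x) n x|

/-- The fourth moment of the sample. -/
noncomputable def fourthMoment (n : ℕ) (x : ℕ → ℝ) : ℝ :=
  (1 / (n : ℝ)) * ∑ j ∈ Finset.range n, x j ^ 4

theorem fourthMoment_nonneg (n : ℕ) (x : ℕ → ℝ) : 0 ≤ fourthMoment n x :=
  mul_nonneg (by positivity) (Finset.sum_nonneg fun _ _ => by positivity)

/-- The constant in the linearization for `|t| ≤ T`. -/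
noncomputable def linConst (T : ℝ) : ℝ := 32 * (4 * T + 4 * T ^ 2 + 2 * T ^ 3) + 2 + 6 * T

/-- The squared error of the linearization is `1 / n` times an expression in normalized sums and the
fourth moment of the sample, all of which are bounded in probability. -/
theorem sq_residualProcess_sub_linProcess_le {n : ℕ} (hn : 0 < n) {x : ℕ → ℝ} {t T : ℝ}
    (ht : |t| ≤ T) (hB : 16 * paramError n x ^ 2 ≤ n) :
    (residualProcess n x t - linProcess n x t) ^ 2
      ≤ 3 * linConst T ^ 2 / n * ((paramError n x ^ 2 * (1 + fourthMoment n x)) ^ 2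
        + paramError n x ^ 2 * (normSum (scaleFun t) n x ^ 2 + normSum (shiftFun t) n x ^ 2)) := by
  have hT : 0 ≤ T := (abs_nonneg t).trans ht
  set B := paramError n x with hBdef
  set M := fourthMoment n x with hM
  set p := normSum (scaleFun t) n x with hp
  set q := normSum (shiftFun t) n x with hq
  have hn0 : (0 : ℝ) < n := by exact_mod_cast hn
  set r := √(n : ℝ) with hr
  have hr0 : 0 < r := Real.sqrt_pos.2 hn0
  have hrr : r ^ 2 = n := Real.sq_sqrt hn0.le
  have hB0 : 0 ≤ B := by rw [hBdef, paramError]; positivity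
  have hM0 : 0 ≤ M := fourthMoment_nonneg n x
  have hD : B / r = |(1 / (n : ℝ)) * ∑ j ∈ Finset.range n, x j ^ 2 - 1| + |sampleMean n x| := by
    have e1 : (1 / (n : ℝ)) * ∑ j ∈ Finset.range n, x j ^ 2 - 1
        = normSum (fun x => x ^ 2 - 1) n x / r := by
      rw [normSum, Finset.sum_sub_distrib, ← hr, ← hrr]
      simp only [Finset.sum_const, Finset.card_range, nsmul_eq_mul, ← hrr]
      field_simp
    have e2 : sampleMean n x = normSum (fun x => x) n x / r := by
      rw [normSum, sampleMean, ← hr, ← hrr]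
      field_simp
    rw [e1, e2, abs_div, abs_div, abs_of_pos hr0, ← add_div]
    rfl
  have hDle : B / r ≤ 1 / 4 := by
    rw [div_le_iff₀ hr0]
    nlinarith
  have h := abs_sum_summand_residual_sub_le hn ht hD hDle
  have ep : ∑ j ∈ Finset.range n, scaleFun t (x j) = r * p := by
    rw [hp, normSum, ← hr]; field_simp
  have eq : ∑ j ∈ Finset.range n, shiftFun t (x j) = r * q := by
    rw [hq, normSum, ← hr]; field_simp
  have eM : ∑ j ∈ Finset.range n, x j ^ 4 = n * M := by
    rw [hM, fourthMoment]; field_simp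
  rw [ep, eq, eM, abs_mul, abs_mul, abs_of_pos hr0] at h
  have e3 : residualProcess n x t - linProcess n x t
      = (1 / r) * (∑ j ∈ Finset.range n, summand t (residual n x j)
        - ∑ j ∈ Finset.range n, linSummand t (x j)) := by
    rw [residualProcess_eq, linProcess, normSum, mul_sub]
  set K := linConst T with hK
  set C := 4 * T + 4 * T ^ 2 + 2 * T ^ 3 with hC
  have hC0 : 0 ≤ C := by positivity
  have hK0 : 0 ≤ K := by rw [hK, linConst]; positivity
  have hKeq : K = 32 * C + 2 + 6 * T := rfl
  have h2 : |∑ j ∈ Finset.range n, summand t (residual n x j)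
      - ∑ j ∈ Finset.range n, linSummand t (x j)| ≤ K * (B ^ 2 * (1 + M) + B * |p| + B * |q|) := by
    refine h.trans ?_
    have e4 : 32 * C * (B / r) ^ 2 * (n + n * M) + 2 * (B / r) * (r * |p| + r * |q|)
        + n * ((2 + 6 * T) * (B / r) ^ 2)
        = 32 * C * (B ^ 2 * (1 + M)) + 2 * (B * |p| + B * |q|) + (2 + 6 * T) * B ^ 2 := by
      rw [← hrr]; field_simp
    rw [e4, hKeq]
    have c1 : B ^ 2 ≤ B ^ 2 * (1 + M) := le_mul_of_one_le_right (sq_nonneg B) (by linarith)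
    have c2 := mul_le_mul_of_nonneg_left c1 (by positivity : 0 ≤ 2 + 6 * T)
    have c3 : 0 ≤ (32 * C + 6 * T) * (B * |p| + B * |q|) := by positivity
    linarith
  calc (residualProcess n x t - linProcess n x t) ^ 2
      = (1 / r) ^ 2 * |∑ j ∈ Finset.range n, summand t (residual n x j)
        - ∑ j ∈ Finset.range n, linSummand t (x j)| ^ 2 := by rw [e3, mul_pow, sq_abs]
    _ ≤ (1 / r) ^ 2 * (K * (B ^ 2 * (1 + M) + B * |p| + B * |q|)) ^ 2 := by gcongr
    _ = K ^ 2 / n * (B ^ 2 * (1 + M) + B * |p| + B * |q|) ^ 2 := by rw [← hrr]; field_simp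
    _ ≤ K ^ 2 / n * (3 * ((B ^ 2 * (1 + M)) ^ 2 + B ^ 2 * (p ^ 2 + q ^ 2))) := by
        gcongr
        have hp2 := sq_abs p
        have hq2 := sq_abs q
        nlinarith [sq_nonneg (B ^ 2 * (1 + M) - B * |p|), sq_nonneg (B ^ 2 * (1 + M) - B * |q|),
          sq_nonneg (B * |p| - B * |q|)]
    _ = _ := by ring

end Linearization

/-! ### The error of the linearization vanishes in probability -/

section Vanishing

open Topology

variable {Ω : Type*} [MeasurableSpace Ω] {P : Measure Ω} [IsProbabilityMeasure P]
  {X : ℕ → Ω → ℝ} {w : ℝ → ℝ}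

/-- The second moment of a normalized sum of centred summands of quadratic growth; the factor `6` is
`E (1 + X ^ 2) ^ 2`. -/
theorem lintegral_sq_normSum_le (hm : ∀ j, Measurable (X j))
    (hlaw : ∀ j, P.map (X j) = gaussianReal 0 1) (hindep : iIndepFun X P) {h : ℝ → ℝ}
    (hh : PolyGrowth h) (h0 : ∫ x, h x ∂(gaussianReal 0 1) = 0) {c : ℝ}
    (hc : ∀ x, |h x| ≤ c * (1 + x ^ 2)) (n : ℕ) :
    ∫⁻ ω, ENNReal.ofReal (normSum h n (fun j => X j ω) ^ 2) ∂P ≤ ENNReal.ofReal (6 * c ^ 2) := by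
  have hsq := hh.pow 2
  have hcont : Continuous h := hh.1
  have hmem : MemLp h 2 (gaussianReal 0 1) :=
    (memLp_two_iff_integrable_sq hcont.aestronglyMeasurable).2 hsq.integrable
  have hL2 : ∀ i, MemLp (fun ω => h (X i ω)) 2 P := fun i => by
    rw [← hlaw i] at hmem
    exact hmem.comp_of_map (hm i).aemeasurable
  have hbound : ∫ x, h x ^ 2 ∂(gaussianReal 0 1) ≤ 6 * c ^ 2 := by
    have hp : PolyGrowth fun x : ℝ => c ^ 2 * ((1 + 2 * x ^ 2) + x ^ 4) :=
      (((PolyGrowth.const 1).add ((PolyGrowth.id.pow 2).const_mul 2)).add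
        (PolyGrowth.id.pow 4)).const_mul _
    calc ∫ x, h x ^ 2 ∂(gaussianReal 0 1)
        ≤ ∫ x, c ^ 2 * ((1 + 2 * x ^ 2) + x ^ 4) ∂(gaussianReal 0 1) := by
          refine integral_mono hsq.integrable hp.integrable fun x => ?_
          have := pow_le_pow_left₀ (abs_nonneg _) (hc x) 2
          rw [sq_abs] at this
          simp only
          linarith
      _ = 6 * c ^ 2 := by
          rw [integral_const_mul, integral_add
            ((PolyGrowth.const 1).add ((PolyGrowth.id.pow 2).const_mul 2)).integrable
            (PolyGrowth.id.pow 4).integrable, integral_add (PolyGrowth.const 1).integrable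
            ((PolyGrowth.id.pow 2).const_mul 2).integrable, integral_const_mul,
            integral_sq_gaussianReal, integral_fourth_gaussianReal]
          simp
          ring
  have hmain := integral_norm_sq_inv_sqrt_smul_sum_le (P := P) (η := fun i ω => h (X i ω))
    (c := 6 * c ^ 2) hL2
    (fun i j hij => (hindep.indepFun hij).comp hcont.measurable hcont.measurable)
    (fun i => by
      rw [← integral_map (hm i).aemeasurable hcont.aestronglyMeasurable, hlaw i, h0])
    (fun i => by
      simp_rw [Real.norm_eq_abs, sq_abs]
      rw [← integral_map (f := fun x => h x ^ 2) (hm i).aemeasurable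
        (hcont.pow 2).aestronglyMeasurable, hlaw i]
      exact hbound) (by positivity) n
  have hmemS : MemLp (fun ω => normSum h n (fun j => X j ω)) 2 P :=
    (memLp_finsetSum _ fun i _ => hL2 i).const_mul _
  rw [← ofReal_integral_eq_lintegral_ofReal
    ((memLp_two_iff_integrable_sq hmemS.1).1 hmemS) (ae_of_all _ fun _ => sq_nonneg _)]
  refine ENNReal.ofReal_le_ofReal
    (le_of_eq_of_le (integral_congr_ae (ae_of_all _ fun ω => ?_)) hmain)
  simp only [normSum, one_div, smul_eq_mul, Real.norm_eq_abs, sq_abs]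

omit [IsProbabilityMeasure P] in
theorem lintegral_fourthMoment_le (hm : ∀ j, Measurable (X j))
    (hlaw : ∀ j, P.map (X j) = gaussianReal 0 1) (n : ℕ) :
    ∫⁻ ω, ENNReal.ofReal (fourthMoment n fun j => X j ω) ∂P ≤ 3 := by
  have h4 : ∀ j, Integrable (fun ω => X j ω ^ 4) P := fun j => by
    have := (PolyGrowth.id.pow 4).integrable
    rw [← hlaw j] at this
    exact this.comp_measurable (hm j)
  have h5 : ∀ j, ∫ ω, X j ω ^ 4 ∂P = 3 := fun j => by
    rw [← integral_map (f := fun x => x ^ 4) (hm j).aemeasurable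
      (by fun_prop), hlaw j, integral_fourth_gaussianReal]
  have hint : Integrable (fun ω => fourthMoment n fun j => X j ω) P :=
    (integrable_finsetSum _ fun j _ => h4 j).const_mul _
  rw [← ofReal_integral_eq_lintegral_ofReal hint (ae_of_all _ fun _ => fourthMoment_nonneg _ _)]
  unfold fourthMoment
  rw [integral_const_mul, integral_finsetSum _ fun j _ => h4 j]
  simp_rw [h5]
  rw [show (3 : ℝ≥0∞) = ENNReal.ofReal 3 by simp]
  apply ENNReal.ofReal_le_ofReal
  simp only [Finset.sum_const, Finset.card_range, nsmul_eq_mul]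
  rcases Nat.eq_zero_or_pos n with rfl | hn
  · simp
  · have : (n : ℝ) ≠ 0 := by positivity
    field_simp
    norm_num

theorem PolyGrowth.scaleFun (t : ℝ) : PolyGrowth (scaleFun t) :=
  (PolyGrowth.id.mul (.summandDeriv t)).add (.const _)

theorem PolyGrowth.shiftFun (t : ℝ) : PolyGrowth (shiftFun t) :=
  (PolyGrowth.summandDeriv t).sub (.const _)

theorem integral_scaleFun (t : ℝ) : ∫ x, scaleFun t x ∂(gaussianReal 0 1) = 0 := by
  unfold scaleFun
  rw [integral_add (PolyGrowth.id.mul (.summandDeriv t)).integrable (PolyGrowth.const _).integrable,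
    integral_id_mul_summandDeriv]
  simp

theorem integral_shiftFun (t : ℝ) : ∫ x, shiftFun t x ∂(gaussianReal 0 1) = 0 := by
  unfold shiftFun
  rw [integral_sub (PolyGrowth.summandDeriv t).integrable (PolyGrowth.const _).integrable,
    integral_summandDeriv]
  simp

theorem abs_scaleFun_le {t T : ℝ} (ht : |t| ≤ T) (x : ℝ) :
    |scaleFun t x| ≤ 4 * (1 + T ^ 2) * (1 + x ^ 2) := by
  have hT : 0 ≤ T := (abs_nonneg t).trans ht
  have ht2 : t ^ 2 ≤ T ^ 2 := by rw [← sq_abs]; exact pow_le_pow_left₀ (abs_nonneg t) ht 2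
  have hx := abs_nonneg x
  have hx2 := sq_abs x
  unfold scaleFun
  refine (abs_add_le _ _).trans ?_
  rw [abs_mul, abs_mul, abs_mul, abs_two, Real.abs_exp]
  have h1 : |x| * |summandDeriv t x| ≤ |x| * (2 * (1 + T ^ 2 + T * |x|)) :=
    mul_le_mul_of_nonneg_left ((abs_summandDeriv_le t x).trans (by gcongr)) hx
  have h2 : 2 * |t| * Real.exp (-t ^ 2 / 2) ≤ 2 * T * 1 := by
    gcongr
    exact exp_neg_sq_le_one t
  have h3 : 2 * T ≤ 1 + T ^ 2 := by nlinarith [sq_nonneg (T - 1)]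
  have h4 : 2 * |x| ≤ 1 + x ^ 2 := by nlinarith [sq_nonneg (|x| - 1)]
  have h5 : 2 * T * x ^ 2 ≤ (1 + T ^ 2) * x ^ 2 := mul_le_mul_of_nonneg_right h3 (sq_nonneg x)
  have h6 : (1 + T ^ 2) * (2 * |x|) ≤ (1 + T ^ 2) * (1 + x ^ 2) :=
    mul_le_mul_of_nonneg_left h4 (by positivity)
  nlinarith [mul_nonneg (sq_nonneg T) (sq_nonneg x), sq_nonneg x, sq_nonneg T]

theorem abs_shiftFun_le {t T : ℝ} (ht : |t| ≤ T) (x : ℝ) :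
    |shiftFun t x| ≤ 4 * (1 + T ^ 2) * (1 + x ^ 2) := by
  have hT : 0 ≤ T := (abs_nonneg t).trans ht
  have ht2 : t ^ 2 ≤ T ^ 2 := by rw [← sq_abs]; exact pow_le_pow_left₀ (abs_nonneg t) ht 2
  have hx := abs_nonneg x
  have hx2 := sq_abs x
  unfold shiftFun
  refine (abs_sub _ _).trans ?_
  rw [Real.abs_exp]
  have h1 : |summandDeriv t x| ≤ 2 * (1 + T ^ 2 + T * |x|) :=
    (abs_summandDeriv_le t x).trans (by gcongr)
  have h2 := exp_neg_sq_le_one t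
  have h3 : 2 * (T * |x|) ≤ T ^ 2 + x ^ 2 := by nlinarith [sq_nonneg (T - |x|)]
  nlinarith [mul_nonneg (sq_nonneg T) (sq_nonneg x), sq_nonneg x, sq_nonneg T]

/-- A random bound for the linearization error on `|t| ≤ T`; its expectation is bounded in `n`. -/
noncomputable def errorControl (w : ℝ → ℝ) (T : ℝ) (n : ℕ) (x : ℕ → ℝ) : ℝ≥0∞ :=
  ENNReal.ofReal (paramError n x ^ 2) + ENNReal.ofReal (fourthMoment n x)
    + ∫⁻ t in Set.Icc (-T) T, ENNReal.ofReal
      (normSum (scaleFun t) n x ^ 2 + normSum (shiftFun t) n x ^ 2) ∂(weightMeasure w)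

theorem measurable_normSum (hm : ∀ j, Measurable (X j)) {h : ℝ → ℝ} (hh : Measurable h) (n : ℕ) :
    Measurable fun ω => normSum h n fun j => X j ω := by
  unfold normSum; fun_prop

theorem measurable_normSum_uncurry (hm : ∀ j, Measurable (X j)) {φ : ℝ → ℝ → ℝ}
    (hφ : Continuous fun z : ℝ × ℝ => φ z.1 z.2) (n : ℕ) :
    Measurable fun z : Ω × ℝ => normSum (φ z.2) n fun j => X j z.1 := by
  unfold normSum
  have : ∀ j, Measurable fun z : Ω × ℝ => φ z.2 (X j z.1) := fun j =>
    hφ.measurable.comp (measurable_snd.prodMk ((hm j).comp measurable_fst))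
  fun_prop

theorem measurable_residual (hm : ∀ j, Measurable (X j)) (n j : ℕ) :
    Measurable fun ω => residual n (fun j => X j ω) j := by
  unfold residual sampleSD sampleMean; fun_prop

theorem continuous_scaleFun : Continuous fun z : ℝ × ℝ => scaleFun z.1 z.2 := by
  unfold scaleFun summandDeriv waveFun waveDeriv; fun_prop

theorem continuous_shiftFun : Continuous fun z : ℝ × ℝ => shiftFun z.1 z.2 := by
  unfold shiftFun summandDeriv waveFun waveDeriv; fun_prop

theorem measurable_paramError (hm : ∀ j, Measurable (X j)) (n : ℕ) :
    Measurable fun ω => paramError n fun j => X j ω := by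
  unfold paramError normSum; fun_prop

theorem measurable_fourthMoment (hm : ∀ j, Measurable (X j)) (n : ℕ) :
    Measurable fun ω => fourthMoment n fun j => X j ω := by
  unfold fourthMoment; fun_prop

theorem measurable_controlIntegrand (hm : ∀ j, Measurable (X j)) (n : ℕ) :
    Measurable fun z : Ω × ℝ => ENNReal.ofReal (normSum (scaleFun z.2) n (fun j => X j z.1) ^ 2
      + normSum (shiftFun z.2) n (fun j => X j z.1) ^ 2) :=
  (((measurable_normSum_uncurry hm continuous_scaleFun n).pow_const 2).add
    ((measurable_normSum_uncurry hm continuous_shiftFun n).pow_const 2)).ennreal_ofReal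

theorem measurable_errorControl (hw : IsWeight w) (hm : ∀ j, Measurable (X j)) (T : ℝ) (n : ℕ) :
    Measurable fun ω => errorControl w T n fun j => X j ω := by
  have := isFiniteMeasure_weightMeasure hw
  unfold errorControl
  exact ((measurable_paramError hm n).pow_const 2).ennreal_ofReal.add
    (measurable_fourthMoment hm n).ennreal_ofReal |>.add
    (measurable_controlIntegrand hm n).lintegral_prod_right'

theorem lintegral_errorControl_le (hw : IsWeight w) (hm : ∀ j, Measurable (X j))
    (hlaw : ∀ j, P.map (X j) = gaussianReal 0 1) (hindep : iIndepFun X P) (T : ℝ) (n : ℕ) :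
    ∫⁻ ω, errorControl w T n (fun j => X j ω) ∂P
      ≤ 24 + 3 + ENNReal.ofReal (192 * (1 + T ^ 2) ^ 2) * weightMeasure w Set.univ := by
  have := isFiniteMeasure_weightMeasure hw
  unfold errorControl
  have hm1 := ((measurable_paramError hm n).pow_const 2).ennreal_ofReal
  have hm2 : Measurable fun ω => ENNReal.ofReal (paramError n (fun j => X j ω) ^ 2)
      + ENNReal.ofReal (fourthMoment n fun j => X j ω) :=
    hm1.add (measurable_fourthMoment hm n).ennreal_ofReal
  rw [lintegral_add_left hm2, lintegral_add_left hm1]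
  refine add_le_add (add_le_add ?_ (lintegral_fourthMoment_le hm hlaw n)) ?_
  · have h1 := lintegral_sq_normSum_le hm hlaw hindep (h := fun x => x ^ 2 - 1) (c := 1)
      ((PolyGrowth.id.pow 2).sub (.const 1)) (by
        rw [integral_sub (PolyGrowth.id.pow 2).integrable (PolyGrowth.const 1).integrable,
          integral_sq_gaussianReal]
        simp) (fun x => by rw [abs_le]; constructor <;> nlinarith [sq_nonneg x]) n
    have h2 := lintegral_sq_normSum_le hm hlaw hindep (h := fun x => x) (c := 1)
      PolyGrowth.id integral_id_gaussianReal_std (fun x => by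
        rw [abs_le]; constructor <;> nlinarith [sq_nonneg (x - 1), sq_nonneg (x + 1)]) n
    calc ∫⁻ ω, ENNReal.ofReal (paramError n (fun j => X j ω) ^ 2) ∂P
        ≤ ∫⁻ ω, 2 * (ENNReal.ofReal (normSum (fun x => x ^ 2 - 1) n (fun j => X j ω) ^ 2)
          + ENNReal.ofReal (normSum (fun x => x) n (fun j => X j ω) ^ 2)) ∂P := by
          refine lintegral_mono fun ω => ?_
          rw [← ENNReal.ofReal_add (sq_nonneg _) (sq_nonneg _),
            show (2 : ℝ≥0∞) = ENNReal.ofReal 2 by simp, ← ENNReal.ofReal_mul (by norm_num)]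
          apply ENNReal.ofReal_le_ofReal
          rw [paramError, add_sq, sq_abs, sq_abs]
          nlinarith [sq_nonneg (|normSum (fun x => x ^ 2 - 1) n fun j => X j ω|
            - |normSum (fun x => x) n fun j => X j ω|),
            sq_abs (normSum (fun x => x ^ 2 - 1) n fun j => X j ω),
            sq_abs (normSum (fun x => x) n fun j => X j ω)]
      _ = 2 * (∫⁻ ω, ENNReal.ofReal (normSum (fun x => x ^ 2 - 1) n (fun j => X j ω) ^ 2) ∂P
          + ∫⁻ ω, ENNReal.ofReal (normSum (fun x => x) n (fun j => X j ω) ^ 2) ∂P) := by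
          have hma := ((measurable_normSum hm (h := fun x => x ^ 2 - 1)
            (by fun_prop) n).pow_const 2).ennreal_ofReal
          have hmb := ((measurable_normSum hm (h := fun x => x)
            (by fun_prop) n).pow_const 2).ennreal_ofReal
          rw [lintegral_const_mul' _ _ (by norm_num), lintegral_add_left hma]
      _ ≤ 2 * (ENNReal.ofReal (6 * 1 ^ 2) + ENNReal.ofReal (6 * 1 ^ 2)) := by gcongr
      _ = 24 := by norm_num
  · rw [lintegral_lintegral_swap (measurable_controlIntegrand hm n).aemeasurable]
    calc _ ≤ ∫⁻ _ in Set.Icc (-T) T, ENNReal.ofReal (192 * (1 + T ^ 2) ^ 2) ∂(weightMeasure w) := by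
          refine setLIntegral_mono measurable_const fun t ht => ?_
          have ht' : |t| ≤ T := abs_le.2 ht
          have h1 := lintegral_sq_normSum_le hm hlaw hindep (PolyGrowth.scaleFun t)
            (integral_scaleFun t) (abs_scaleFun_le ht') n
          have h2 := lintegral_sq_normSum_le hm hlaw hindep (PolyGrowth.shiftFun t)
            (integral_shiftFun t) (abs_shiftFun_le ht') n
          simp_rw [ENNReal.ofReal_add (sq_nonneg _) (sq_nonneg _)]
          rw [lintegral_add_left ((measurable_normSum hm
            (PolyGrowth.scaleFun t).1.measurable n).pow_const 2).ennreal_ofReal]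
          refine (add_le_add h1 h2).trans_eq ?_
          rw [← ENNReal.ofReal_add (by positivity) (by positivity)]
          congr 1
          ring
      _ ≤ _ := by
          rw [lintegral_const]
          gcongr
          exact Measure.restrict_le_self

/-- On `|t| ≤ T` the squared error of the linearization is of order `1 / n` when the random bound
`errorControl` is bounded. -/
theorem setLIntegral_core_le {T A : ℝ} (hA : 0 ≤ A) {n : ℕ} (hn : 0 < n) (hnA : 16 * A ≤ n)
    {x : ℕ → ℝ} (hx : errorControl w T n x ≤ ENNReal.ofReal A) :
    ∫⁻ t in Set.Icc (-T) T, ENNReal.ofReal ((residualProcess n x t - linProcess n x t) ^ 2)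
        ∂(weightMeasure w)
      ≤ ENNReal.ofReal (3 * linConst T ^ 2 / n) * (ENNReal.ofReal ((A * (1 + A)) ^ 2)
        * weightMeasure w Set.univ + ENNReal.ofReal A * ENNReal.ofReal A) := by
  have h1 : paramError n x ^ 2 ≤ A := by
    refine (ENNReal.ofReal_le_ofReal_iff hA).1 (le_trans ?_ hx)
    exact (le_add_right le_rfl).trans (le_add_right le_rfl)
  have h2 : fourthMoment n x ≤ A := by
    refine (ENNReal.ofReal_le_ofReal_iff hA).1 (le_trans ?_ hx)
    exact (le_add_left le_rfl).trans (le_add_right le_rfl)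
  have h3 : ∫⁻ t in Set.Icc (-T) T, ENNReal.ofReal
      (normSum (scaleFun t) n x ^ 2 + normSum (shiftFun t) n x ^ 2) ∂(weightMeasure w)
      ≤ ENNReal.ofReal A := (le_add_left le_rfl).trans hx
  have hmeas : Measurable fun t => ENNReal.ofReal
      (normSum (scaleFun t) n x ^ 2 + normSum (shiftFun t) n x ^ 2) := by
    have := (measurable_controlIntegrand (Ω := Unit) (X := fun j _ => x j)
      (fun _ => measurable_const) n).comp (measurable_prodMk_left (x := ()))
    exact this
  have hM0 := fourthMoment_nonneg n x
  calc _ ≤ ∫⁻ t in Set.Icc (-T) T, ENNReal.ofReal (3 * linConst T ^ 2 / n)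
        * (ENNReal.ofReal ((A * (1 + A)) ^ 2) + ENNReal.ofReal A * ENNReal.ofReal
          (normSum (scaleFun t) n x ^ 2 + normSum (shiftFun t) n x ^ 2)) ∂(weightMeasure w) := by
        refine setLIntegral_mono (by fun_prop) fun t ht => ?_
        rw [← ENNReal.ofReal_mul hA, ← ENNReal.ofReal_add (by positivity) (by positivity),
          ← ENNReal.ofReal_mul (by positivity)]
        apply ENNReal.ofReal_le_ofReal
        refine (sq_residualProcess_sub_linProcess_le hn (abs_le.2 ht) (by linarith)).trans ?_
        gcongr
    _ = ENNReal.ofReal (3 * linConst T ^ 2 / n) * (ENNReal.ofReal ((A * (1 + A)) ^ 2)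
        * (weightMeasure w).restrict (Set.Icc (-T) T) Set.univ
        + ENNReal.ofReal A * ∫⁻ t in Set.Icc (-T) T, ENNReal.ofReal
          (normSum (scaleFun t) n x ^ 2 + normSum (shiftFun t) n x ^ 2) ∂(weightMeasure w)) := by
        rw [lintegral_const_mul _ (by fun_prop), lintegral_add_left measurable_const,
          lintegral_const, lintegral_const_mul _ hmeas]
    _ ≤ _ := by
        gcongr
        exact Measure.restrict_le_self

theorem measurable_error (hm : ∀ j, Measurable (X j)) (n : ℕ) :
    Measurable fun z : Ω × ℝ => ENNReal.ofReal
      ((residualProcess n (fun j => X j z.1) z.2 - linProcess n (fun j => X j z.1) z.2) ^ 2) := by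
  have h1 := measurable_normSum_uncurry (fun j => measurable_residual hm n j)
    isAdmissible_summand.1 n
  have h2 := measurable_normSum_uncurry hm isAdmissible_linSummand.1 n
  exact ((h1.sub h2).pow_const 2).ennreal_ofReal

/-- A bound for the mean square of the linearization error that is uniform in `n`; it controls the
large values of `t`. -/
theorem lintegral_error_le (hm : ∀ j, Measurable (X j))
    (hlaw : ∀ j, P.map (X j) = gaussianReal 0 1) (hindep : iIndepFun X P) {n : ℕ} (hn : 4 ≤ n)
    (t : ℝ) :
    ∫⁻ ω, ENNReal.ofReal
      ((residualProcess n (fun j => X j ω) t - linProcess n (fun j => X j ω) t) ^ 2) ∂P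
      ≤ ENNReal.ofReal (2216 * (1 + t ^ 2)) := by
  have h1 := lintegral_sq_residualProcess_le hm hlaw hindep hn t
  have h2 := lintegral_sq_normSum_le hm hlaw hindep (PolyGrowth.linSummand t)
    (integral_linSummand t) (c := 3 * (1 + |t|)) (fun x => by linarith [abs_linSummand_le t x]) n
  have hmb : Measurable fun ω => ENNReal.ofReal (linProcess n (fun j => X j ω) t ^ 2) :=
    ((measurable_normSum hm (PolyGrowth.linSummand t).1.measurable n).pow_const 2).ennreal_ofReal
  calc _ ≤ ∫⁻ ω, 2 * (ENNReal.ofReal (residualProcess n (fun j => X j ω) t ^ 2)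
        + ENNReal.ofReal (linProcess n (fun j => X j ω) t ^ 2)) ∂P := by
        refine lintegral_mono fun ω => ?_
        rw [← ENNReal.ofReal_add (sq_nonneg _) (sq_nonneg _),
          show (2 : ℝ≥0∞) = ENNReal.ofReal 2 by simp, ← ENNReal.ofReal_mul (by norm_num)]
        apply ENNReal.ofReal_le_ofReal
        nlinarith [sq_nonneg (residualProcess n (fun j => X j ω) t
          + linProcess n (fun j => X j ω) t)]
    _ = 2 * (∫⁻ ω, ENNReal.ofReal (residualProcess n (fun j => X j ω) t ^ 2) ∂P
        + ∫⁻ ω, ENNReal.ofReal (linProcess n (fun j => X j ω) t ^ 2) ∂P) := by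
        rw [lintegral_const_mul' _ _ (by norm_num), lintegral_add_right _ hmb]
    _ ≤ 2 * (ENNReal.ofReal (1000 * (1 + t ^ 2)) + ENNReal.ofReal (6 * (3 * (1 + |t|)) ^ 2)) := by
        gcongr
        exact h2
    _ ≤ ENNReal.ofReal (2216 * (1 + t ^ 2)) := by
        rw [← ENNReal.ofReal_add (by positivity) (by positivity),
          show (2 : ℝ≥0∞) = ENNReal.ofReal 2 by simp, ← ENNReal.ofReal_mul (by norm_num)]
        apply ENNReal.ofReal_le_ofReal
        nlinarith [sq_abs t, sq_nonneg (|t| - 1)]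

theorem tendsto_setLIntegral_compl_Icc (hw : IsWeight w) (c : ℝ) :
    Tendsto (fun k : ℕ => ∫⁻ t in (Set.Icc (-(k : ℝ)) k)ᶜ, ENNReal.ofReal (c * (1 + t ^ 2))
      ∂(weightMeasure w)) atTop (𝓝 0) := by
  have hint : Integrable (fun t : ℝ => c * (1 + t ^ 2)) (weightMeasure w) :=
    (integrable_one_add_sq hw).const_mul c
  simp_rw [← lintegral_indicator measurableSet_Icc.compl]
  rw [← lintegral_zero (μ := weightMeasure w)]
  refine tendsto_lintegral_of_dominated_convergence (fun t => ENNReal.ofReal (c * (1 + t ^ 2)))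
    (fun k => Measurable.indicator (by fun_prop) measurableSet_Icc.compl)
    (fun k => ae_of_all _ fun t => Set.indicator_le_self _ _ t)
    hint.lintegral_lt_top.ne (ae_of_all _ fun t => ?_)
  refine tendsto_const_nhds.congr' ?_
  filter_upwards [tendsto_natCast_atTop_atTop.eventually_ge_atTop |t|] with k hk
  rw [Set.indicator_of_notMem]
  simpa [abs_le] using hk

/-- The linearization error tends to zero in probability in `L²`. The part `|t| > T` is small
uniformly in `n` for large `T`; on `|t| ≤ T` the error is of order `n⁻¹ᐟ²`. -/
theorem tendsto_measure_lintegral_error (hw : IsWeight w) (hm : ∀ j, Measurable (X j))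
    (hlaw : ∀ j, P.map (X j) = gaussianReal 0 1) (hindep : iIndepFun X P) {ε : ℝ} (hε : 0 < ε) :
    Tendsto (fun n : ℕ => P {ω | ENNReal.ofReal ε ≤ ∫⁻ t, ENNReal.ofReal
      ((residualProcess n (fun j => X j ω) t - linProcess n (fun j => X j ω) t) ^ 2)
        ∂(weightMeasure w)}) atTop (𝓝 0) := by
  have := isFiniteMeasure_weightMeasure hw
  set ν := weightMeasure w with hν
  set E : ℕ → Ω → ℝ → ℝ≥0∞ := fun n ω t => ENNReal.ofReal
      ((residualProcess n (fun j => X j ω) t - linProcess n (fun j => X j ω) t) ^ 2) with hE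
  have hε2 : ENNReal.ofReal (ε / 2) ≠ 0 := by simpa using hε
  rw [ENNReal.tendsto_nhds_zero]
  intro η hη
  have hη2 : η / 2 ≠ 0 := (ENNReal.half_pos hη.ne').ne'
  -- the cut-off `T = k`
  obtain ⟨k, hk⟩ := ((ENNReal.tendsto_nhds_zero.1 (tendsto_setLIntegral_compl_Icc hw 2216))
    (ENNReal.ofReal (ε / 2) * (η / 2)) (pos_iff_ne_zero.2 (mul_ne_zero hε2 hη2))).exists
  set s := Set.Icc (-(k : ℝ)) k with hs
  set L : ℝ≥0∞ := 24 + 3 + ENNReal.ofReal (192 * (1 + (k : ℝ) ^ 2) ^ 2) * ν Set.univ with hL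
  have hLtop : L ≠ ∞ := by
    rw [hL]
    exact ENNReal.add_ne_top.2 ⟨by norm_num, ENNReal.mul_ne_top ENNReal.ofReal_ne_top
      (measure_ne_top _ _)⟩
  -- the level `A` of the random bound
  obtain ⟨A, hA0, hA⟩ : ∃ A : ℝ, 0 < A ∧ L / ENNReal.ofReal A ≤ η / 2 := by
    have h1 : Tendsto (fun A : ℝ => L / ENNReal.ofReal A) atTop (𝓝 0) := by
      rw [← ENNReal.div_top (a := L)]
      exact ENNReal.Tendsto.const_div ENNReal.tendsto_ofReal_atTop (Or.inr hLtop)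
    obtain ⟨A, h2, h3⟩ := ((ENNReal.tendsto_nhds_zero.1 h1 (η / 2) (pos_iff_ne_zero.2 hη2)).and
      (eventually_gt_atTop 0)).exists
    exact ⟨A, h3, h2⟩
  have hcore : ∀ᶠ n : ℕ in atTop, ENNReal.ofReal (3 * linConst k ^ 2 / n)
      * (ENNReal.ofReal ((A * (1 + A)) ^ 2) * ν Set.univ + ENNReal.ofReal A * ENNReal.ofReal A)
      < ENNReal.ofReal (ε / 2) := by
    have h1 : Tendsto (fun n : ℕ => ENNReal.ofReal (3 * linConst k ^ 2 / n)
        * (ENNReal.ofReal ((A * (1 + A)) ^ 2) * ν Set.univ + ENNReal.ofReal A * ENNReal.ofReal A))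
        atTop (𝓝 0) := by
      have h2 := ENNReal.tendsto_ofReal (tendsto_const_div_atTop_nhds_zero_nat (3 * linConst k ^ 2))
      rw [ENNReal.ofReal_zero] at h2
      have h3 := ENNReal.Tendsto.mul_const (b := ENNReal.ofReal ((A * (1 + A)) ^ 2) * ν Set.univ
        + ENNReal.ofReal A * ENNReal.ofReal A) h2 (Or.inr (ENNReal.add_ne_top.2
          ⟨ENNReal.mul_ne_top ENNReal.ofReal_ne_top (measure_ne_top _ _),
            ENNReal.mul_ne_top ENNReal.ofReal_ne_top ENNReal.ofReal_ne_top⟩))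
      rwa [zero_mul] at h3
    exact h1.eventually_lt_const (pos_iff_ne_zero.2 hε2)
  filter_upwards [hcore, eventually_ge_atTop 4,
    tendsto_natCast_atTop_atTop.eventually_ge_atTop (16 * A)] with n hn hn4 hnA
  have htail : P {ω | ENNReal.ofReal (ε / 2) ≤ ∫⁻ t in sᶜ, E n ω t ∂ν} ≤ η / 2 := by
    have hmeas : Measurable fun ω => ∫⁻ t in sᶜ, E n ω t ∂ν :=
      (measurable_error hm n).lintegral_prod_right'
    refine (meas_ge_le_lintegral_div hmeas.aemeasurable hε2 ENNReal.ofReal_ne_top).trans ?_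
    rw [ENNReal.div_le_iff hε2 ENNReal.ofReal_ne_top, mul_comm,
      lintegral_lintegral_swap (measurable_error hm n).aemeasurable]
    exact (lintegral_mono fun t => lintegral_error_le hm hlaw hindep hn4 t).trans hk
  have hctrl : P {ω | ENNReal.ofReal A ≤ errorControl w k n fun j => X j ω} ≤ η / 2 :=
    (meas_ge_le_lintegral_div (measurable_errorControl hw hm k n).aemeasurable
      (by simpa using hA0) ENNReal.ofReal_ne_top).trans ((ENNReal.div_le_div_right
        (lintegral_errorControl_le hw hm hlaw hindep k n) _).trans hA)
  calc _ ≤ P ({ω | ENNReal.ofReal (ε / 2) ≤ ∫⁻ t in sᶜ, E n ω t ∂ν}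
        ∪ {ω | ENNReal.ofReal A ≤ errorControl w k n fun j => X j ω}) := by
        refine measure_mono fun ω hω => ?_
        by_contra hcon
        rw [Set.mem_union, not_or] at hcon
        simp only [Set.mem_ofPred_eq, not_le] at hcon hω
        have h1 := (setLIntegral_core_le hA0.le (by omega) hnA hcon.2.le).trans_lt hn
        have h2 : ∫⁻ t, E n ω t ∂ν
            = ∫⁻ t in s, E n ω t ∂ν + ∫⁻ t in sᶜ, E n ω t ∂ν :=
          (lintegral_add_compl _ measurableSet_Icc).symm
        have h3 := ENNReal.add_lt_add h1 hcon.1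
        rw [← ENNReal.ofReal_add (by positivity) (by positivity), add_halves] at h3
        exact absurd hω (not_le.2 (h2 ▸ h3))
    _ ≤ η / 2 + η / 2 := (measure_union_le _ _).trans (add_le_add htail hctrl)
    _ = η := ENNReal.add_halves η

end Vanishing

/-! ### The test statistic -/

section Statistic

variable {w : ℝ → ℝ}

theorem integrable_sq_residualProcess_mul (hw : IsWeight w) (n : ℕ) (x : ℕ → ℝ) :
    Integrable (fun t => residualProcess n x t ^ 2 * w t) volume :=
  (integrable_weightMeasure_iff hw).1
    ((memLp_two_iff_integrable_sq (memLp_residualProcess hw n x).1).1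
      (memLp_residualProcess hw n x))

/-- With `A(t)` and `B(t)` the real and imaginary parts of the sum in `Z_n`, one has
`W_n(± t) = n⁻¹ᐟ² (B(t) ± A(t))`. -/
theorem natCast_mul_norm_sq_eq (n : ℕ) (x : ℕ → ℝ) (t : ℝ) :
    n * ‖(1 / (n : ℂ)) * ∑ j ∈ Finset.range n,
      (Complex.I * (residual n x j : ℂ) + (t : ℂ)) *
        Complex.exp (Complex.I * (t : ℂ) * (residual n x j : ℂ))‖ ^ 2
      = (residualProcess n x t ^ 2 + residualProcess n x (-t) ^ 2) / 2 := by
  rcases Nat.eq_zero_or_pos n with rfl | hn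
  · simp [residualProcess]
  set A := ∑ j ∈ Finset.range n, (t * Real.cos (t * residual n x j)
    - residual n x j * Real.sin (t * residual n x j)) with hA
  set B := ∑ j ∈ Finset.range n, (residual n x j * Real.cos (t * residual n x j)
    + t * Real.sin (t * residual n x j)) with hB
  have hsum : ∑ j ∈ Finset.range n, (Complex.I * (residual n x j : ℂ) + (t : ℂ)) *
      Complex.exp (Complex.I * (t : ℂ) * (residual n x j : ℂ)) = A + B * Complex.I := by
    rw [hA, hB]
    push_cast
    rw [Finset.sum_mul, ← Finset.sum_add_distrib]
    refine Finset.sum_congr rfl fun j _ => ?_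
    rw [show Complex.I * (t : ℂ) * (residual n x j : ℂ)
      = ((t : ℂ) * (residual n x j : ℂ)) * Complex.I by ring, Complex.exp_mul_I]
    linear_combination (residual n x j : ℂ) * Complex.sin ((t : ℂ) * (residual n x j : ℂ))
      * Complex.I_sq
  have hp : residualProcess n x t = (1 / √n) * (B + A) := by
    rw [residualProcess, hA, hB, ← Finset.sum_add_distrib]
    congr 1
    exact Finset.sum_congr rfl fun j _ => by ring
  have hm : residualProcess n x (-t) = (1 / √n) * (B - A) := by
    rw [residualProcess, hA, hB, ← Finset.sum_sub_distrib]
    congr 1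
    refine Finset.sum_congr rfl fun j _ => ?_
    rw [neg_mul, Real.cos_neg, Real.sin_neg]
    ring
  have hn' : (n : ℝ) ≠ 0 := by positivity
  have hnorm : ‖(A : ℂ) + B * Complex.I‖ ^ 2 = A ^ 2 + B ^ 2 := by
    rw [← Complex.normSq_eq_norm_sq, Complex.normSq_add_mul_I]
  rw [hsum, norm_mul, mul_pow, hnorm, hp, hm, mul_pow, mul_pow, div_pow,
    Real.sq_sqrt (by positivity)]
  simp
  field_simp
  ring

/-- The mixed term `A B` is odd and the weight is even. -/
theorem testStatistic_eq_integral (hw : IsWeight w) (n : ℕ) (x : ℕ → ℝ) :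
    testStatistic w n x = ∫ t, residualProcess n x t ^ 2 * w t := by
  have hint := integrable_sq_residualProcess_mul hw n x
  have hneg : ∫ t, residualProcess n x (-t) ^ 2 * w (-t) = ∫ t, residualProcess n x t ^ 2 * w t :=
    integral_neg_eq_self (fun t => residualProcess n x t ^ 2 * w t) volume
  rw [testStatistic, ← integral_const_mul]
  calc _ = ∫ t, (residualProcess n x t ^ 2 * w t + residualProcess n x (-t) ^ 2 * w (-t)) / 2 := by
        refine integral_congr_ae (ae_of_all _ fun t => ?_)
        simp only
        rw [← mul_assoc, natCast_mul_norm_sq_eq, hw.even]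
        ring
    _ = _ := by
        rw [integral_div, integral_add hint hint.comp_neg, hneg]
        ring

theorem testStatistic_eq_norm_sq (hw : IsWeight w) (n : ℕ) (x : ℕ → ℝ) :
    testStatistic w n x = ‖residualElement hw n x‖ ^ 2 := by
  rw [testStatistic_eq_integral hw, ← integral_weightMeasure hw fun t => residualProcess n x t ^ 2]
  exact (norm_sq_eq_integral_of_ae_eq (MemLp.coeFn_toLp _)).symm

/-- The scaled residuals do not depend on the location and the scale of the sample. -/
theorem residual_affine {n : ℕ} (x : ℕ → ℝ) (m : ℝ) {s : ℝ} (hs : 0 < s) {j : ℕ}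
    (hj : j ∈ Finset.range n) :
    residual n (fun j => (x j - m) / s) j = residual n x j := by
  have hn : (n : ℝ) ≠ 0 := by
    have := Finset.mem_range.1 hj
    norm_cast
    omega
  have h1 : sampleMean n (fun j => (x j - m) / s) = (sampleMean n x - m) / s := by
    rw [sampleMean, sampleMean, ← Finset.sum_div, Finset.sum_sub_distrib]
    simp only [Finset.sum_const, Finset.card_range, nsmul_eq_mul]
    field_simp
  have h2 : ∀ j, (x j - m) / s - (sampleMean n x - m) / s = (x j - sampleMean n x) / s :=
    fun j => by ring
  have h3 : sampleSD n (fun j => (x j - m) / s) = sampleSD n x / s := by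
    rw [sampleSD, sampleSD, h1]
    simp_rw [h2, div_pow, ← Finset.sum_div]
    rw [← mul_div_assoc, Real.sqrt_div' _ (sq_nonneg s), Real.sqrt_sq hs.le]
  rw [residual, residual, h1, h3, h2, div_div_div_cancel_right₀ hs.ne']

theorem residualElement_affine (hw : IsWeight w) (n : ℕ) (x : ℕ → ℝ) (m : ℝ) {s : ℝ} (hs : 0 < s) :
    residualElement hw n (fun j => (x j - m) / s) = residualElement hw n x := by
  have : residualProcess n (fun j => (x j - m) / s) = residualProcess n x := by
    ext t
    rw [residualProcess_eq, residualProcess_eq]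
    congr 1
    exact Finset.sum_congr rfl fun j hj => by rw [residual_affine x m hs hj]
  simp_rw [residualElement, this]

end Statistic

/-! ### Convergence of the residual process -/

section Convergence

open Topology

variable {w : ℝ → ℝ}

theorem coeFn_inv_sqrt_smul_sum_toL2 {φ : ℝ → ℝ → ℝ} (hφ : IsAdmissible φ) (hw : IsWeight w) (n : ℕ)
    (x : ℕ → ℝ) :
    ((√(n : ℝ))⁻¹ • ∑ k ∈ Finset.range n, hφ.toL2 hw (x k) : L2w w)
      =ᵐ[weightMeasure w] fun t => normSum (φ t) n x := by
  have h1 : ∀ᵐ t ∂(weightMeasure w), ∀ k ∈ Finset.range n, hφ.toL2 hw (x k) t = φ t (x k) :=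
    (Finset.range n).eventually_all.2 fun k _ => hφ.coeFn_toL2 hw (x k)
  filter_upwards [h1, Lp.coeFn_smul (√(n : ℝ))⁻¹ (∑ k ∈ Finset.range n, hφ.toL2 hw (x k)),
    Lp.coeFn_finsetSum (Finset.range n) fun k => hφ.toL2 hw (x k)] with t h1 h2 h3
  rw [h2, Pi.smul_apply, h3, Finset.sum_apply, Finset.sum_congr rfl h1, normSum, one_div,
    smul_eq_mul]

theorem residualElement_eq (hw : IsWeight w) (n : ℕ) (x : ℕ → ℝ) :
    residualElement hw n x
      = (√(n : ℝ))⁻¹ • ∑ k ∈ Finset.range n, isAdmissible_summand.toL2 hw (residual n x k) := by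
  refine Lp.ext ?_
  refine (MemLp.coeFn_toLp _).trans ?_
  exact (coeFn_inv_sqrt_smul_sum_toL2 isAdmissible_summand hw n fun k => residual n x k).symm

variable {Ω : Type*} [MeasurableSpace Ω] {P : Measure Ω} [IsProbabilityMeasure P]

omit [IsProbabilityMeasure P] in
/-- A centred Gaussian random element is determined in law by its covariance kernel. -/
theorem IsCentredGaussianWithKernel.map_eq {W : Ω → L2w w} {K : ℝ → ℝ → ℝ}
    (hW : IsCentredGaussianWithKernel W P K) {μ : Measure (L2w w)} [IsGaussian μ]
    (h0 : ∫ x, x ∂μ = 0) (hcov : ∀ f g : L2w w, covarianceBilin μ f g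
      = ∫ s, ∫ t, f s * K s t * g t ∂(weightMeasure w) ∂(weightMeasure w)) :
    P.map W = μ := by
  have := hW.gaussian.isGaussian_map
  have hWm : AEMeasurable W P := hW.gaussian.aemeasurable
  refine IsGaussian.ext ?_ ?_
  · change ∫ x, x ∂(P.map W) = ∫ x, x ∂μ
    rw [h0]
    refine ext_inner_left ℝ fun f => ?_
    rw [inner_zero_right, ← integral_inner (f := fun x : L2w w => x) IsGaussian.integrable_id,
      integral_map hWm (by fun_prop)]
    exact hW.centred f
  · ext f g
    rw [hcov, covarianceBilin_apply_eq_cov IsGaussian.memLp_two_id, covariance_map (by fun_prop)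
      (by fun_prop) hWm]
    exact hW.covariance_eq f g

theorem isCentredGaussianWithKernel_id {K : ℝ → ℝ → ℝ} {μ : Measure (L2w w)} [IsGaussian μ]
    (h0 : ∫ x, x ∂μ = 0) (hcov : ∀ f g : L2w w, covarianceBilin μ f g
      = ∫ s, ∫ t, f s * K s t * g t ∂(weightMeasure w) ∂(weightMeasure w)) :
    IsCentredGaussianWithKernel (id : L2w w → L2w w) μ K where
  gaussian := ⟨by rw [Measure.map_id]; infer_instance⟩
  centred f := by
    simp only [id]
    rw [integral_inner (f := fun x : L2w w => x) IsGaussian.integrable_id, h0, inner_zero_right]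
  covariance_eq f g := by
    rw [← hcov, covarianceBilin_apply_eq_cov IsGaussian.memLp_two_id]
    rfl

/-- For standard normal observations the residual process and the linearized process have the same
limit in law. -/
theorem tendstoInDistribution_residualElement (hw : IsWeight w) {X : ℕ → Ω → ℝ}
    (hm : ∀ j, Measurable (X j)) (hlaw : ∀ j, P.map (X j) = gaussianReal 0 1)
    (hindep : iIndepFun X P) {Ω' : Type*} [MeasurableSpace Ω'] {P' : Measure Ω'}
    [IsProbabilityMeasure P'] {W : Ω' → L2w w} (hWm : AEMeasurable W P')
    {μ : ProbabilityMeasure (L2w w)} (hWμ : P'.map W = μ)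
    (hμ : ∀ V : ℕ → ProbabilityMeasure (L2w w),
      (∀ n : ℕ, (V n : Measure (L2w w)) = P.map fun ω =>
        (√(n : ℝ))⁻¹ • ∑ k ∈ Finset.range n, isAdmissible_linSummand.toL2 hw (X k ω)) →
      Tendsto V atTop (𝓝 μ)) :
    TendstoInDistribution (fun (n : ℕ) ω => residualElement hw n (fun j => X j ω)) atTop W
      (fun _ => P) P' := by
  have hlin : ∀ n : ℕ, Measurable fun ω =>
      (√(n : ℝ))⁻¹ • ∑ k ∈ Finset.range n, isAdmissible_linSummand.toL2 hw (X k ω) := fun n => by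
    have hk : ∀ k, Measurable fun ω => isAdmissible_linSummand.toL2 hw (X k ω) := fun k =>
      (isAdmissible_linSummand.continuous_toL2 hw).measurable.comp (hm k)
    exact Measurable.const_smul (M := ℝ) (Finset.measurable_sum (Finset.range n) fun k _ => hk k) _
  have hres : ∀ n : ℕ, Measurable fun ω => residualElement hw n (fun j => X j ω) := fun n => by
    simp_rw [residualElement_eq]
    have hk : ∀ k, Measurable fun ω =>
        isAdmissible_summand.toL2 hw (residual n (fun j => X j ω) k) := fun k =>
      (isAdmissible_summand.continuous_toL2 hw).measurable.comp (measurable_residual hm n k)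
    exact Measurable.const_smul (M := ℝ) (Finset.measurable_sum (Finset.range n) fun k _ => hk k) _
  refine tendstoInDistribution_of_tendstoInMeasure_sub (X := fun (n : ℕ) ω =>
    (√(n : ℝ))⁻¹ • ∑ k ∈ Finset.range n, isAdmissible_linSummand.toL2 hw (X k ω)) _ _
    ⟨fun n => (hlin n).aemeasurable, hWm, ?_⟩ ?_ fun n => (hres n).aemeasurable
  · have e : (⟨P'.map W, Measure.isProbabilityMeasure_map hWm⟩ : ProbabilityMeasure (L2w w)) = μ :=
      Subtype.ext hWμ
    rw [e]
    exact hμ _ fun n => rfl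
  · refine tendstoInMeasure_iff_norm.2 fun ε hε => ?_
    have h := tendsto_measure_lintegral_error hw hm hlaw hindep (pow_pos hε 2)
    refine h.congr fun n => ?_
    congr 1
    ext ω
    simp only [Set.mem_ofPred_eq, Pi.sub_apply, Pi.zero_apply, sub_zero]
    set d := residualElement hw n (fun j => X j ω)
      - (√(n : ℝ))⁻¹ • ∑ k ∈ Finset.range n, isAdmissible_linSummand.toL2 hw (X k ω) with hd
    have hae : d =ᵐ[weightMeasure w] fun t =>
        residualProcess n (fun j => X j ω) t - linProcess n (fun j => X j ω) t := by
      filter_upwards [Lp.coeFn_sub (residualElement hw n (fun j => X j ω))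
        ((√(n : ℝ))⁻¹ • ∑ k ∈ Finset.range n, isAdmissible_linSummand.toL2 hw (X k ω)),
        MemLp.coeFn_toLp (memLp_residualProcess hw n fun j => X j ω),
        coeFn_inv_sqrt_smul_sum_toL2 isAdmissible_linSummand hw n fun j => X j ω] with t h1 h2 h3
      rw [hd, h1, Pi.sub_apply, h3, linProcess]
      congr 1
    have hint : Integrable (fun t => (residualProcess n (fun j => X j ω) t
        - linProcess n (fun j => X j ω) t) ^ 2) (weightMeasure w) :=
      (((memLp_two_iff_integrable_sq (Lp.memLp d).1).1 (Lp.memLp d)).congr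
        (by filter_upwards [hae] with t ht; rw [ht]))
    rw [← ofReal_integral_eq_lintegral_ofReal hint (ae_of_all _ fun t => sq_nonneg _),
      ← norm_sq_eq_integral_of_ae_eq hae, ENNReal.ofReal_le_ofReal_iff (sq_nonneg _),
      pow_le_pow_iff_left₀ hε.le (norm_nonneg _) two_ne_zero]

omit [IsProbabilityMeasure P] in
/-- A sample from a normal law is, up to a change of location and scale and up to null sets, a
sample of measurable standard normal variables. -/
theorem exists_standardized {X : ℕ → Ω → ℝ} {m : ℝ} {v : ℝ≥0} (hv : v ≠ 0)
    (hlaw : ∀ j, HasLaw (X j) (gaussianReal m v) P) (hindep : iIndepFun X P) :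
    ∃ Y : ℕ → Ω → ℝ, (∀ j, Measurable (Y j)) ∧ (∀ j, P.map (Y j) = gaussianReal 0 1) ∧
      iIndepFun Y P ∧ ∀ᵐ ω ∂P, ∀ j, Y j ω = (X j ω - m) / √(v : ℝ) := by
  have hX : ∀ j, AEMeasurable (X j) P := fun j => (hlaw j).aemeasurable
  have hg : Measurable fun x : ℝ => (x - m) / √(v : ℝ) := by fun_prop
  refine ⟨fun j ω => ((hX j).mk (X j) ω - m) / √(v : ℝ), fun j => hg.comp (hX j).measurable_mk,
    fun j => ?_, ?_, ?_⟩
  · have h1 : P.map (fun ω => ((hX j).mk (X j) ω - m) / √(v : ℝ))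
        = ((P.map ((hX j).mk (X j))).map fun x => x - m).map fun x => x / √(v : ℝ) := by
      rw [Measure.map_map (by fun_prop) (hX j).measurable_mk, Measure.map_map (by fun_prop)
        (Measurable.comp (by fun_prop) (hX j).measurable_mk)]
      rfl
    rw [h1, Measure.map_congr (hX j).ae_eq_mk.symm, (hlaw j).map_eq, gaussianReal_map_sub_const,
      gaussianReal_map_div_const, sub_self, zero_div]
    congr 1
    have : (⟨√(v : ℝ) ^ 2, sq_nonneg _⟩ : ℝ≥0) = v := by
      ext; simp
    rw [show (NNReal.mk (√(v : ℝ) ^ 2) (sq_nonneg _)) = v from this, div_self hv]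
  · exact (hindep.congr fun j => (hX j).ae_eq_mk).comp (fun _ x => (x - m) / √(v : ℝ)) fun _ => hg
  · rw [ae_all_iff]
    intro j
    filter_upwards [(hX j).ae_eq_mk] with ω hω
    rw [hω]

end Convergence
end NormalityTest

theorem mainTheorem2 {w : ℝ → ℝ} (hw : NormalityTest.IsWeight w)
    {Ω : Type*} [MeasurableSpace Ω] (P : Measure Ω) [IsProbabilityMeasure P]
    (X : ℕ → Ω → ℝ) (m : ℝ) (v : ℝ≥0) (hv : v ≠ 0)
    (hlaw : ∀ j, HasLaw (X j) (gaussianReal m v) P) (hindep : iIndepFun X P) :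
    -- the two expressions for the test statistic agree
    (∀ (n : ℕ) (ω : Ω), NormalityTest.testStatistic w n (fun j => X j ω)
        = ∫ t, NormalityTest.residualProcess n (fun j => X j ω) t ^ 2 * w t) ∧
    -- the limiting Gaussian element exists
    (∃ (Ω' : Type) (_ : MeasurableSpace Ω') (P' : Measure Ω') (_ : IsProbabilityMeasure P')
        (W : Ω' → NormalityTest.L2w w),
      NormalityTest.IsCentredGaussianWithKernel W P' NormalityTest.kernelZ) ∧
    -- every version of it is the limit of `W_n`, and its squared norm is the limit of `Z_n`
    (∀ (Ω' : Type*) [MeasurableSpace Ω'] (P' : Measure Ω') [IsProbabilityMeasure P']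
        (W : Ω' → NormalityTest.L2w w),
      NormalityTest.IsCentredGaussianWithKernel W P' NormalityTest.kernelZ →
        TendstoInDistribution
          (fun (n : ℕ) ω => NormalityTest.residualElement hw n (fun j => X j ω))
          atTop W (fun _ => P) P' ∧
        (∀ ω, ∫ t, (W ω t) ^ 2 * w t = ‖W ω‖ ^ 2) ∧
        TendstoInDistribution
          (fun (n : ℕ) ω => NormalityTest.testStatistic w n (fun j => X j ω))
          atTop (fun ω => ∫ t, (W ω t) ^ 2 * w t) (fun _ => P) P') := by
  obtain ⟨Y, hYm, hYlaw, hYindep, hYX⟩ := NormalityTest.exists_standardized hv hlaw hindep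
  obtain ⟨μ, hμG, hμ0, hμcov, hμlim⟩ :=
    NormalityTest.exists_isGaussian_tendsto_linearized hw hYm hYlaw hYindep
  refine ⟨fun n ω => NormalityTest.testStatistic_eq_integral hw n _,
    ⟨NormalityTest.L2w w, inferInstance, μ, inferInstance, id,
      NormalityTest.isCentredGaussianWithKernel_id hμ0 hμcov⟩, ?_⟩
  intro Ω' _ P' _ W hW
  have hnorm : ∀ ω, ∫ t, (W ω t) ^ 2 * w t = ‖W ω‖ ^ 2 := fun ω => by
    rw [← NormalityTest.integral_weightMeasure hw fun t => W ω t ^ 2,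
      NormalityTest.norm_sq_eq_integral]
  have hY := NormalityTest.tendstoInDistribution_residualElement hw hYm hYlaw hYindep
    hW.gaussian.aemeasurable (hW.map_eq hμ0 hμcov) hμlim
  have hs : 0 < √(v : ℝ) := Real.sqrt_pos.2 (NNReal.coe_pos.2 (pos_iff_ne_zero.2 hv))
  have hconv : TendstoInDistribution
      (fun (n : ℕ) ω => NormalityTest.residualElement hw n (fun j => X j ω)) atTop W (fun _ => P)
      P' := by
    refine hY.congr (fun n => ?_) (ae_eq_refl _)
    filter_upwards [hYX] with ω hω
    simp_rw [hω]
    exact NormalityTest.residualElement_affine hw n _ m hs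
  refine ⟨hconv, hnorm, ?_⟩
  refine (hconv.continuous_comp (g := fun f : NormalityTest.L2w w => ‖f‖ ^ 2) (by fun_prop)).congr
    (fun n => ae_of_all _ fun ω => ?_) (ae_of_all _ fun ω => (hnorm ω).symm)
  exact (NormalityTest.testStatistic_eq_norm_sq hw n _).symm
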